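/- **Setting.** Let $p=k/m>0$, where $k,m$ are coprime positive integers and $m$ is odd; real powers are taken through the real $m$-th root, i.e. $v^{j/m}=(v^{1/m})^{j}$ for $v\in\mathbb R$. All functions are real-valued. Let $\mathscr H$ be the Hilbert transform in $x$, $\mathscr Hu=\mathrm{p.v.}\,\frac1\pi\int_{\mathbb R}\frac{u(z,y)}{x-z}\,dz$ (Fourier symbol $-i\,\mathrm{sgn}\,\xi_1$), let $\widehat{D_x^{1/2}\varphi}=|\xi_1|^{1/2}\widehat\varphi$, and let $\mathscr Z=\{\varphi\in L^2(\mathbb R^2): \|\varphi\|_{\mathscr Z}<\infty\}$ with $$\|\varphi\|_{\mathscr Z}^2=\|\varphi\|_{L^2}^2+\|\varphi_y\|_{L^2}^2+\|D_x^{1/2}\varphi\|_{L^2}^2 .$$ For $c>0$ and $\varphi\in\mathscr Z$ put $$I(\varphi)=\tfrac12\int_{\mathbb R^2}\big(c\varphi^2+\varphi\mathscr H\varphi_x+\varphi_y^2\big)\,dx\,dy,\qquad J(\varphi)=\int_{\mathbb R^2}\varphi^{p+2}\,dx\,dy,$$ where $\int\varphi\mathscr H\varphi_x$ means $\|D_x^{1/2}\varphi\|_{L^2}^2$,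 and for $\lambda\in\mathbb R$ put $I_\lambda=\inf\{I(\varphi):\varphi\in\mathscr Z,\ J(\varphi)=\lambda\}$ and $M_\lambda=\{\varphi\in\mathscr Z: I(\varphi)=I_\lambda,\ J(\varphi)=\lambda\}$. For $s>2$ and $0<T\le\infty$, an $H^s$ solution on $[0,T)$ of the BO-ZK equation (with $\alpha=-1$, $\varepsilon=1$) $$u_t+u^pu_x-\mathscr Hu_{xx}+u_{xyy}=0 \tag{1}$$ is a function $u\in C([0,T);H^s(\mathbb R^2))$ that satisfies (1) in the sense of distributions, where $u^pu_x=\big(\tfrac{1}{p+1}u^{p+1}\big)_x$. **Theorem 3.8.** Let $c>0$, $0<p<4/3$, $\lambda=(2(p+1)I_1)^{(p+2)/p}$ and $$\mathscr N_c=\{\varphi\in\mathscr Z:\ J(\varphi)=2(p+1)I(\varphi)=\lambda\}.$$ Then $\mathscr N_c=M_\lambda$, and $\mathscr N_c$ is $\mathscr Z$-stable under the flow of (1): for every $\epsilon>0$ there is $\delta>0$ such that, for every $s>2$, every $T\in(0,\infty]$ and every $H^s$ solution $u$ of (1) on $[0,T)$ with $\|u(0)-\varphi\|_{\mathscr Z}\le\delta$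 for some $\varphi\in\mathscr N_c$, $$\sup_{0\le t<T}\ \inf_{\psi\in\mathscr N_c}\|u(t)-\psi\|_{\mathscr Z}\le\epsilon .$$ -/

import Mathlib

noncomputable section

namespace BOZK

open MeasureTheory Filter Topology
open scoped ENNReal SchwartzMap FourierTransform LineDeriv

/-- The plane `ℝ²`; the coordinate `0` is `x` and the coordinate `1` is `y`. -/
abbrev Plane : Type := EuclideanSpace ℝ (Fin 2)

/-- Real-valued functions in `L²(ℝ²)`. -/
abbrev L2 : Type := Lp ℝ 2 (volume : Measure Plane)

/-- Unit vector in the direction `x`. -/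
def ex : Plane := EuclideanSpace.single 0 1

/-- Unit vector in the direction `y`. -/
def ey : Plane := EuclideanSpace.single 1 1

/-- A real `L²` function seen as a complex one. -/
def toComplex (u : L2) : Lp ℂ 2 (volume : Measure Plane) :=
  Complex.ofRealCLM.compLp u

/-- The `L²` Fourier transform. Mathlib's convention is `∫ e^{-2πi⟨x, ξ⟩} u(x) dx`, so the symbol
of `-i ∂_{x_j}` is `2π ξ_j`, and Plancherel's identity holds without a constant. -/
def fourierL2 (u : L2) : Lp ℂ 2 (volume : Measure Plane) := 𝓕 (toComplex u)

/-- `‖u_y‖²` in `L²`, with the value `∞` if the derivative is not in `L²`. -/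
def dySq (u : L2) : ℝ≥0∞ :=
  ∫⁻ ξ, ENNReal.ofReal ((2 * Real.pi * ξ 1) ^ 2) * ‖fourierL2 u ξ‖ₑ ^ 2

/-- `‖D_x^{1/2} u‖²` in `L²`, with the value `∞` if the fractional derivative is not in `L²`.
Since `𝓗∂_x` has the symbol `|2π ξ₀|`, this is also `∫ u 𝓗u_x`. -/
def dxHalfSq (u : L2) : ℝ≥0∞ :=
  ∫⁻ ξ, ENNReal.ofReal |2 * Real.pi * ξ 0| * ‖fourierL2 u ξ‖ₑ ^ 2

/-- The norm of the energy space `𝓩`, with the value `∞` outside of `𝓩`. -/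
def zNorm (u : L2) : ℝ≥0∞ :=
  (‖u‖ₑ ^ 2 + dySq u + dxHalfSq u) ^ (1 / 2 : ℝ)

/-- Membership in the energy space `𝓩 = H^{1/2,0} ∩ H^{0,1}`. -/
def MemZ (u : L2) : Prop := zNorm u < ∞

/-- The norm of the isotropic Sobolev space `H^s(ℝ²)`, `s ≥ 0`, with the value `∞` outside. -/
def hsNorm (s : ℝ) (u : L2) : ℝ≥0∞ :=
  (∫⁻ ξ, ENNReal.ofReal ((1 + ‖(2 * Real.pi) • ξ‖ ^ 2) ^ s) * ‖fourierL2 u ξ‖ₑ ^ 2) ^ (1 / 2 : ℝ)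

/-- The real power `x ^ (k / m)` for odd `m`: the `k`-th power of the real `m`-th root of `x`. -/
def oddPow (k m : ℕ) (x : ℝ) : ℝ :=
  (Real.sign x * |x| ^ (1 / (m : ℝ))) ^ k

/-- The symbol `-i sgn ξ₀` of the Hilbert transform in `x`. -/
def hilbertSymbol (ξ : Plane) : ℂ := -Complex.I * (Real.sign (ξ 0) : ℂ)

theorem memLp_hilbertSymbol_mul (f : Lp ℂ 2 (volume : Measure Plane)) :
    MemLp (fun ξ => hilbertSymbol ξ * f ξ) 2 (volume : Measure Plane) := by
  refine MemLp.of_le (Lp.memLp f) ?_ (Eventually.of_forall fun ξ => ?_)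
  · have hs : Measurable Real.sign := by
      unfold Real.sign
      exact Measurable.ite measurableSet_Iio measurable_const
        (Measurable.ite measurableSet_Ioi measurable_const measurable_const)
    have h0 : Measurable fun ξ : Plane => ξ 0 := by fun_prop
    have : Measurable hilbertSymbol :=
      (Complex.measurable_ofReal.comp (hs.comp h0)).const_mul _
    exact this.aestronglyMeasurable.mul (Lp.aestronglyMeasurable f)
  · rw [norm_mul]
    refine mul_le_of_le_one_left (norm_nonneg _) ?_
    rcases Real.sign_apply_eq (ξ 0) with h | h | h <;> simp [hilbertSymbol, h]

/-- The Hilbert transform in `x`, `𝓗u = p.v. (1/π) ∫ u(z, y) / (x - z) dz`, as the operator on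
`L²(ℝ²)` with the symbol `-i sgn ξ₀`. -/
def hilbert (u : L2) : Lp ℂ 2 (volume : Measure Plane) :=
  𝓕⁻ ((memLp_hilbertSymbol_mul (fourierL2 u)).toLp _)

/-- `I(φ) = ½ ∫ (c φ² + φ 𝓗φ_x + φ_y²)`, on `𝓩`. -/
def energyI (c : ℝ) (u : L2) : ℝ :=
  (1 / 2) * (c * ‖u‖ ^ 2 + (dxHalfSq u).toReal + (dySq u).toReal)

/-- `J(φ) = ∫ φ^{p+2}` with `p = k / m`. -/
def energyJ (k m : ℕ) (u : L2) : ℝ := ∫ x, oddPow (k + 2 * m) m (u x)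

/-- `I_lam = inf {I(φ) : φ ∈ 𝓩, J(φ) = lam}`. -/
def minI (k m : ℕ) (c lam : ℝ) : ℝ :=
  sInf {r : ℝ | ∃ u : L2, MemZ u ∧ energyJ k m u = lam ∧ energyI c u = r}

/-- The set of minimizers `M_lam = {φ ∈ 𝓩 : I(φ) = I_lam, J(φ) = lam}`. -/
def minimizers (k m : ℕ) (c lam : ℝ) : Set L2 :=
  {u | MemZ u ∧ energyI c u = minI k m c lam ∧ energyJ k m u = lam}

/-- The set `{φ ∈ 𝓩 : J(φ) = 2 (p + 1) I(φ) = lam}` with `p = k / m`. -/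
def groundSet (k m : ℕ) (c lam : ℝ) : Set L2 :=
  {u | MemZ u ∧ energyJ k m u = 2 * ((k : ℝ) / m + 1) * energyI c u ∧
    2 * ((k : ℝ) / m + 1) * energyI c u = lam}

/-- `u ∈ C([0, T); H^s(ℝ²))` solves
`u_t + u^p u_x + α 𝓗u_{xx} + ε u_{xyy} = 0`, `p = k / m`, in the sense of (tempered)
distributions on `ℝ²` for every `t ∈ [0, T)`, where `u^p u_x = (u^{p+1} / (p + 1))_x`.
The value `T = ⊤` is allowed and describes global solutions; at `t = 0` the time derivative is
one-sided. -/
structure IsSolution (k m : ℕ) (α ε s : ℝ) (T : EReal) (u : ℝ → L2) : Prop where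
  memHs : ∀ t : ℝ, 0 ≤ t → (t : EReal) < T → hsNorm s (u t) < ∞
  continuous : ∀ t : ℝ, 0 ≤ t → (t : EReal) < T →
    Tendsto (fun τ => hsNorm s (u τ - u t)) (𝓝[Set.Ici 0] t) (𝓝 0)
  equation : ∀ t : ℝ, 0 ≤ t → (t : EReal) < T → ∀ φ : 𝓢(Plane, ℂ),
    HasDerivWithinAt (fun τ => ∫ x, (u τ x : ℂ) * φ x)
      ((∫ x, ((oddPow (k + m) m (u t x) / ((k : ℝ) / m + 1) : ℝ) : ℂ) * (∂_{ex} φ) x)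
        - (α : ℂ) * (∫ x, hilbert (u t) x * (∂_{ex} (∂_{ex} φ)) x)
        + (ε : ℂ) * (∫ x, (u t x : ℂ) * (∂_{ex} (∂_{ey} (∂_{ey} φ))) x))
      (Set.Ici 0) t

end BOZK

end

/-! The equation is Hamiltonian: it reads `u_t = ∂ₓ E'(u)` with `E(u) = ½ ∫ (u 𝓗uₓ + u_y²) - J(u) /
((p+1)(p+2))`, so the mass `‖u‖²` and `E` are conserved. Stability then rests on two facts: (a) mass
and energy close to those of a minimizer force `I` and `J` to be close to `I_λ` and `λ`; (b) every
minimizing sequence converges in `𝓩` after translations.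

Scaling: `I` and `J` are homogeneous of degrees `2` and `p+2`, so `I_λ = λ^{2/(p+2)} I_1`, and the
given `λ` is the one with `λ = 2(p+1) I_λ`. The equality of the two sets is then immediate. With `S
= 2 I_λ` one gets `J(v) ≤ λ (2I(v)/S)^{(p+2)/2}` for every `v` (`IsLevel.energyJ_le`).

For (a), this inequality is applied to mass-preserving anisotropic dilates. At a minimizer both
sides touch, which yields the Pohozaev identities (`IsLevel.pohozaev`); they determine the mass and
both derivative seminorms, so all minimizers have the same mass and the same `E`. For general `v` a
good choice of dilation gives the sharp Gagliardo–Nirenberg inequality `J(v)/λ ≤ μ^{1-p/4} a^{p/2}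
b^{p/4}` (`IsLevel.energyJ_le_of_minimizer`), where `μ`, `a`, `b` are the ratios of mass,
`x`-seminorm and `y`-seminorm to those of a minimizer. In these variables `E` is a positive multiple
of `(p/2) a + (p/4) b - J/λ`. As `p < 4/3`, the third weight `1 - 3p/4` is positive, and a
quantitative inequality of the means (`variance_le_arith_sub_geom`) shows that `μ → 1` and
convergence of `E` force `a, b → 1` (`tendsto_one_of_defect`, `IsLevel.tendsto_of_energyE`).

For (b), `𝓩` embeds in `L^{10/3}` (`lintegral_rpow_le`), and `p + 2 < 10/3` is again `p < 4/3`. If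
the low frequency parts were uniformly small, so would be `J`; hence a low frequency part stays
large at some point (`IsLevel.exists_lowPart`). Moving that point to the origin makes the weak limit
`u` nonzero. Orthogonality splits `I`, Brezis–Lieb splits `J`, and if `t` is the share of `I`
carried by `u`, then `1 ≤ t^{(p+2)/2} + (1-t)^{(p+2)/2}`, so `t = 1` and the convergence is strong
(`IsLevel.tendsto_of_weak`, `IsLevel.exists_translate`).

The conservation laws have to be proved for solutions that are only `H^s` with `s > 2`. They are
tested on sharp frequency truncations, whose mass and energy change at a rate `O(R^{(1-s)/2})`,
which vanishes as the cutoff `R` tends to infinity (`eq_of_truncate`). `IsLevel.stable` combines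
everything by contradiction. -/

noncomputable section

namespace BOZK

open MeasureTheory Filter Topology
open scoped Pointwise ENNReal SchwartzMap FourierTransform LineDeriv

/-! ### The Fourier transform on `L²` -/

/-- Complex-valued functions in `L²(ℝ²)`. -/
abbrev CL2 : Type := Lp ℂ 2 (volume : Measure Plane)

theorem integral_fourier_mul (f : CL2) (ψ : 𝓢(Plane, ℂ)) :
    ∫ x, (𝓕 f : CL2) x * ψ x = ∫ x, f x * (𝓕 ψ) x := by
  have h := congrArg (fun T => T ψ) (Lp.fourier_toTemperedDistribution_eq f)
  simp only [TemperedDistribution.fourier_apply, Lp.toTemperedDistribution_apply] at h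
  simpa [smul_eq_mul, mul_comm] using h.symm

theorem integral_fourierInv_mul (f : CL2) (ψ : 𝓢(Plane, ℂ)) :
    ∫ x, (𝓕⁻ f : CL2) x * ψ x = ∫ x, f x * (𝓕⁻ ψ) x := by
  have h := congrArg (fun T => T ψ) (Lp.fourierInv_toTemperedDistribution_eq f)
  simp only [TemperedDistribution.fourierInv_apply, Lp.toTemperedDistribution_apply] at h
  simpa [smul_eq_mul, mul_comm] using h.symm

/-- An `L²` function is determined by its tempered distribution. Identities for the `L²` transform
are reduced in this way to Schwartz functions, where the transform is an integral. -/
theorem eq_of_integral_mul_schwartz {f g : CL2}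
    (h : ∀ ψ : 𝓢(Plane, ℂ), ∫ x, f x * ψ x = ∫ x, g x * ψ x) : f = g := by
  have : f - g ∈ LinearMap.ker (Lp.toTemperedDistributionCLM ℂ (volume : Measure Plane) 2 :
      CL2 →ₗ[ℂ] 𝓢'(Plane, ℂ)) := by
    rw [LinearMap.mem_ker]
    simp only [ContinuousLinearMap.coe_coe, map_sub]
    rw [sub_eq_zero]
    ext ψ
    simp only [Lp.toTemperedDistributionCLM_apply, Lp.toTemperedDistribution_apply, smul_eq_mul]
    simpa [mul_comm] using h ψ
  rw [Lp.ker_toTemperedDistributionCLM_eq_bot] at this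
  exact sub_eq_zero.1 ((Submodule.mem_bot ℂ).1 this)

theorem continuous_fourierInv {F : Plane → ℂ} (hF : Integrable F) :
    Continuous (𝓕⁻ F : Plane → ℂ) := by
  refine VectorFourier.fourierIntegral_continuous (L := -innerₗ Plane)
    Real.continuous_fourierChar ?_ hF
  have : Continuous fun p : Plane × Plane => -(inner ℝ p.1 p.2 : ℝ) := by fun_prop
  exact this

theorem integral_fourierInv_mul_of_integrable {F G : Plane → ℂ} (hF : Integrable F)
    (hG : Integrable G) : ∫ x, 𝓕⁻ F x * G x = ∫ x, F x * 𝓕⁻ G x := by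
  have := VectorFourier.integral_fourierIntegral_smul_eq_flip (𝕜 := ℝ) (e := Real.fourierChar)
    (μ := (volume : Measure Plane)) (ν := (volume : Measure Plane)) (L := -innerₗ Plane)
    (f := F) (g := G) Real.continuous_fourierChar ?_ hF hG
  · have e : ((-innerₗ Plane).flip) = -innerₗ Plane := by
      ext x y; simp [real_inner_comm]
    rw [e] at this
    exact this
  · have : Continuous fun p : Plane × Plane => -(inner ℝ p.1 p.2 : ℝ) := by fun_prop
    exact this

/-- On `L¹ ∩ L²` the inverse Fourier transform of `L²` is given by the integral. -/
theorem fourierInv_ae_eq {F : CL2} (hF : Integrable F) :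
    (𝓕⁻ F : CL2) =ᵐ[volume] (𝓕⁻ (F : Plane → ℂ) : Plane → ℂ) := by
  refine ae_eq_of_integral_contDiff_smul_eq
    ((Lp.memLp (𝓕⁻ F : CL2)).locallyIntegrable (by norm_num))
    (continuous_fourierInv hF).locallyIntegrable fun g hg hgc => ?_
  have hgc' : HasCompactSupport fun x => (g x : ℂ) := hgc.comp_left Complex.ofReal_zero
  let ψ : 𝓢(Plane, ℂ) := hgc'.toSchwartzMap (Complex.ofRealCLM.contDiff.comp hg)
  have h1 := integral_fourierInv_mul F ψ
  have h2 := integral_fourierInv_mul_of_integrable hF ψ.integrable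
  have e : ∀ x, ψ x = g x := fun x => rfl
  rw [SchwartzMap.fourierInv_coe, ← h2] at h1
  simp only [e] at h1
  simpa [mul_comm] using h1

theorem coeFn_toComplex (u : L2) : toComplex u =ᵐ[volume] fun x => (u x : ℂ) :=
  Complex.ofRealCLM.coeFn_compLp u

theorem toComplex_add (u v : L2) : toComplex (u + v) = toComplex u + toComplex v :=
  (Complex.ofRealCLM.compLpL 2 volume).map_add u v

theorem toComplex_sub (u v : L2) : toComplex (u - v) = toComplex u - toComplex v :=
  (Complex.ofRealCLM.compLpL 2 volume).map_sub u v

theorem toComplex_smul (r : ℝ) (u : L2) : toComplex (r • u) = r • toComplex u :=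
  (Complex.ofRealCLM.compLpL 2 volume).map_smul r u

theorem norm_toComplex (u : L2) : ‖toComplex u‖ = ‖u‖ := by
  rw [Lp.norm_def, Lp.norm_def]
  congr 1
  refine eLpNorm_congr_norm_ae ?_
  filter_upwards [coeFn_toComplex u] with x hx
  rw [hx, Complex.norm_real]

theorem fourierL2_add (u v : L2) : fourierL2 (u + v) = fourierL2 u + fourierL2 v := by
  rw [fourierL2, toComplex_add]
  exact (Lp.fourierTransformₗᵢ Plane ℂ).map_add _ _

theorem fourierL2_sub (u v : L2) : fourierL2 (u - v) = fourierL2 u - fourierL2 v := by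
  rw [fourierL2, toComplex_sub]
  exact (Lp.fourierTransformₗᵢ Plane ℂ).map_sub _ _

theorem fourierL2_smul (r : ℝ) (u : L2) : fourierL2 (r • u) = r • fourierL2 u := by
  rw [fourierL2, toComplex_smul]
  exact ((Lp.fourierTransformₗᵢ Plane ℂ).toLinearEquiv.toLinearMap.restrictScalars ℝ).map_smul r _

theorem norm_fourierL2 (u : L2) : ‖fourierL2 u‖ = ‖u‖ := by
  rw [fourierL2, Lp.norm_fourier_eq, norm_toComplex]

theorem fourierInv_fourierL2 (u : L2) : (𝓕⁻ (fourierL2 u) : CL2) = toComplex u :=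
  (Lp.fourierTransformₗᵢ Plane ℂ).symm_apply_apply _

theorem integral_fourierL2_mul (u : L2) (ψ : 𝓢(Plane, ℂ)) :
    ∫ x, fourierL2 u x * ψ x = ∫ x, (u x : ℂ) * (𝓕 ψ) x := by
  rw [fourierL2, integral_fourier_mul]
  refine integral_congr_ae ?_
  filter_upwards [coeFn_toComplex u] with x hx
  rw [hx]

theorem enorm_fourierL2 (u : L2) : ‖fourierL2 u‖ₑ = ‖u‖ₑ := by
  rw [← ofReal_norm, ← ofReal_norm, norm_fourierL2]

/-! ### Translations and dilations on the Fourier side -/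

/-- The translate `x ↦ u (x + a)`. -/
def translate (a : Plane) (u : L2) : L2 :=
  Lp.compMeasurePreserving (fun x => x + a) (measurePreserving_add_right volume a) u

theorem coeFn_translate (a : Plane) (u : L2) : translate a u =ᵐ[volume] fun x => u (x + a) :=
  Lp.coeFn_compMeasurePreserving u (measurePreserving_add_right volume a)

theorem fourier_apply_eq_schwartz (ψ : 𝓢(Plane, ℂ)) (x : Plane) :
    (𝓕 ψ) x = ∫ v, Real.fourierChar (-inner ℝ v x) • ψ v := by
  rw [SchwartzMap.fourier_coe, Real.fourier_eq]

theorem fourierL2_translate (a : Plane) (u : L2) :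
    fourierL2 (translate a u) =ᵐ[volume]
      fun ξ => (Real.fourierChar (inner ℝ ξ a) : ℂ) * fourierL2 u ξ := by
  have hb : MemLp (fun ξ => (Real.fourierChar (inner ℝ ξ a) : ℂ) * fourierL2 u ξ) 2
      (volume : Measure Plane) := by
    refine MemLp.of_le (Lp.memLp (fourierL2 u)) ?_ (Eventually.of_forall fun ξ => ?_)
    · refine AEStronglyMeasurable.mul (Continuous.aestronglyMeasurable ?_)
        (Lp.aestronglyMeasurable _)
      have : Continuous fun ξ : Plane => inner ℝ ξ a := by fun_prop
      exact continuous_subtype_val.comp (Real.continuous_fourierChar.comp this)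
    · rw [norm_mul, Circle.norm_coe, one_mul]
  suffices h : fourierL2 (translate a u) = hb.toLp _ by
    rw [h]; exact hb.coeFn_toLp
  refine eq_of_integral_mul_schwartz fun ψ => ?_
  -- Chosen so that its transform is a shift of `𝓕 ψ`; the shift of `u` is then absorbed by the
  -- translation invariance of the integral.
  let η : 𝓢(Plane, ℂ) := 𝓕⁻ (SchwartzMap.compSubConstCLM ℂ a (𝓕 ψ))
  have hη : ∀ ξ, η ξ = (Real.fourierChar (inner ℝ ξ a) : ℂ) * ψ ξ := by
    intro ξ
    have h1 : η ξ = ∫ v, Real.fourierChar (inner ℝ v ξ) • (𝓕 ψ) (v - a) := by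
      simp only [η]
      rw [SchwartzMap.fourierInv_coe, Real.fourierInv_eq]
      rfl
    have h2 : ψ ξ = ∫ v, Real.fourierChar (inner ℝ v ξ) • (𝓕 ψ) v := by
      have h3 : ψ = 𝓕⁻ (𝓕 ψ : 𝓢(Plane, ℂ)) := (FourierTransform.fourierInv_fourier_eq ψ).symm
      conv_lhs => rw [h3]
      rw [SchwartzMap.fourierInv_coe, Real.fourierInv_eq]
    rw [h1, h2, ← integral_const_mul]
    refine (integral_add_right_eq_self (μ := (volume : Measure Plane))
      (fun v => Real.fourierChar (inner ℝ v ξ) • (𝓕 ψ) (v - a)) a).symm.trans ?_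
    refine integral_congr_ae (Eventually.of_forall fun v => ?_)
    simp only [Circle.smul_def, smul_eq_mul, add_sub_cancel_right]
    rw [← mul_assoc, ← Circle.coe_mul, ← AddChar.map_add_eq_mul, inner_add_left,
      real_inner_comm ξ a, add_comm]
  have hFη : ∀ x, (𝓕 η) (x + a) = (𝓕 ψ) x := by
    intro x
    simp only [η]
    rw [FourierTransform.fourier_fourierInv_eq]
    simp [SchwartzMap.compSubConstCLM_apply]
  calc ∫ x, fourierL2 (translate a u) x * ψ x
      = ∫ x, (translate a u x : ℂ) * (𝓕 ψ) x := integral_fourierL2_mul _ _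
    _ = ∫ x, (u (x + a) : ℂ) * (𝓕 η) (x + a) := by
        refine integral_congr_ae ?_
        filter_upwards [coeFn_translate a u] with x hx
        rw [hx, hFη]
    _ = ∫ x, (u x : ℂ) * (𝓕 η) x :=
        integral_add_right_eq_self (fun x => (u x : ℂ) * (𝓕 η) x) a
    _ = ∫ x, fourierL2 u x * η x := (integral_fourierL2_mul _ _).symm
    _ = _ := by
        refine integral_congr_ae ?_
        filter_upwards [hb.coeFn_toLp] with x hx
        rw [hx, hη]
        ring

/-- The diagonal linear equivalence `(x, y) ↦ (α x, β y)`. -/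
def diag (α β : ℝ) (hα : α ≠ 0) (hβ : β ≠ 0) : Plane ≃L[ℝ] Plane :=
  LinearEquiv.toContinuousLinearEquiv
    { toFun := fun x => !₂[α * x 0, β * x 1]
      invFun := fun x => !₂[α⁻¹ * x 0, β⁻¹ * x 1]
      map_add' := fun x y => by ext i; fin_cases i <;> simp <;> ring
      map_smul' := fun r x => by ext i; fin_cases i <;> simp <;> ring
      left_inv := fun x => by ext i; fin_cases i <;> simp [hα, hβ]
      right_inv := fun x => by ext i; fin_cases i <;> simp [hα, hβ] }

section Dilation

variable {α β : ℝ} (hα : α ≠ 0) (hβ : β ≠ 0)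

@[simp] theorem diag_apply_zero (x : Plane) : diag α β hα hβ x 0 = α * x 0 := rfl

@[simp] theorem diag_apply_one (x : Plane) : diag α β hα hβ x 1 = β * x 1 := rfl

theorem diag_symm : (diag α β hα hβ).symm = diag α⁻¹ β⁻¹ (inv_ne_zero hα) (inv_ne_zero hβ) := by
  ext x i
  rfl

theorem inner_diag (x y : Plane) :
    inner ℝ (diag α β hα hβ x) y = (inner ℝ x (diag α β hα hβ y) : ℝ) := by
  simp only [PiLp.inner_apply, Fin.sum_univ_two, diag_apply_zero, diag_apply_one]
  simp
  ring

theorem det_diag : LinearMap.det (diag α β hα hβ : Plane →ₗ[ℝ] Plane) = α * β := by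
  have h : (diag α β hα hβ : Plane →ₗ[ℝ] Plane) =
      Matrix.toLin (EuclideanSpace.basisFun (Fin 2) ℝ).toBasis
        (EuclideanSpace.basisFun (Fin 2) ℝ).toBasis (Matrix.diagonal ![α, β]) := by
    refine (EuclideanSpace.basisFun (Fin 2) ℝ).toBasis.ext fun i => ?_
    rw [Matrix.toLin_self]
    ext j
    fin_cases i <;> fin_cases j <;> simp [diag, Matrix.diagonal]
  rw [h, LinearMap.det_toLin]
  simp

theorem map_diag_volume : Measure.map (diag α β hα hβ) (volume : Measure Plane) =
    ENNReal.ofReal |(α * β)⁻¹| • volume := by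
  have h := Measure.map_linearMap_addHaar_eq_smul_addHaar (volume : Measure Plane)
    (f := (diag α β hα hβ : Plane →ₗ[ℝ] Plane)) (by rw [det_diag]; exact mul_ne_zero hα hβ)
  rw [det_diag] at h
  exact h

theorem measurableEmbedding_diag : MeasurableEmbedding (diag α β hα hβ) :=
  (diag α β hα hβ).toHomeomorph.measurableEmbedding

theorem lintegral_comp_diag (g : Plane → ℝ≥0∞) :
    ∫⁻ x, g (diag α β hα hβ x) = ENNReal.ofReal |(α * β)⁻¹| * ∫⁻ x, g x := by
  rw [← (measurableEmbedding_diag hα hβ).lintegral_map, map_diag_volume, lintegral_smul_measure,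
    smul_eq_mul]

theorem integral_comp_diag {E : Type*} [NormedAddCommGroup E] [NormedSpace ℝ E] (g : Plane → E) :
    ∫ x, g (diag α β hα hβ x) = |(α * β)⁻¹| • ∫ x, g x := by
  rw [← (measurableEmbedding_diag hα hβ).integral_map, map_diag_volume, integral_smul_measure,
    ENNReal.toReal_ofReal (abs_nonneg _)]

theorem memLp_comp_diag {E : Type*} [NormedAddCommGroup E] {f : Plane → E}
    (hf : MemLp f 2 (volume : Measure Plane)) :
    MemLp (fun x => f (diag α β hα hβ x)) 2 (volume : Measure Plane) := by
  have : MemLp f 2 (Measure.map (diag α β hα hβ) (volume : Measure Plane)) := by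
    rw [map_diag_volume]
    exact hf.smul_measure ENNReal.ofReal_ne_top
  exact this.comp_of_map (measurableEmbedding_diag hα hβ).measurable.aemeasurable

/-- The dilate `(x, y) ↦ u (α x, β y)`. -/
def dilate (u : L2) : L2 := (memLp_comp_diag hα hβ (Lp.memLp u)).toLp _

theorem coeFn_dilate (u : L2) :
    dilate hα hβ u =ᵐ[volume] fun x => u (diag α β hα hβ x) :=
  (memLp_comp_diag hα hβ (Lp.memLp u)).coeFn_toLp

theorem fourierL2_dilate (u : L2) :
    fourierL2 (dilate hα hβ u) =ᵐ[volume]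
      fun ξ => (|(α * β)⁻¹| : ℝ) • fourierL2 u ((diag α β hα hβ).symm ξ) := by
  have hb : MemLp (fun ξ => (|(α * β)⁻¹| : ℝ) • fourierL2 u ((diag α β hα hβ).symm ξ)) 2
      (volume : Measure Plane) := by
    rw [diag_symm]
    exact (memLp_comp_diag _ _ (Lp.memLp (fourierL2 u))).const_smul |(α * β)⁻¹|
  suffices h : fourierL2 (dilate hα hβ u) = hb.toLp _ by
    rw [h]; exact hb.coeFn_toLp
  refine eq_of_integral_mul_schwartz fun ψ => ?_
  let η : 𝓢(Plane, ℂ) := SchwartzMap.compCLMOfContinuousLinearEquiv ℂ (diag α β hα hβ) ψ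
  have hη : ∀ ξ, η ξ = ψ (diag α β hα hβ ξ) := fun ξ => rfl
  have hFη : ∀ x, (𝓕 η) (diag α β hα hβ x) = |(α * β)⁻¹| • (𝓕 ψ) x := by
    intro x
    rw [fourier_apply_eq_schwartz, fourier_apply_eq_schwartz, ← integral_comp_diag hα hβ]
    refine integral_congr_ae (Eventually.of_forall fun v => ?_)
    simp only [hη, inner_diag]
  have hpos : |(α * β)⁻¹| ≠ 0 := abs_ne_zero.2 (inv_ne_zero (mul_ne_zero hα hβ))
  -- The Jacobian is kept on both sides and cancelled at the end: one copy comes from the transform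
  -- of the dilated test function, the other from the change of variables.
  have h1 : |(α * β)⁻¹| • ∫ x, fourierL2 (dilate hα hβ u) x * ψ x =
      |(α * β)⁻¹| • ∫ x, fourierL2 u x * η x := by
    calc |(α * β)⁻¹| • ∫ x, fourierL2 (dilate hα hβ u) x * ψ x
      = |(α * β)⁻¹| • ∫ x, (dilate hα hβ u x : ℂ) * (𝓕 ψ) x := by rw [integral_fourierL2_mul]
    _ = ∫ x, (u (diag α β hα hβ x) : ℂ) * (𝓕 η) (diag α β hα hβ x) := by
        rw [← integral_smul]
        refine integral_congr_ae ?_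
        filter_upwards [coeFn_dilate hα hβ u] with x hx
        rw [hx, hFη, mul_smul_comm]
    _ = |(α * β)⁻¹| • ∫ x, (u x : ℂ) * (𝓕 η) x :=
        integral_comp_diag hα hβ (fun x => (u x : ℂ) * (𝓕 η) x)
    _ = _ := by rw [integral_fourierL2_mul]
  rw [smul_right_inj hpos] at h1
  rw [h1]
  have h2 : ∫ x, hb.toLp _ x * ψ x =
      ∫ x, |(α * β)⁻¹| • (fourierL2 u ((diag α β hα hβ).symm x) * ψ x) := by
    refine integral_congr_ae ?_
    filter_upwards [hb.coeFn_toLp] with x hx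
    rw [hx, smul_mul_assoc]
  rw [h2, integral_smul, ← integral_comp_diag hα hβ]
  simp [hη]

end Dilation

/-! ### Fourier multipliers and the energy norm -/

section Multiplier

theorem lintegral_enorm_sq {E : Type*} [NormedAddCommGroup E]
    (f : Lp E 2 (volume : Measure Plane)) : ∫⁻ x, ‖f x‖ₑ ^ 2 = ‖f‖ₑ ^ 2 := by
  rw [Lp.enorm_def, eLpNorm_eq_lintegral_rpow_enorm_toReal two_ne_zero ENNReal.ofNat_ne_top]
  simp only [ENNReal.toReal_ofNat, ENNReal.rpow_ofNat, one_div]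
  rw [← ENNReal.rpow_natCast, ← ENNReal.rpow_mul]
  simp

theorem integrable_norm_sq {E : Type*} [NormedAddCommGroup E]
    (f : Lp E 2 (volume : Measure Plane)) : Integrable fun x => ‖f x‖ ^ 2 :=
  (Lp.memLp f).integrable_norm_pow two_ne_zero

theorem integral_norm_sq_eq {E : Type*} [NormedAddCommGroup E]
    (f : Lp E 2 (volume : Measure Plane)) : ∫ x, ‖f x‖ ^ 2 = ‖f‖ ^ 2 := by
  rw [integral_eq_lintegral_of_nonneg_ae (Eventually.of_forall fun x => by positivity)
    (integrable_norm_sq f).1]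
  have : ∀ x, ENNReal.ofReal (‖f x‖ ^ 2) = ‖f x‖ₑ ^ 2 := fun x => by
    rw [ENNReal.ofReal_pow (norm_nonneg _), ofReal_norm]
  simp only [this, lintegral_enorm_sq]
  simp

/-- `g` times `F` is square integrable. -/
def MemMul (g : Plane → ℂ) (F : CL2) : Prop :=
  MemLp (fun ξ => g ξ * F ξ) 2 (volume : Measure Plane)

open Classical in
/-- The product `g F` in `L²`, with the value `0` if it is not square integrable. -/
def mulFn (g : Plane → ℂ) (F : CL2) : CL2 :=
  if h : MemMul g F then MemLp.toLp _ h else 0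

variable {g h : Plane → ℂ} {F G : CL2}

theorem coeFn_mulFn (hg : MemMul g F) : mulFn g F =ᵐ[volume] fun ξ => g ξ * F ξ := by
  rw [mulFn, dif_pos hg]
  exact MemLp.coeFn_toLp hg

theorem MemMul.add (hF : MemMul g F) (hG : MemMul g G) : MemMul g (F + G) := by
  refine (MemLp.add hF hG).ae_eq ?_
  filter_upwards [Lp.coeFn_add F G] with ξ h
  simp only [h, Pi.add_apply, mul_add]

theorem MemMul.sub (hF : MemMul g F) (hG : MemMul g G) : MemMul g (F - G) := by
  refine (MemLp.sub hF hG).ae_eq ?_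
  filter_upwards [Lp.coeFn_sub F G] with ξ h
  simp only [h, Pi.sub_apply, mul_sub]

theorem MemMul.smul (hF : MemMul g F) (r : ℝ) : MemMul g (r • F) := by
  refine (MemLp.const_smul hF r).ae_eq ?_
  filter_upwards [Lp.coeFn_smul r F] with ξ h
  simp only [h, Pi.smul_apply, mul_smul_comm]

theorem mulFn_add (hF : MemMul g F) (hG : MemMul g G) :
    mulFn g (F + G) = mulFn g F + mulFn g G := by
  refine Lp.ext ?_
  filter_upwards [coeFn_mulFn hF, coeFn_mulFn hG, coeFn_mulFn (hF.add hG), Lp.coeFn_add F G,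
    Lp.coeFn_add (mulFn g F) (mulFn g G)] with ξ h1 h2 h3 h4 h5
  simp only [h1, h2, h3, h4, h5, Pi.add_apply, mul_add]

theorem mulFn_sub (hF : MemMul g F) (hG : MemMul g G) :
    mulFn g (F - G) = mulFn g F - mulFn g G := by
  refine Lp.ext ?_
  filter_upwards [coeFn_mulFn hF, coeFn_mulFn hG, coeFn_mulFn (hF.sub hG), Lp.coeFn_sub F G,
    Lp.coeFn_sub (mulFn g F) (mulFn g G)] with ξ h1 h2 h3 h4 h5
  simp only [h1, h2, h3, h4, h5, Pi.sub_apply, mul_sub]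

theorem mulFn_smul (hF : MemMul g F) (r : ℝ) : mulFn g (r • F) = r • mulFn g F := by
  refine Lp.ext ?_
  filter_upwards [coeFn_mulFn hF, coeFn_mulFn (hF.smul r), Lp.coeFn_smul r F,
    Lp.coeFn_smul r (mulFn g F)] with ξ h1 h3 h4 h5
  simp only [h1, h3, h4, h5, Pi.smul_apply, mul_smul_comm]

theorem memMul_of_bound (hg : Measurable g) {C : ℝ} (hC : ∀ ξ, ‖g ξ‖ ≤ C) (F : CL2) :
    MemMul g F := by
  refine MemLp.of_le_mul (c := C) (Lp.memLp F)
    (hg.aestronglyMeasurable.mul (Lp.aestronglyMeasurable F)) (Eventually.of_forall fun ξ => ?_)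
  rw [norm_mul]
  exact mul_le_mul_of_nonneg_right (hC ξ) (norm_nonneg _)

theorem MemMul.of_le (hF : MemMul g F) (hh : Measurable h) {C : ℝ}
    (hC : ∀ ξ, ‖h ξ‖ ≤ C * ‖g ξ‖) : MemMul h F := by
  refine MemLp.of_le_mul (c := C) hF
    (hh.aestronglyMeasurable.mul (Lp.aestronglyMeasurable F)) (Eventually.of_forall fun ξ => ?_)
  rw [norm_mul, norm_mul, ← mul_assoc]
  exact mul_le_mul_of_nonneg_right (hC ξ) (norm_nonneg _)

theorem memMul_mulFn_iff (hF : MemMul g F) :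
    MemMul h (mulFn g F) ↔ MemMul (fun ξ => h ξ * g ξ) F := by
  refine memLp_congr_ae ?_
  filter_upwards [coeFn_mulFn hF] with ξ h1
  rw [h1, mul_assoc]

theorem mulFn_mulFn (hF : MemMul g F) (hhg : MemMul (fun ξ => h ξ * g ξ) F) :
    mulFn h (mulFn g F) = mulFn (fun ξ => h ξ * g ξ) F := by
  refine Lp.ext ?_
  filter_upwards [coeFn_mulFn hF, coeFn_mulFn hhg,
    coeFn_mulFn ((memMul_mulFn_iff hF).2 hhg)] with ξ h1 h2 h3
  rw [h3, h2, h1, mul_assoc]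

theorem norm_mulFn_le (hF : MemMul g F) {C : ℝ} (hC : ∀ ξ, ‖g ξ‖ ≤ C) :
    ‖mulFn g F‖ ≤ C * ‖F‖ := by
  refine Lp.norm_le_mul_norm_of_ae_le_mul ?_
  filter_upwards [coeFn_mulFn hF] with ξ h1
  rw [h1, norm_mul]
  exact mul_le_mul_of_nonneg_right (hC ξ) (norm_nonneg _)

theorem norm_mulFn_le_mulFn (hF : MemMul g F) (hF' : MemMul h F) {C : ℝ}
    (hC : ∀ ξ, ‖h ξ‖ ≤ C * ‖g ξ‖) : ‖mulFn h F‖ ≤ C * ‖mulFn g F‖ := by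
  refine Lp.norm_le_mul_norm_of_ae_le_mul ?_
  filter_upwards [coeFn_mulFn hF, coeFn_mulFn hF'] with ξ h1 h2
  rw [h1, h2, norm_mul, norm_mul, ← mul_assoc]
  exact mul_le_mul_of_nonneg_right (hC ξ) (norm_nonneg _)

theorem enorm_mulFn_sq (hF : MemMul g F) :
    ‖mulFn g F‖ₑ ^ 2 = ∫⁻ ξ, ‖g ξ‖ₑ ^ 2 * ‖F ξ‖ₑ ^ 2 := by
  rw [← lintegral_enorm_sq]
  refine lintegral_congr_ae ?_
  filter_upwards [coeFn_mulFn hF] with ξ h1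
  rw [h1, enorm_mul, mul_pow]

theorem memMul_of_lintegral (hg : Measurable g)
    (hF : ∫⁻ ξ, ‖g ξ‖ₑ ^ 2 * ‖F ξ‖ₑ ^ 2 < ∞) : MemMul g F := by
  refine ⟨hg.aestronglyMeasurable.mul (Lp.aestronglyMeasurable F), ?_⟩
  rw [eLpNorm_lt_top_iff_lintegral_rpow_enorm_lt_top two_ne_zero ENNReal.ofNat_ne_top]
  simpa only [ENNReal.toReal_ofNat, ENNReal.rpow_ofNat, enorm_mul, mul_pow] using hF

theorem memMul_iff (hg : Measurable g) :
    MemMul g F ↔ ∫⁻ ξ, ‖g ξ‖ₑ ^ 2 * ‖F ξ‖ₑ ^ 2 < ∞ := by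
  refine ⟨fun hF => ?_, memMul_of_lintegral hg⟩
  rw [← enorm_mulFn_sq hF]
  exact ENNReal.pow_lt_top enorm_lt_top

theorem inner_mulFn_left (hF : MemMul g F) (hG : MemMul (fun ξ => (starRingEnd ℂ) (g ξ)) G) :
    (inner ℂ (mulFn g F) G : ℂ) = inner ℂ F (mulFn (fun ξ => (starRingEnd ℂ) (g ξ)) G) := by
  rw [L2.inner_def, L2.inner_def]
  refine integral_congr_ae ?_
  filter_upwards [coeFn_mulFn hF, coeFn_mulFn hG] with ξ h1 h2
  rw [h1, h2]
  simp only [RCLike.inner_apply, map_mul]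
  ring

/-- The weight `c + |2πξ₀| + (2πξ₁)²`. -/
def wt (c : ℝ) (ξ : Plane) : ℝ := c + |2 * Real.pi * ξ 0| + (2 * Real.pi * ξ 1) ^ 2

/-- The square root of the weight as a complex multiplier. -/
def sqwt (c : ℝ) (ξ : Plane) : ℂ := (√(wt c ξ) : ℝ)

theorem continuous_wt (c : ℝ) : Continuous (wt c) := by
  unfold wt
  fun_prop

theorem measurable_sqwt (c : ℝ) : Measurable (sqwt c) :=
  (Complex.continuous_ofReal.comp (Real.continuous_sqrt.comp (continuous_wt c))).measurable

theorem le_wt (c : ℝ) (ξ : Plane) : c ≤ wt c ξ := by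
  unfold wt
  have := abs_nonneg (2 * Real.pi * ξ 0)
  have := sq_nonneg (2 * Real.pi * ξ 1)
  linarith

theorem wt_pos {c : ℝ} (hc : 0 < c) (ξ : Plane) : 0 < wt c ξ := hc.trans_le (le_wt c ξ)

theorem enorm_sqwt_sq {c : ℝ} (hc : 0 ≤ c) (ξ : Plane) :
    ‖sqwt c ξ‖ₑ ^ 2 = ENNReal.ofReal (wt c ξ) := by
  rw [← ofReal_norm, ← ENNReal.ofReal_pow (norm_nonneg _), sqwt, Complex.norm_real, Real.norm_eq_abs,
    sq_abs, Real.sq_sqrt (hc.trans (le_wt c ξ))]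

theorem norm_sqwt_sq {c : ℝ} (hc : 0 ≤ c) (ξ : Plane) : ‖sqwt c ξ‖ ^ 2 = wt c ξ := by
  rw [sqwt, Complex.norm_real, Real.norm_eq_abs, sq_abs, Real.sq_sqrt (hc.trans (le_wt c ξ))]

theorem lintegral_wt {c : ℝ} (hc : 0 ≤ c) (u : L2) :
    ∫⁻ ξ, ‖sqwt c ξ‖ₑ ^ 2 * ‖fourierL2 u ξ‖ₑ ^ 2 =
      ENNReal.ofReal c * ‖u‖ₑ ^ 2 + dySq u + dxHalfSq u := by
  have hm : AEMeasurable (fun ξ => ‖fourierL2 u ξ‖ₑ ^ 2) (volume : Measure Plane) :=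
    (Lp.aestronglyMeasurable (fourierL2 u)).enorm.pow_const 2
  have e : ∀ ξ, ‖sqwt c ξ‖ₑ ^ 2 * ‖fourierL2 u ξ‖ₑ ^ 2 =
      ENNReal.ofReal c * ‖fourierL2 u ξ‖ₑ ^ 2 +
      ENNReal.ofReal ((2 * Real.pi * ξ 1) ^ 2) * ‖fourierL2 u ξ‖ₑ ^ 2 +
      ENNReal.ofReal |2 * Real.pi * ξ 0| * ‖fourierL2 u ξ‖ₑ ^ 2 := by
    intro ξ
    rw [enorm_sqwt_sq hc, wt, ENNReal.ofReal_add (by positivity) (by positivity),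
      ENNReal.ofReal_add hc (abs_nonneg _)]
    ring
  simp only [e]
  have m1 : Measurable fun ξ : Plane => ENNReal.ofReal ((2 * Real.pi * ξ 1) ^ 2) := by fun_prop
  have m2 : Measurable fun ξ : Plane => ENNReal.ofReal |2 * Real.pi * ξ 0| := by fun_prop
  have m1' := m1.aemeasurable.mul hm
  have m2' := m2.aemeasurable.mul hm
  simp only [Pi.mul_def] at m1' m2'
  rw [lintegral_add_right' _ m2', lintegral_add_right' _ m1', lintegral_const_mul'' _ hm, lintegral_enorm_sq, enorm_fourierL2, dySq, dxHalfSq]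

theorem memZ_iff (u : L2) : MemZ u ↔ dySq u < ∞ ∧ dxHalfSq u < ∞ := by
  rw [MemZ, zNorm, ENNReal.rpow_lt_top_iff_of_pos (by norm_num), ENNReal.add_lt_top,
    ENNReal.add_lt_top]
  have : ‖u‖ₑ ^ 2 < ∞ := ENNReal.pow_lt_top enorm_lt_top
  tauto

theorem memZ_iff_memMul {c : ℝ} (hc : 0 ≤ c) (u : L2) : MemZ u ↔ MemMul (sqwt c) (fourierL2 u) := by
  rw [memMul_iff (measurable_sqwt c), lintegral_wt hc, memZ_iff, ENNReal.add_lt_top,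
    ENNReal.add_lt_top]
  have : ENNReal.ofReal c * ‖u‖ₑ ^ 2 < ∞ :=
    ENNReal.mul_lt_top ENNReal.ofReal_lt_top (ENNReal.pow_lt_top enorm_lt_top)
  tauto

/-- The weighted transform of `u`, whose `L²` norm is the energy norm. -/
def zLift (c : ℝ) (u : L2) : CL2 := mulFn (sqwt c) (fourierL2 u)

theorem MemZ.memMul {u : L2} (hu : MemZ u) {c : ℝ} (hc : 0 ≤ c) : MemMul (sqwt c) (fourierL2 u) :=
  (memZ_iff_memMul hc u).1 hu

/-- By Plancherel, `I` becomes the square of a Hilbert norm, so that weak limits and orthogonal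
splitting apply to minimizing sequences. The case `c = 0` serves the quadratic part of `E`, the case
`c = 1` the norm of `𝓩`. -/
theorem norm_zLift_sq {c : ℝ} (hc : 0 ≤ c) {u : L2} (hu : MemZ u) :
    ‖zLift c u‖ ^ 2 = 2 * energyI c u := by
  have h := enorm_mulFn_sq (hu.memMul hc)
  rw [lintegral_wt hc] at h
  have h' := congrArg ENNReal.toReal h
  obtain ⟨h1, h2⟩ := (memZ_iff u).1 hu
  have h3 : ENNReal.ofReal c * ‖u‖ₑ ^ 2 < ∞ :=
    ENNReal.mul_lt_top ENNReal.ofReal_lt_top (ENNReal.pow_lt_top enorm_lt_top)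
  rw [ENNReal.toReal_add (ENNReal.add_lt_top.2 ⟨h3, h1⟩).ne h2.ne, ENNReal.toReal_add h3.ne h1.ne,
    ENNReal.toReal_mul, ENNReal.toReal_ofReal hc, ENNReal.toReal_pow, ENNReal.toReal_pow,
    toReal_enorm, toReal_enorm] at h'
  rw [zLift, h', energyI]
  ring

theorem zNorm_eq {u : L2} (hu : MemZ u) : zNorm u = ‖zLift 1 u‖ₑ := by
  have h := enorm_mulFn_sq (hu.memMul zero_le_one)
  rw [lintegral_wt zero_le_one, ENNReal.ofReal_one, one_mul] at h
  rw [zNorm, ← h, zLift, ← ENNReal.rpow_natCast, ← ENNReal.rpow_mul]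
  norm_num

theorem MemZ.add {u v : L2} (hu : MemZ u) (hv : MemZ v) : MemZ (u + v) := by
  rw [memZ_iff_memMul zero_le_one, fourierL2_add]
  exact (hu.memMul zero_le_one).add (hv.memMul zero_le_one)

theorem MemZ.sub {u v : L2} (hu : MemZ u) (hv : MemZ v) : MemZ (u - v) := by
  rw [memZ_iff_memMul zero_le_one, fourierL2_sub]
  exact (hu.memMul zero_le_one).sub (hv.memMul zero_le_one)

theorem MemZ.smul {u : L2} (hu : MemZ u) (r : ℝ) : MemZ (r • u) := by
  rw [memZ_iff_memMul zero_le_one, fourierL2_smul]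
  exact (hu.memMul zero_le_one).smul r

theorem zLift_sub {c : ℝ} (hc : 0 ≤ c) {u v : L2} (hu : MemZ u) (hv : MemZ v) :
    zLift c (u - v) = zLift c u - zLift c v := by
  rw [zLift, fourierL2_sub, mulFn_sub (hu.memMul hc) (hv.memMul hc)]
  rfl

/-- The scaling is carried out on the extended integrals, so no membership in `𝓩` is needed. -/
theorem energyI_smul (c r : ℝ) (u : L2) : energyI c (r • u) = r ^ 2 * energyI c u := by
  have hm : AEMeasurable (fun ξ => ‖fourierL2 u ξ‖ₑ ^ 2) (volume : Measure Plane) :=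
    (Lp.aestronglyMeasurable (fourierL2 u)).enorm.pow_const 2
  have key : ∀ w : Plane → ℝ≥0∞, Measurable w →
      ∫⁻ ξ, w ξ * ‖fourierL2 (r • u) ξ‖ₑ ^ 2 =
        ENNReal.ofReal (r ^ 2) * ∫⁻ ξ, w ξ * ‖fourierL2 u ξ‖ₑ ^ 2 := by
    intro w hw
    have hwm := hw.aemeasurable.mul hm
    simp only [Pi.mul_def] at hwm
    rw [← lintegral_const_mul'' _ hwm, fourierL2_smul]
    refine lintegral_congr_ae ?_
    filter_upwards [Lp.coeFn_smul r (fourierL2 u)] with ξ h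
    rw [h, Pi.smul_apply, enorm_smul, mul_pow, ← ofReal_norm r, ← ENNReal.ofReal_pow (norm_nonneg _),
      Real.norm_eq_abs, sq_abs]
    ring
  have h1 : dySq (r • u) = ENNReal.ofReal (r ^ 2) * dySq u := key _ (by fun_prop)
  have h2 : dxHalfSq (r • u) = ENNReal.ofReal (r ^ 2) * dxHalfSq u := key _ (by fun_prop)
  rw [energyI, energyI, h1, h2, norm_smul, ENNReal.toReal_mul, ENNReal.toReal_mul,
    ENNReal.toReal_ofReal (sq_nonneg r), mul_pow, Real.norm_eq_abs, sq_abs]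
  ring

end Multiplier

/-! ### Low and high frequencies, and the embedding into `L^{10/3}` -/

/-- The set of low frequencies. -/
def lowSet (R : ℝ) : Set Plane := {ξ | wt 1 ξ ≤ R}

theorem measurableSet_lowSet (R : ℝ) : MeasurableSet (lowSet R) :=
  measurableSet_le (continuous_wt 1).measurable measurable_const

/-- The set lies in the box `|ξ₀| ≤ R`, `|ξ₁| ≤ √R` of area `4 R^{3/2}`. This growth is what
produces the exponent `10/3`; the bound is written as a square because Cauchy–Schwarz will take its
root. -/
theorem volume_lowSet_le {R : ℝ} (hR : 0 ≤ R) :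
    volume (lowSet R) ≤ ENNReal.ofReal ((2 * R ^ (3 / 4 : ℝ)) ^ 2) := by
  have hsub : lowSet R ⊆ (@WithLp.ofLp 2 (Fin 2 → ℝ)) ⁻¹'
      (Set.pi Set.univ fun i => Set.Icc (-(![R, √R] i)) (![R, √R] i)) := by
    intro ξ hξ
    have hξ' : 1 + |2 * Real.pi * ξ 0| + (2 * Real.pi * ξ 1) ^ 2 ≤ R := hξ
    have hpi : 1 ≤ 2 * Real.pi := by linarith [Real.pi_gt_three]
    have h0 : |ξ 0| ≤ R := by
      rw [abs_mul, abs_of_pos (by positivity : 0 < 2 * Real.pi)] at hξ'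
      nlinarith [abs_nonneg (ξ 0), sq_nonneg (2 * Real.pi * ξ 1)]
    have h1 : |ξ 1| ≤ √R := by
      refine Real.le_sqrt_of_sq_le ?_
      rw [sq_abs]
      have : ξ 1 ^ 2 ≤ (2 * Real.pi * ξ 1) ^ 2 := by
        rw [mul_pow]
        exact le_mul_of_one_le_left (sq_nonneg _) (one_le_pow₀ hpi)
      linarith [abs_nonneg (2 * Real.pi * ξ 0)]
    simp only [Set.mem_preimage, Set.mem_pi, Set.mem_univ, true_imp_iff, Fin.forall_fin_two]
    exact ⟨abs_le.1 h0, abs_le.1 h1⟩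
  refine (measure_mono hsub).trans ?_
  rw [(PiLp.volume_preserving_ofLp (Fin 2)).measure_preimage
    (MeasurableSet.univ_pi fun i => measurableSet_Icc).nullMeasurableSet, volume_pi_pi]
  simp only [Fin.prod_univ_two, Real.volume_Icc]
  rw [← ENNReal.ofReal_mul (by simp; linarith)]
  refine ENNReal.ofReal_le_ofReal (le_of_eq ?_)
  have h2 : (R ^ (3 / 4 : ℝ)) ^ 2 = R * √R := by
    rw [← Real.rpow_natCast, ← Real.rpow_mul hR, Real.sqrt_eq_rpow]
    rcases hR.eq_or_lt with h | h
    · simp [← h]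
    · rw [← Real.rpow_one_add' hR (by norm_num)]
      norm_num
  simp only [Matrix.cons_val_zero, Matrix.cons_val_one]
  rw [mul_pow, h2]
  ring

open Classical in
/-- The characteristic function of the low frequencies. -/
def lowCut (R : ℝ) (ξ : Plane) : ℂ := if ξ ∈ lowSet R then 1 else 0

open Classical in
/-- The characteristic function of the high frequencies. -/
def highCut (R : ℝ) (ξ : Plane) : ℂ := if ξ ∈ lowSet R then 0 else 1

theorem measurable_lowCut (R : ℝ) : Measurable (lowCut R) :=
  Measurable.ite (measurableSet_lowSet R) measurable_const measurable_const

theorem measurable_highCut (R : ℝ) : Measurable (highCut R) :=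
  Measurable.ite (measurableSet_lowSet R) measurable_const measurable_const

theorem norm_lowCut_le (R : ℝ) (ξ : Plane) : ‖lowCut R ξ‖ ≤ 1 := by
  unfold lowCut; split_ifs <;> simp

theorem norm_highCut_le (R : ℝ) (ξ : Plane) : ‖highCut R ξ‖ ≤ 1 := by
  unfold highCut; split_ifs <;> simp

theorem memMul_lowCut (R : ℝ) (F : CL2) : MemMul (lowCut R) F :=
  memMul_of_bound (measurable_lowCut R) (norm_lowCut_le R) F

theorem memMul_highCut (R : ℝ) (F : CL2) : MemMul (highCut R) F :=
  memMul_of_bound (measurable_highCut R) (norm_highCut_le R) F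

theorem lowCut_add_highCut (R : ℝ) (F : CL2) :
    mulFn (lowCut R) F + mulFn (highCut R) F = F := by
  refine Lp.ext ?_
  filter_upwards [coeFn_mulFn (memMul_lowCut R F), coeFn_mulFn (memMul_highCut R F),
    Lp.coeFn_add (mulFn (lowCut R) F) (mulFn (highCut R) F)] with ξ h1 h2 h3
  rw [h3, Pi.add_apply, h1, h2, lowCut, highCut]
  split_ifs <;> simp

/-- Cauchy–Schwarz on a set of finite measure. It makes the low frequency part a bounded continuous
function. -/
theorem lintegral_lowCut_le {R : ℝ} (hR : 0 ≤ R) (F : CL2) :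
    ∫⁻ ξ, ‖mulFn (lowCut R) F ξ‖ₑ ≤ ENNReal.ofReal (2 * R ^ (3 / 4 : ℝ) * ‖F‖) := by
  have h1 : ∫⁻ ξ, ‖mulFn (lowCut R) F ξ‖ₑ = ∫⁻ ξ in lowSet R, ‖F ξ‖ₑ := by
    rw [← lintegral_indicator (measurableSet_lowSet R)]
    refine lintegral_congr_ae ?_
    filter_upwards [coeFn_mulFn (memMul_lowCut R F)] with ξ h
    rw [h, lowCut, Set.indicator]
    split_ifs <;> simp
  have h2 := eLpNorm_le_eLpNorm_mul_rpow_measure_univ (μ := volume.restrict (lowSet R))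
    (p := 1) (q := 2) (by norm_num) (Lp.aestronglyMeasurable F).restrict
  rw [eLpNorm_one_eq_lintegral_enorm] at h2
  rw [h1]
  refine h2.trans ?_
  rw [Measure.restrict_apply_univ, mul_comm, ENNReal.ofReal_mul (by positivity), ofReal_norm,
    Lp.enorm_def]
  refine mul_le_mul' ?_ (eLpNorm_mono_measure _ Measure.restrict_le_self)
  have h3 := ENNReal.rpow_le_rpow (volume_lowSet_le hR) (z := 1 / 2) (by norm_num)
  have e : (1 / (1 : ℝ≥0∞).toReal - 1 / (2 : ℝ≥0∞).toReal : ℝ) = 1 / 2 := by norm_num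
  rw [e]
  refine h3.trans (le_of_eq ?_)
  rw [ENNReal.ofReal_rpow_of_nonneg (by positivity) (by norm_num), ← Real.sqrt_eq_rpow,
    Real.sqrt_sq (by positivity)]

theorem integrable_lowCut (R : ℝ) (F : CL2) : Integrable (mulFn (lowCut R) F) := by
  refine ⟨Lp.aestronglyMeasurable _, ?_⟩
  by_cases hR : 0 ≤ R
  · exact (lintegral_lowCut_le hR F).trans_lt ENNReal.ofReal_lt_top
  · have hR' : lowSet R ⊆ lowSet 0 := fun ξ (hξ : _ ≤ R) => hξ.trans (not_le.1 hR).le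
    refine lt_of_le_of_lt ?_ ((lintegral_lowCut_le le_rfl F).trans_lt ENNReal.ofReal_lt_top)
    refine lintegral_mono_ae ?_
    filter_upwards [coeFn_mulFn (memMul_lowCut R F), coeFn_mulFn (memMul_lowCut 0 F)] with ξ h h'
    rw [h, h', lowCut, lowCut]
    split_ifs with h1 h2
    · exact le_rfl
    · exact absurd (hR' h1) h2
    · simp
    · simp

/-- The low frequency part of the function with Fourier transform `F`. -/
def lowPart (R : ℝ) (F : CL2) : Plane → ℂ := 𝓕⁻ (mulFn (lowCut R) F : Plane → ℂ)

theorem norm_fourierInv_le {F : Plane → ℂ} (hF : Integrable F) (x : Plane) :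
    ‖(𝓕⁻ F : Plane → ℂ) x‖ ≤ (∫⁻ ξ, ‖F ξ‖ₑ).toReal := by
  rw [← integral_norm_eq_lintegral_enorm hF.1]
  exact VectorFourier.norm_fourierIntegral_le_integral_norm _ _ _ _ _

theorem norm_lowPart_le {R : ℝ} (hR : 0 ≤ R) (F : CL2) (x : Plane) :
    ‖lowPart R F x‖ ≤ 2 * R ^ (3 / 4 : ℝ) * ‖F‖ := by
  refine (norm_fourierInv_le (integrable_lowCut R F) x).trans ?_
  exact ENNReal.toReal_le_of_le_ofReal (by positivity) (lintegral_lowCut_le hR F)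

theorem continuous_lowPart (R : ℝ) (F : CL2) : Continuous (lowPart R F) :=
  continuous_fourierInv (integrable_lowCut R F)

theorem lowPart_ae_eq (R : ℝ) (F : CL2) :
    (𝓕⁻ (mulFn (lowCut R) F) : CL2) =ᵐ[volume] lowPart R F :=
  fourierInv_ae_eq (integrable_lowCut R F)

theorem fourierInv_add' (F G : CL2) : (𝓕⁻ (F + G) : CL2) = 𝓕⁻ F + 𝓕⁻ G :=
  (Lp.fourierTransformₗᵢ Plane ℂ).symm.map_add F G

theorem norm_fourierInv (F : CL2) : ‖(𝓕⁻ F : CL2)‖ = ‖F‖ :=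
  (Lp.fourierTransformₗᵢ Plane ℂ).symm.norm_map F

theorem enorm_fourierInv (F : CL2) : ‖(𝓕⁻ F : CL2)‖ₑ = ‖F‖ₑ := by
  rw [← ofReal_norm, ← ofReal_norm, norm_fourierInv]

theorem fourierInv_ae_eq_lowPart_add (R : ℝ) (F : CL2) :
    (𝓕⁻ F : CL2) =ᵐ[volume] fun x => lowPart R F x + (𝓕⁻ (mulFn (highCut R) F) : CL2) x := by
  have h : (𝓕⁻ F : CL2) = 𝓕⁻ (mulFn (lowCut R) F) + 𝓕⁻ (mulFn (highCut R) F) := by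
    rw [← fourierInv_add', lowCut_add_highCut]
  rw [h]
  filter_upwards [lowPart_ae_eq R F, Lp.coeFn_add (𝓕⁻ (mulFn (lowCut R) F) : CL2)
    (𝓕⁻ (mulFn (highCut R) F))] with x h1 h2
  rw [h2, Pi.add_apply, h1]

theorem enorm_highCut_sq (R : ℝ) (F : CL2) :
    ‖mulFn (highCut R) F‖ₑ ^ 2 = ∫⁻ ξ, {ξ | R < wt 1 ξ}.indicator (fun ξ => ‖F ξ‖ₑ ^ 2) ξ := by
  rw [enorm_mulFn_sq (memMul_highCut R F)]
  refine lintegral_congr fun ξ => ?_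
  by_cases h : ξ ∈ lowSet R
  · have : ξ ∉ {ξ | R < wt 1 ξ} := fun h' => (not_lt.2 (show wt 1 ξ ≤ R from h)) h'
    rw [Set.indicator_of_notMem this, highCut, if_pos h]
    simp
  · have : ξ ∈ {ξ | R < wt 1 ξ} := not_le.1 (show ¬ wt 1 ξ ≤ R from h)
    rw [Set.indicator_of_mem this, highCut, if_neg h]
    simp

theorem lintegral_rpow_third {B : ℝ} (hB : 0 ≤ B) :
    ∫⁻ t in Set.Ioo 0 B, ENNReal.ofReal (4 * t ^ (1 / 3 : ℝ)) =
      ENNReal.ofReal (3 * B ^ (4 / 3 : ℝ)) := by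
  have hint : IntervalIntegrable (fun t : ℝ => 4 * t ^ (1 / 3 : ℝ)) volume 0 B :=
    (intervalIntegral.intervalIntegrable_rpow' (by norm_num)).const_mul 4
  rw [← ofReal_integral_eq_lintegral_ofReal]
  · rw [← integral_Ioc_eq_integral_Ioo, ← intervalIntegral.integral_of_le hB,
      intervalIntegral.integral_const_mul, integral_rpow (Or.inl (by norm_num))]
    congr 1
    rw [Real.zero_rpow (by norm_num)]
    norm_num
    ring
  · rw [intervalIntegrable_iff_integrableOn_Ioo_of_le hB] at hint
    exact hint
  · rw [EventuallyLE, ae_restrict_iff' measurableSet_Ioo]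
    exact Eventually.of_forall fun t ht => by
      have := ht.1.le
      simp only [Pi.zero_apply]
      positivity

/-- The cutoff depends on the level `t`: the low part never exceeds `t/2`, so the superlevel set is
controlled by the high part alone, through Chebyshev's inequality in `L²`. -/
theorem measure_lt_norm_le {F : CL2} (hF : 0 < ‖F‖) {t : ℝ} (ht : 0 < t) :
    volume {x | t < ‖(𝓕⁻ F : CL2) x‖} * ENNReal.ofReal (t ^ ((10 / 3 : ℝ) - 1)) ≤
      ENNReal.ofReal (4 * t ^ (1 / 3 : ℝ)) *
        ∫⁻ ξ, {ξ | (t / (4 * ‖F‖)) ^ (4 / 3 : ℝ) < wt 1 ξ}.indicator (fun ξ => ‖F ξ‖ₑ ^ 2) ξ := by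
  -- The solution of `2 R^{3/4} ‖F‖ = t / 2`.
  set R := (t / (4 * ‖F‖)) ^ (4 / 3 : ℝ) with hRdef
  have hR : 0 ≤ R := by positivity
  have hlow : ∀ x, ‖lowPart R F x‖ ≤ t / 2 := by
    intro x
    refine (norm_lowPart_le hR F x).trans (le_of_eq ?_)
    rw [hRdef, ← Real.rpow_mul (by positivity)]
    norm_num
    field_simp
    norm_num
  rw [← enorm_highCut_sq, ← enorm_fourierInv]
  set h : CL2 := 𝓕⁻ (mulFn (highCut R) F) with hh
  have h1 : volume {x | t < ‖(𝓕⁻ F : CL2) x‖} ≤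
      volume {x | ENNReal.ofReal ((t / 2) ^ 2) ≤ ‖h x‖ₑ ^ 2} := by
    refine measure_mono_ae ?_
    filter_upwards [fourierInv_ae_eq_lowPart_add R F] with x hx hx'
    have hx2 : t < ‖(𝓕⁻ F : CL2) x‖ := hx'
    rw [hx] at hx2
    have hx3 : t / 2 ≤ ‖h x‖ := by
      have := norm_add_le (lowPart R F x) (h x)
      linarith [hlow x]
    change ENNReal.ofReal ((t / 2) ^ 2) ≤ ‖h x‖ₑ ^ 2
    rw [← ofReal_norm, ← ENNReal.ofReal_pow (norm_nonneg _)]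
    exact ENNReal.ofReal_le_ofReal (by gcongr)
  have h2 := mul_meas_ge_le_lintegral₀ (μ := volume) (f := fun x => ‖h x‖ₑ ^ 2)
    ((Lp.aestronglyMeasurable h).enorm.pow_const 2) (ENNReal.ofReal ((t / 2) ^ 2))
  rw [lintegral_enorm_sq] at h2
  have e : ENNReal.ofReal (t ^ ((10 / 3 : ℝ) - 1)) =
      ENNReal.ofReal (4 * t ^ (1 / 3 : ℝ)) * ENNReal.ofReal ((t / 2) ^ 2) := by
    rw [← ENNReal.ofReal_mul (by positivity)]
    congr 1
    have : t ^ ((10 / 3 : ℝ) - 1) = t ^ (1 / 3 : ℝ) * t ^ (2 : ℕ) := by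
      rw [← Real.rpow_natCast, ← Real.rpow_add ht]
      norm_num
    rw [this]
    ring
  rw [e, mul_left_comm]
  gcongr
  refine le_trans ?_ h2
  rw [mul_comm]
  gcongr

/-- The embedding of the energy space into `L^{10/3}`. -/
theorem lintegral_rpow_le (F : CL2) :
    ∫⁻ x, ENNReal.ofReal (‖(𝓕⁻ F : CL2) x‖ ^ (10 / 3 : ℝ)) ≤
      ENNReal.ofReal (10 * (4 * ‖F‖) ^ (4 / 3 : ℝ)) *
        ∫⁻ ξ, ENNReal.ofReal (wt 1 ξ) * ‖F ξ‖ₑ ^ 2 := by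
  rcases (norm_nonneg F).eq_or_lt with h0 | hF
  · have hF0 : F = 0 := norm_eq_zero.1 h0.symm
    have hz : (𝓕⁻ F : CL2) = 0 := by
      rw [← norm_eq_zero, norm_fourierInv, ← h0]
    have : ∫⁻ x, ENNReal.ofReal (‖(𝓕⁻ F : CL2) x‖ ^ (10 / 3 : ℝ)) = 0 := by
      rw [hz]
      rw [lintegral_eq_zero_iff' (by
        exact ((Lp.aestronglyMeasurable (0 : CL2)).norm.aemeasurable.pow_const _).ennreal_ofReal)]
      filter_upwards [Lp.coeFn_zero ℂ 2 (volume : Measure Plane)] with x hx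
      rw [hx]
      simp only [Pi.zero_apply, norm_zero]
      rw [Real.zero_rpow (by norm_num)]
      simp
    rw [this]
    exact zero_le
  have hw : Measurable fun ξ => (wt 1 ξ) := (continuous_wt 1).measurable
  have hFm : AEMeasurable (fun ξ => ‖F ξ‖ₑ ^ 2) (volume : Measure Plane) :=
    (Lp.aestronglyMeasurable F).enorm.pow_const 2
  -- Layer-cake formula. After Fubini, a frequency `ξ` only sees the levels `t < 4 ‖F‖ wt(ξ)^{3/4}`,
  -- and integrating `4 t^{1/3}` up to there gives `3 (4‖F‖)^{4/3} wt(ξ)`: exactly one power of the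
  -- weight.
  rw [lintegral_rpow_eq_lintegral_meas_lt_mul volume
    (Eventually.of_forall fun x => norm_nonneg _) (Lp.aestronglyMeasurable _).norm.aemeasurable
    (by norm_num : (0 : ℝ) < 10 / 3)]
  have hmeasS : MeasurableSet {z : ℝ × Plane | (z.1 / (4 * ‖F‖)) ^ (4 / 3 : ℝ) < wt 1 z.2} := by
    refine measurableSet_lt ?_ (hw.comp measurable_snd)
    exact ((measurable_fst.div_const _).pow_const _)
  have hS : ∀ t > 0, ∀ ξ, ((t / (4 * ‖F‖)) ^ (4 / 3 : ℝ) < wt 1 ξ ↔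
      t < 4 * ‖F‖ * wt 1 ξ ^ (3 / 4 : ℝ)) := by
    intro t ht ξ
    have hp := wt_pos zero_lt_one ξ
    rw [← Real.lt_rpow_inv_iff_of_pos (by positivity) hp.le (by norm_num), div_lt_iff₀ (by positivity)]
    norm_num [mul_comm]
  calc ENNReal.ofReal (10 / 3) * ∫⁻ t in Set.Ioi (0 : ℝ), volume {x | t < ‖(𝓕⁻ F : CL2) x‖} *
        ENNReal.ofReal (t ^ ((10 / 3 : ℝ) - 1))
      ≤ ENNReal.ofReal (10 / 3) * ∫⁻ t in Set.Ioi (0 : ℝ), ∫⁻ ξ,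
          ENNReal.ofReal (4 * t ^ (1 / 3 : ℝ)) *
          {ξ | (t / (4 * ‖F‖)) ^ (4 / 3 : ℝ) < wt 1 ξ}.indicator (fun ξ => ‖F ξ‖ₑ ^ 2) ξ := by
        refine mul_le_mul' le_rfl ?_
        refine lintegral_mono_ae ((ae_restrict_iff' measurableSet_Ioi).2
          (Eventually.of_forall fun t ht => ?_))
        refine (measure_lt_norm_le hF ht).trans (le_of_eq ?_)
        rw [lintegral_const_mul'' _ (hFm.indicator (measurableSet_lt measurable_const hw))]
    _ = ENNReal.ofReal (10 / 3) * ∫⁻ ξ, ∫⁻ t in Set.Ioi (0 : ℝ),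
          ENNReal.ofReal (4 * t ^ (1 / 3 : ℝ)) *
          {ξ | (t / (4 * ‖F‖)) ^ (4 / 3 : ℝ) < wt 1 ξ}.indicator (fun ξ => ‖F ξ‖ₑ ^ 2) ξ := by
        rw [lintegral_lintegral_swap]
        refine AEMeasurable.mul (Measurable.aemeasurable ?_) ?_
        · exact ((measurable_fst.pow_const _).const_mul 4).ennreal_ofReal
        · have h1 : AEMeasurable (fun z : ℝ × Plane => ‖F z.2‖ₑ ^ 2)
            ((volume.restrict (Set.Ioi 0)).prod volume) := hFm.comp_snd
          exact h1.indicator hmeasS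
    _ = ENNReal.ofReal (10 / 3) * ∫⁻ ξ, ENNReal.ofReal (3 * (4 * ‖F‖) ^ (4 / 3 : ℝ) * wt 1 ξ) *
          ‖F ξ‖ₑ ^ 2 := by
        congr 1
        refine lintegral_congr fun ξ => ?_
        have hp := wt_pos zero_lt_one ξ
        have e1 : ∀ t ∈ Set.Ioi (0 : ℝ), ENNReal.ofReal (4 * t ^ (1 / 3 : ℝ)) *
            {ξ | (t / (4 * ‖F‖)) ^ (4 / 3 : ℝ) < wt 1 ξ}.indicator (fun ξ => ‖F ξ‖ₑ ^ 2) ξ =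
            (Set.Iio (4 * ‖F‖ * wt 1 ξ ^ (3 / 4 : ℝ))).indicator
              (fun t => ENNReal.ofReal (4 * t ^ (1 / 3 : ℝ))) t * ‖F ξ‖ₑ ^ 2 := by
          intro t ht
          simp only [Set.indicator, Set.mem_ofPred_eq, Set.mem_Iio, hS t ht ξ]
          split_ifs <;> simp
        rw [setLIntegral_congr_fun measurableSet_Ioi e1, lintegral_mul_const']
        · rw [setLIntegral_indicator measurableSet_Iio, Set.inter_comm, Set.Ioi_inter_Iio,
            lintegral_rpow_third (by positivity)]
          congr 2
          rw [Real.mul_rpow (by positivity) (by positivity), ← Real.rpow_mul hp.le]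
          norm_num
          ring
        · exact ENNReal.pow_ne_top enorm_ne_top
    _ = _ := by
        have e2 : ∀ ξ, ENNReal.ofReal (3 * (4 * ‖F‖) ^ (4 / 3 : ℝ) * wt 1 ξ) * ‖F ξ‖ₑ ^ 2 =
            ENNReal.ofReal (3 * (4 * ‖F‖) ^ (4 / 3 : ℝ)) *
              (ENNReal.ofReal (wt 1 ξ) * ‖F ξ‖ₑ ^ 2) := by
          intro ξ
          rw [ENNReal.ofReal_mul (by positivity), mul_assoc]
        simp only [e2]
        rw [lintegral_const_mul' _ _ ENNReal.ofReal_ne_top, ← mul_assoc,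
          ← ENNReal.ofReal_mul (by norm_num)]
        congr 2
        ring

/-! ### Powers with odd denominator and the pointwise Brezis–Lieb inequality -/

section OddPow

variable {j m : ℕ}

theorem abs_oddPow (hj : 0 < j) (hm : 0 < m) (x : ℝ) : |oddPow j m x| = |x| ^ ((j : ℝ) / m) := by
  have hm' : (0 : ℝ) < m := by exact_mod_cast hm
  have hj' : (0 : ℝ) < j := by exact_mod_cast hj
  rcases eq_or_ne x 0 with rfl | hx
  · rw [oddPow]
    simp only [Real.sign_zero, zero_mul, abs_zero]
    rw [zero_pow hj.ne', Real.zero_rpow (by positivity), abs_zero]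
  · have hs : |Real.sign x| = 1 := by
      rcases Real.sign_apply_eq_of_ne_zero x hx with h | h <;> simp [h]
    rw [oddPow, abs_pow, abs_mul, hs, one_mul, abs_of_nonneg (by positivity), ← Real.rpow_natCast,
      ← Real.rpow_mul (abs_nonneg x)]
    congr 1
    field_simp

theorem oddPow_zero (hj : 0 < j) : oddPow j m 0 = 0 := by
  simp [oddPow, Real.sign_zero, hj.ne']

theorem oddPow_of_pos {x : ℝ} (hx : 0 < x) : oddPow j m x = x ^ ((j : ℝ) / m) := by
  rw [oddPow, Real.sign_of_pos hx, one_mul, abs_of_pos hx, ← Real.rpow_natCast,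
    ← Real.rpow_mul hx.le]
  congr 1
  ring

theorem oddPow_of_neg {x : ℝ} (hx : x < 0) :
    oddPow j m x = (-1) ^ j * (-x) ^ ((j : ℝ) / m) := by
  rw [oddPow, Real.sign_of_neg hx, abs_of_neg hx, mul_pow, ← Real.rpow_natCast (_ ^ _),
    ← Real.rpow_mul (by linarith)]
  congr 2
  ring

theorem oddPow_mul {θ : ℝ} (hθ : 0 < θ) (x : ℝ) :
    oddPow j m (θ * x) = θ ^ ((j : ℝ) / m) * oddPow j m x := by
  have hs : Real.sign (θ * x) = Real.sign x := by
    rcases lt_trichotomy x 0 with h | h | h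
    · rw [Real.sign_of_neg h, Real.sign_of_neg (mul_neg_of_pos_of_neg hθ h)]
    · simp [h]
    · rw [Real.sign_of_pos h, Real.sign_of_pos (mul_pos hθ h)]
  rw [oddPow, oddPow, hs, abs_mul, abs_of_pos hθ, Real.mul_rpow hθ.le (abs_nonneg x),
    mul_left_comm, mul_pow, ← Real.rpow_natCast (θ ^ _), ← Real.rpow_mul hθ.le]
  congr 2
  ring

theorem oddPow_add (hm : Odd m) (x : ℝ) : oddPow (j + m) m x = oddPow j m x * x := by
  have hm' : (m : ℝ) ≠ 0 := by exact_mod_cast hm.pos.ne'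
  rw [oddPow, oddPow, pow_add]
  congr 1
  rw [mul_pow, ← Real.rpow_natCast (_ ^ _), ← Real.rpow_mul (abs_nonneg x),
    one_div_mul_cancel hm', Real.rpow_one]
  rcases lt_trichotomy x 0 with h | h | h
  · rw [Real.sign_of_neg h, abs_of_neg h, hm.neg_one_pow]
    ring
  · simp [h]
  · rw [Real.sign_of_pos h, abs_of_pos h, one_pow, one_mul]

theorem hasDerivAt_oddPow (hj : 0 < j) (hm : Odd m) (x : ℝ) :
    HasDerivAt (oddPow (j + m) m) (((j : ℝ) / m + 1) * oddPow j m x) x := by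
  have hm' : (0 : ℝ) < m := by exact_mod_cast hm.pos
  have hj' : (0 : ℝ) < j := by exact_mod_cast hj
  have he : ((j + m : ℕ) : ℝ) / m = (j : ℝ) / m + 1 := by
    push_cast
    field_simp
  rcases lt_trichotomy x 0 with h | h | h
  · have h1 : HasDerivAt (fun y : ℝ => (-1) ^ (j + m) * (-y) ^ ((j : ℝ) / m + 1))
        ((-1) ^ (j + m) * (((j : ℝ) / m + 1) * (-x) ^ ((j : ℝ) / m + 1 - 1) * -1)) x := by
      refine HasDerivAt.const_mul _ ?_
      have := (Real.hasDerivAt_rpow_const (p := (j : ℝ) / m + 1) (x := -x)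
        (Or.inl (by linarith))).comp x (hasDerivAt_neg x)
      exact this
    have h2 : oddPow (j + m) m =ᶠ[𝓝 x]
        fun y : ℝ => (-1) ^ (j + m) * (-y) ^ ((j : ℝ) / m + 1) := by
      filter_upwards [Iio_mem_nhds h] with y hy
      rw [oddPow_of_neg hy, he]
    refine (h1.congr_of_eventuallyEq h2).congr_deriv ?_
    rw [oddPow_of_neg h, pow_add, hm.neg_one_pow, add_sub_cancel_right]
    ring
  -- At the origin the difference quotient of the power `j/m + 1` at `t` is the power `j/m` of `t`,
  -- which tends to `0` because `j > 0`.
  · subst h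
    rw [oddPow_zero hj, mul_zero, hasDerivAt_iff_tendsto_slope_zero]
    have hlim : Tendsto (fun t : ℝ => oddPow j m t) (𝓝[≠] 0) (𝓝 0) := by
      rw [tendsto_zero_iff_abs_tendsto_zero]
      have : Tendsto (fun t : ℝ => |t| ^ ((j : ℝ) / m)) (𝓝 0) (𝓝 0) := by
        have hc : Continuous fun t : ℝ => |t| ^ ((j : ℝ) / m) :=
          continuous_abs.rpow_const fun _ => Or.inr (by positivity)
        have := hc.tendsto 0
        simpa [Real.zero_rpow (by positivity : (j : ℝ) / m ≠ 0)] using this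
      refine (this.mono_left nhdsWithin_le_nhds).congr fun t => ?_
      simp [abs_oddPow hj hm.pos]
    refine hlim.congr' ?_
    filter_upwards [self_mem_nhdsWithin] with t ht
    have ht' : t ≠ 0 := ht
    rw [zero_add, oddPow_zero (by omega), sub_zero, oddPow_add hm, smul_eq_mul]
    field_simp
  · have h1 := Real.hasDerivAt_rpow_const (p := (j : ℝ) / m + 1) (x := x) (Or.inl h.ne')
    have h2 : oddPow (j + m) m =ᶠ[𝓝 x] fun y : ℝ => y ^ ((j : ℝ) / m + 1) := by
      filter_upwards [Ioi_mem_nhds h] with y hy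
      rw [oddPow_of_pos hy, he]
    refine (h1.congr_of_eventuallyEq h2).congr_deriv ?_
    rw [oddPow_of_pos h, add_sub_cancel_right]

theorem continuous_oddPow (hj : 0 < j) (hm : Odd m) : Continuous (oddPow (j + m) m) :=
  continuous_iff_continuousAt.2 fun x => (hasDerivAt_oddPow hj hm x).continuousAt

end OddPow

/-- A continuous function that is positively homogeneous of degree `q`, with `|f x| = |x| ^ q`. -/
structure IsPower (q : ℝ) (f : ℝ → ℝ) : Prop where
  continuous : Continuous f
  abs_eq : ∀ x, |f x| = |x| ^ q
  homog : ∀ θ > 0, ∀ x, f (θ * x) = θ ^ q * f x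

theorem isPower_oddPow {k m : ℕ} (hk : 0 < k) (hm : Odd m) :
    IsPower ((k : ℝ) / m + 2) (oddPow (k + 2 * m) m) := by
  have hm' : (0 : ℝ) < m := by exact_mod_cast hm.pos
  have he : ((k + 2 * m : ℕ) : ℝ) / m = (k : ℝ) / m + 2 := by
    push_cast
    field_simp
  refine ⟨?_, fun x => ?_, fun θ hθ x => ?_⟩
  · have : k + 2 * m = (k + m) + m := by ring
    rw [this]
    exact continuous_oddPow (by omega) hm
  · rw [abs_oddPow (by omega) hm.pos, he]
  · rw [oddPow_mul hθ, he]

theorem rpow_add_le {q : ℝ} (hq : 0 ≤ q) {a b : ℝ} (ha : 0 ≤ a) (hb : 0 ≤ b) :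
    (a + b) ^ q ≤ 2 ^ q * (a ^ q + b ^ q) := by
  have h1 : 0 ≤ a ^ q := by positivity
  have h2 : 0 ≤ b ^ q := by positivity
  rcases le_total a b with h | h
  · calc (a + b) ^ q ≤ (2 * b) ^ q := by gcongr; linarith
      _ = 2 ^ q * b ^ q := Real.mul_rpow (by norm_num) hb
      _ ≤ _ := by gcongr; linarith
  · calc (a + b) ^ q ≤ (2 * a) ^ q := by gcongr; linarith
      _ = 2 ^ q * a ^ q := Real.mul_rpow (by norm_num) ha
      _ ≤ _ := by gcongr; linarith

/-- The pointwise inequality behind the Brezis–Lieb lemma. -/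
theorem IsPower.abs_add_sub_le {q : ℝ} (hq : 0 < q) {f : ℝ → ℝ} (hf : IsPower q f) {δ : ℝ}
    (hδ : 0 < δ) :
    ∃ C : ℝ, 0 ≤ C ∧ ∀ a b : ℝ, |f (a + b) - f a - f b| ≤ δ * |a| ^ q + C * |b| ^ q := by
  have hcont : ∀ σ : ℝ, ∃ η > 0, ∀ t, |t - σ| < η → |f t - f σ| < δ / 2 := fun σ => by
    have := Metric.continuous_iff.1 hf.continuous σ (δ / 2) (by positivity)
    simpa [Real.dist_eq] using this
  obtain ⟨η₁, hη₁, h₁⟩ := hcont 1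
  obtain ⟨η₂, hη₂, h₂⟩ := hcont (-1)
  obtain ⟨η₃, hη₃, h₃⟩ := hcont 0
  set η := min (min η₁ η₂) η₃ with hη
  have hηpos : 0 < η := by positivity
  have f0 : f 0 = 0 := by
    have := hf.abs_eq 0
    rw [abs_zero, Real.zero_rpow hq.ne'] at this
    exact abs_eq_zero.1 this
  refine ⟨2 ^ q * ((2 / η) ^ q + 1) + (2 / η) ^ q + 1, by positivity, fun a b => ?_⟩
  -- If `b` is small relative to `a`, divide by `|a|` using homogeneity and use continuity at `±1`
  -- and at `0`. Otherwise every term is bounded by a multiple of `|b| ^ q`.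
  by_cases hab : |b| < η * |a|
  · have ha : 0 < |a| := by
      rcases (abs_nonneg a).eq_or_lt with h | h
      · rw [← h, mul_zero] at hab
        exact absurd hab (not_lt.2 (abs_nonneg b))
      · exact h
    obtain ⟨A, hA⟩ : ∃ A, A = |a| := ⟨_, rfl⟩
    rw [← hA] at hab ha ⊢
    have hb1 : |b / A| < η := by
      rw [abs_div, abs_of_pos ha, div_lt_iff₀ ha]; exact hab
    have e1 : f (a + b) = A ^ q * f (a / A + b / A) := by
      rw [← hf.homog _ ha]; congr 1; field_simp
    have e2 : f a = A ^ q * f (a / A) := by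
      rw [← hf.homog _ ha]; congr 1; field_simp
    have e3 : f b = A ^ q * f (b / A) := by
      rw [← hf.homog _ ha]; congr 1; field_simp
    have hs : a / A = 1 ∨ a / A = -1 := by
      rcases lt_trichotomy a 0 with h | h | h
      · right; rw [hA, abs_of_neg h, div_neg, div_self h.ne]
      · simp [hA, h] at ha
      · left; rw [hA, abs_of_pos h]; field_simp
    have hk1 : |f (a / A + b / A) - f (a / A)| < δ / 2 := by
      rcases hs with h | h
      · rw [h]
        refine h₁ _ ?_
        rw [add_sub_cancel_left]
        exact hb1.trans_le ((min_le_left _ _).trans (min_le_left _ _))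
      · rw [h]
        refine h₂ _ ?_
        rw [add_sub_cancel_left]
        exact hb1.trans_le ((min_le_left _ _).trans (min_le_right _ _))
    have hk2 : |f (b / A)| < δ / 2 := by
      have := h₃ (b / A) (by rw [sub_zero]; exact hb1.trans_le (min_le_right _ _))
      rwa [f0, sub_zero] at this
    have hq' : 0 < A ^ q := by positivity
    calc |f (a + b) - f a - f b|
        = A ^ q * |(f (a / A + b / A) - f (a / A)) - f (b / A)| := by
          rw [e1, e2, e3, ← mul_sub, ← mul_sub, abs_mul, abs_of_pos hq']
      _ ≤ A ^ q * δ := by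
          gcongr
          refine (abs_sub _ _).trans ?_
          linarith
      _ ≤ _ := by
          have : 0 ≤ (2 ^ q * ((2 / η) ^ q + 1) + (2 / η) ^ q + 1) * |b| ^ q := by positivity
          linarith
  · have hab' : |a| ≤ 2 / η * |b| := by
      have : |a| ≤ |b| / η := by rw [le_div_iff₀ hηpos]; linarith [not_lt.1 hab]
      refine this.trans ?_
      rw [div_mul_eq_mul_div]
      gcongr
      linarith [abs_nonneg b]
    have hA : |a| ^ q ≤ (2 / η) ^ q * |b| ^ q := by
      rw [← Real.mul_rpow (by positivity) (abs_nonneg b)]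
      gcongr
    have hAB : |a + b| ^ q ≤ 2 ^ q * (|a| ^ q + |b| ^ q) :=
      (Real.rpow_le_rpow (abs_nonneg _) (abs_add_le a b) hq.le).trans
        (rpow_add_le hq.le (abs_nonneg a) (abs_nonneg b))
    calc |f (a + b) - f a - f b| ≤ |f (a + b)| + |f a| + |f b| := by
          refine (abs_sub _ _).trans ?_
          gcongr
          exact abs_sub _ _
      _ = |a + b| ^ q + |a| ^ q + |b| ^ q := by rw [hf.abs_eq, hf.abs_eq, hf.abs_eq]
      _ ≤ 2 ^ q * ((2 / η) ^ q * |b| ^ q + |b| ^ q) + (2 / η) ^ q * |b| ^ q + |b| ^ q := by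
          gcongr
          refine hAB.trans ?_
          gcongr
      _ = (2 ^ q * ((2 / η) ^ q + 1) + (2 / η) ^ q + 1) * |b| ^ q := by ring
      _ ≤ _ := by
          have : 0 ≤ δ * |a| ^ q := by positivity
          linarith

/-! ### Subcritical `L^q` bounds, vanishing and local compactness -/

/-- Split at the threshold `T` with `T^{q - 10/3} = δ`: above it the critical power dominates with
coefficient `δ`, below it the square dominates. -/
theorem rpow_le_interpolate {q : ℝ} (hq : 2 < q) (hq' : q < 10 / 3) {δ : ℝ} (hδ : 0 < δ) :
    ∃ C : ℝ, 0 ≤ C ∧ ∀ t : ℝ, 0 ≤ t → t ^ q ≤ δ * t ^ (10 / 3 : ℝ) + C * t ^ 2 := by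
  set T := δ ^ (1 / (q - 10 / 3)) with hT
  have hTpos : 0 < T := by positivity
  have hTδ : T ^ (q - 10 / 3) = δ := by
    rw [hT, ← Real.rpow_mul hδ.le, one_div_mul_cancel (by linarith), Real.rpow_one]
  refine ⟨T ^ (q - 2), by positivity, fun t ht => ?_⟩
  rcases le_total t T with h | h
  · have h1 : t ^ q = t ^ (q - 2) * t ^ 2 := by
      rw [← Real.rpow_natCast, ← Real.rpow_add' ht (by norm_num; linarith)]
      norm_num
    have h2 : t ^ (q - 2) ≤ T ^ (q - 2) := Real.rpow_le_rpow ht h (by linarith)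
    have h3 : 0 ≤ δ * t ^ (10 / 3 : ℝ) := by positivity
    rw [h1]
    nlinarith [sq_nonneg t]
  · have htpos : 0 < t := hTpos.trans_le h
    have h1 : t ^ q = t ^ (q - 10 / 3) * t ^ (10 / 3 : ℝ) := by
      rw [← Real.rpow_add htpos]
      norm_num
    have h2 : t ^ (q - 10 / 3) ≤ δ := by
      rw [← hTδ]
      exact Real.rpow_le_rpow_of_nonpos hTpos h (by linarith)
    have h3 : 0 ≤ T ^ (q - 2) * t ^ 2 := by positivity
    rw [h1]
    nlinarith [Real.rpow_nonneg ht (10 / 3)]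

theorem one_le_norm_sqwt (ξ : Plane) : 1 ≤ ‖sqwt 1 ξ‖ := by
  have h := norm_sqwt_sq zero_le_one ξ
  have h1 := le_wt 1 ξ
  rw [← h] at h1
  nlinarith [norm_nonneg (sqwt 1 ξ)]

theorem norm_le_norm_mulFn_sqwt {F : CL2} (hF : MemMul (sqwt 1) F) :
    ‖F‖ ≤ ‖mulFn (sqwt 1) F‖ := by
  refine Lp.norm_le_norm_of_ae_le ?_
  filter_upwards [coeFn_mulFn hF] with ξ h
  rw [h, norm_mul]
  exact le_mul_of_one_le_left (norm_nonneg _) (one_le_norm_sqwt ξ)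

theorem lintegral_rpow_le_ofReal {F : CL2} (hF : MemMul (sqwt 1) F) :
    ∫⁻ x, ENNReal.ofReal (‖(𝓕⁻ F : CL2) x‖ ^ (10 / 3 : ℝ)) ≤
      ENNReal.ofReal (10 * (4 * ‖F‖) ^ (4 / 3 : ℝ) * ‖mulFn (sqwt 1) F‖ ^ 2) := by
  refine (lintegral_rpow_le F).trans (le_of_eq ?_)
  have h := enorm_mulFn_sq hF
  simp only [enorm_sqwt_sq zero_le_one] at h
  rw [← h, ENNReal.ofReal_mul (p := 10 * _) (by positivity), ENNReal.ofReal_pow (norm_nonneg _), ofReal_norm]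

theorem integrable_rpow {F : CL2} (hF : MemMul (sqwt 1) F) :
    Integrable fun x => ‖(𝓕⁻ F : CL2) x‖ ^ (10 / 3 : ℝ) := by
  refine ⟨((Lp.aestronglyMeasurable _).norm.aemeasurable.pow_const _).aestronglyMeasurable, ?_⟩
  refine lt_of_le_of_lt (le_of_eq ?_) ((lintegral_rpow_le_ofReal hF).trans_lt ENNReal.ofReal_lt_top)
  refine lintegral_congr fun x => ?_
  rw [← ofReal_norm, Real.norm_of_nonneg (by positivity)]

theorem integral_rpow_le {F : CL2} (hF : MemMul (sqwt 1) F) :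
    ∫ x, ‖(𝓕⁻ F : CL2) x‖ ^ (10 / 3 : ℝ) ≤
      10 * (4 * ‖F‖) ^ (4 / 3 : ℝ) * ‖mulFn (sqwt 1) F‖ ^ 2 := by
  rw [integral_eq_lintegral_of_nonneg_ae (Eventually.of_forall fun x => by positivity)
    (integrable_rpow hF).1]
  exact ENNReal.toReal_le_of_le_ofReal (by positivity) (lintegral_rpow_le_ofReal hF)

theorem integrable_rpow_q {q : ℝ} (hq : 2 < q) (hq' : q < 10 / 3) {F : CL2} (hF : MemMul (sqwt 1) F) :
    Integrable fun x => ‖(𝓕⁻ F : CL2) x‖ ^ q := by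
  obtain ⟨C, hC, h⟩ := rpow_le_interpolate hq hq' one_pos
  refine Integrable.mono' (((integrable_rpow hF).const_mul 1).add
    ((integrable_norm_sq (𝓕⁻ F : CL2)).const_mul C))
    ((Lp.aestronglyMeasurable _).norm.aemeasurable.pow_const _).aestronglyMeasurable
    (Eventually.of_forall fun x => ?_)
  rw [Real.norm_of_nonneg (by positivity)]
  exact h _ (norm_nonneg _)

/-- The `L^{10/3}` norm is bounded on bounded sets of the energy space, so its contribution can be
made smaller than `δ`; what remains is an `L²` norm on the same set. Any smallness in `L²`, global
or local, thus passes to `L^q`. -/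
theorem exists_integral_rpow_q_le {q : ℝ} (hq : 2 < q) (hq' : q < 10 / 3) {δ : ℝ} (hδ : 0 < δ) (K : ℝ) :
    ∃ C : ℝ, 0 ≤ C ∧ ∀ F : CL2, MemMul (sqwt 1) F → ‖mulFn (sqwt 1) F‖ ≤ K → ∀ s : Set Plane,
      ∫ x in s, ‖(𝓕⁻ F : CL2) x‖ ^ q ≤ δ + C * ∫ x in s, ‖(𝓕⁻ F : CL2) x‖ ^ 2 := by
  set K' := max K 0
  have hK' : 0 ≤ K' := le_max_right _ _
  set D := 10 * (4 * K') ^ (4 / 3 : ℝ) * K' ^ 2 + 1 with hD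
  have hDpos : 0 < D := by positivity
  obtain ⟨C, hC, h⟩ := rpow_le_interpolate hq hq' (div_pos hδ hDpos)
  refine ⟨C, hC, fun F hF hFK s => ?_⟩
  have hFK' : ‖mulFn (sqwt 1) F‖ ≤ K' := hFK.trans (le_max_left _ _)
  have i1 := integrable_rpow hF
  have i2 := integrable_norm_sq (𝓕⁻ F : CL2)
  calc ∫ x in s, ‖(𝓕⁻ F : CL2) x‖ ^ q
      ≤ ∫ x in s, (δ / D * ‖(𝓕⁻ F : CL2) x‖ ^ (10 / 3 : ℝ) + C * ‖(𝓕⁻ F : CL2) x‖ ^ 2) :=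
        integral_mono (integrable_rpow_q hq hq' hF).restrict
          ((i1.const_mul _).add (i2.const_mul _)).restrict fun x => h _ (norm_nonneg _)
    _ = δ / D * (∫ x in s, ‖(𝓕⁻ F : CL2) x‖ ^ (10 / 3 : ℝ)) +
          C * ∫ x in s, ‖(𝓕⁻ F : CL2) x‖ ^ 2 := by
        rw [integral_add (i1.const_mul _).restrict (i2.const_mul _).restrict, integral_const_mul,
          integral_const_mul]
    _ ≤ δ + C * ∫ x in s, ‖(𝓕⁻ F : CL2) x‖ ^ 2 := by
        gcongr
        have : ∫ x in s, ‖(𝓕⁻ F : CL2) x‖ ^ (10 / 3 : ℝ) ≤ D := by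
          calc ∫ x in s, ‖(𝓕⁻ F : CL2) x‖ ^ (10 / 3 : ℝ)
              ≤ ∫ x, ‖(𝓕⁻ F : CL2) x‖ ^ (10 / 3 : ℝ) :=
                setIntegral_le_integral i1 (Eventually.of_forall fun x => by positivity)
            _ ≤ 10 * (4 * ‖F‖) ^ (4 / 3 : ℝ) * ‖mulFn (sqwt 1) F‖ ^ 2 := integral_rpow_le hF
            _ ≤ 10 * (4 * K') ^ (4 / 3 : ℝ) * K' ^ 2 := by
                gcongr
                exact (norm_le_norm_mulFn_sqwt hF).trans hFK'
            _ ≤ D := by rw [hD]; linarith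
        calc δ / D * ∫ x in s, ‖(𝓕⁻ F : CL2) x‖ ^ (10 / 3 : ℝ) ≤ δ / D * D := by gcongr
          _ = δ := by field_simp

theorem norm_highCut_sq_le {F : CL2} (hF : MemMul (sqwt 1) F) {R : ℝ} (hR : 0 < R) :
    ‖mulFn (highCut R) F‖ ^ 2 ≤ ‖mulFn (sqwt 1) F‖ ^ 2 / R := by
  have h : ‖mulFn (highCut R) F‖ ≤ (√R)⁻¹ * ‖mulFn (sqwt 1) F‖ := by
    refine norm_mulFn_le_mulFn hF (memMul_highCut R F) fun ξ => ?_
    unfold highCut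
    split_ifs with hξ
    · rw [norm_zero]; positivity
    · rw [norm_one]
      have h1 : R ≤ ‖sqwt 1 ξ‖ ^ 2 := by
        rw [norm_sqwt_sq zero_le_one]
        exact (not_le.1 hξ).le
      rw [inv_mul_eq_div, one_le_div (by positivity)]
      exact Real.sqrt_le_iff.2 ⟨norm_nonneg _, h1⟩
  calc ‖mulFn (highCut R) F‖ ^ 2 ≤ ((√R)⁻¹ * ‖mulFn (sqwt 1) F‖) ^ 2 := by gcongr
    _ = _ := by
      rw [mul_pow, inv_pow, Real.sq_sqrt hR.le]
      field_simp

theorem memMul_sqwt_highCut {F : CL2} (hF : MemMul (sqwt 1) F) (R : ℝ) :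
    MemMul (sqwt 1) (mulFn (highCut R) F) ∧
      ‖mulFn (sqwt 1) (mulFn (highCut R) F)‖ ≤ ‖mulFn (sqwt 1) F‖ := by
  have hC : ∀ ξ, ‖sqwt 1 ξ * highCut R ξ‖ ≤ 1 * ‖sqwt 1 ξ‖ := fun ξ => by
    rw [norm_mul, one_mul]
    exact mul_le_of_le_one_right (norm_nonneg _) (norm_highCut_le R ξ)
  have h1 : MemMul (fun ξ => sqwt 1 ξ * highCut R ξ) F :=
    hF.of_le ((measurable_sqwt 1).mul (measurable_highCut R)) hC
  refine ⟨(memMul_mulFn_iff (memMul_highCut R F)).2 h1, ?_⟩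
  rw [mulFn_mulFn (memMul_highCut R F) h1]
  simpa using norm_mulFn_le_mulFn hF h1 hC

theorem integrable_norm_lowPart_sq (R : ℝ) (F : CL2) :
    Integrable fun x => ‖lowPart R F x‖ ^ 2 := by
  refine (integrable_norm_sq (𝓕⁻ (mulFn (lowCut R) F) : CL2)).congr ?_
  filter_upwards [lowPart_ae_eq R F] with x hx
  rw [hx]

theorem integral_norm_lowPart_sq_le (R : ℝ) (F : CL2) :
    ∫ x, ‖lowPart R F x‖ ^ 2 ≤ ‖F‖ ^ 2 := by
  have : ∫ x, ‖lowPart R F x‖ ^ 2 = ∫ x, ‖(𝓕⁻ (mulFn (lowCut R) F) : CL2) x‖ ^ 2 := by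
    refine integral_congr_ae ?_
    filter_upwards [lowPart_ae_eq R F] with x hx
    rw [hx]
  rw [this, integral_norm_sq_eq, norm_fourierInv]
  have := norm_mulFn_le (memMul_lowCut R F) (norm_lowCut_le R)
  gcongr
  linarith

/-- If the low frequency parts are uniformly small, then so is the `L^q` norm. -/
theorem exists_integral_rpow_q_le_of_lowPart {q : ℝ} (hq : 2 < q) (hq' : q < 10 / 3) (K : ℝ)
    {ε : ℝ} (hε : 0 < ε) :
    ∃ R η : ℝ, 0 < R ∧ 0 < η ∧ ∀ F : CL2, MemMul (sqwt 1) F → ‖mulFn (sqwt 1) F‖ ≤ K →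
      (∀ x, ‖lowPart R F x‖ ≤ η) → ∫ x, ‖(𝓕⁻ F : CL2) x‖ ^ q ≤ ε := by
  have h2q : (0 : ℝ) < 2 ^ q := by positivity
  set δ := ε / (3 * 2 ^ q) with hδ
  have hδpos : 0 < δ := by positivity
  obtain ⟨C, hC, hCF⟩ := exists_integral_rpow_q_le hq hq' hδpos K
  -- Large enough for the high part to satisfy `C ‖h‖² ≤ δ`. The threshold `η` is fixed
  -- independently, through `|low|^q ≤ η^{q-2} |low|²`, and the three shares of `δ` add up to `ε`
  -- after the factor `2 ^ q`.
  set R := (C * K ^ 2 + 1) / δ with hRdef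
  have hR : 0 < R := by positivity
  obtain ⟨η, hη, hηK⟩ : ∃ η : ℝ, 0 < η ∧ η ^ (q - 2) * K ^ 2 ≤ δ := by
    have hcont : Tendsto (fun η : ℝ => η ^ (q - 2) * K ^ 2) (𝓝[>] 0) (𝓝 (0 ^ (q - 2) * K ^ 2)) := by
      refine Tendsto.mul_const _ (Tendsto.mono_left ?_ nhdsWithin_le_nhds)
      exact (Real.continuous_rpow_const (by linarith)).tendsto 0
    rw [Real.zero_rpow (by linarith), zero_mul] at hcont
    obtain ⟨η, h1, h2⟩ := ((hcont.eventually (gt_mem_nhds hδpos)).and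
      self_mem_nhdsWithin).exists
    exact ⟨η, h2, h1.le⟩
  refine ⟨R, η, hR, hη, fun F hF hFK hlow => ?_⟩
  obtain ⟨hH, hHn⟩ := memMul_sqwt_highCut hF R
  set h : CL2 := 𝓕⁻ (mulFn (highCut R) F) with hh
  have hKF : ‖F‖ ≤ K := (norm_le_norm_mulFn_sqwt hF).trans hFK
  have i1 := integrable_norm_lowPart_sq R F
  have i2 := integrable_rpow_q hq hq' hH
  have b1 : ∫ x, ‖h x‖ ^ q ≤ 2 * δ := by
    have e1 := hCF _ hH (hHn.trans hFK) Set.univ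
    simp only [Measure.restrict_univ] at e1
    refine e1.trans ?_
    rw [integral_norm_sq_eq, norm_fourierInv]
    have e2 := norm_highCut_sq_le hF hR
    have e3 : ‖mulFn (sqwt 1) F‖ ^ 2 ≤ K ^ 2 := by gcongr
    have e4 : C * ‖mulFn (highCut R) F‖ ^ 2 ≤ δ := by
      calc C * ‖mulFn (highCut R) F‖ ^ 2 ≤ C * (K ^ 2 / R) := by
            gcongr
            refine e2.trans ?_
            gcongr
        _ = C * K ^ 2 / R := by ring
        _ ≤ δ := by
            rw [div_le_iff₀ hR, hRdef, mul_div_cancel₀ _ hδpos.ne']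
            linarith
    linarith
  calc ∫ x, ‖(𝓕⁻ F : CL2) x‖ ^ q
      ≤ ∫ x, 2 ^ q * (η ^ (q - 2) * ‖lowPart R F x‖ ^ 2 + ‖h x‖ ^ q) := by
        refine integral_mono_ae (integrable_rpow_q hq hq' hF)
          (((i1.const_mul _).add i2).const_mul _) ?_
        filter_upwards [fourierInv_ae_eq_lowPart_add R F] with x hx
        rw [hx]
        calc ‖lowPart R F x + h x‖ ^ q ≤ (‖lowPart R F x‖ + ‖h x‖) ^ q := by
              gcongr
              exact norm_add_le _ _
          _ ≤ 2 ^ q * (‖lowPart R F x‖ ^ q + ‖h x‖ ^ q) :=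
              rpow_add_le (by linarith) (norm_nonneg _) (norm_nonneg _)
          _ ≤ _ := by
              gcongr
              have : ‖lowPart R F x‖ ^ q = ‖lowPart R F x‖ ^ (q - 2) * ‖lowPart R F x‖ ^ 2 := by
                rw [← Real.rpow_natCast, ← Real.rpow_add' (norm_nonneg _) (by norm_num; linarith)]
                norm_num
              rw [this]
              gcongr
              exact hlow x
    _ = 2 ^ q * (η ^ (q - 2) * (∫ x, ‖lowPart R F x‖ ^ 2) + ∫ x, ‖h x‖ ^ q) := by
        rw [integral_const_mul, integral_add (i1.const_mul _) i2, integral_const_mul]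
    _ ≤ 2 ^ q * (δ + 2 * δ) := by
        gcongr
        refine le_trans ?_ hηK
        gcongr
        refine (integral_norm_lowPart_sq_le R F).trans ?_
        gcongr
    _ = ε := by
        rw [hδ]
        field_simp
        ring

/-- Point evaluation of the low part is a bounded functional on `L²`, because a character cut off to
a set of finite measure is square integrable. Hence low parts converge pointwise along weakly
convergent sequences. -/
theorem exists_inner_eq_lowPart (R : ℝ) (x : Plane) :
    ∃ G : CL2, ∀ F : CL2, lowPart R F x = inner ℂ G F := by
  have hm : Measurable fun ξ : Plane => (starRingEnd ℂ) ((Real.fourierChar (inner ℝ ξ x) : ℂ)) := by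
    have : Continuous fun ξ : Plane => inner ℝ ξ x := by fun_prop
    exact (Complex.continuous_conj.comp
      (continuous_subtype_val.comp (Real.continuous_fourierChar.comp this))).measurable
  have hL : MemLp (fun ξ => (starRingEnd ℂ) ((Real.fourierChar (inner ℝ ξ x) : ℂ)) * lowCut R ξ) 2
      (volume : Measure Plane) := by
    refine MemLp.of_le (g := (lowSet R).indicator fun _ => (1 : ℂ)) ?_
      (hm.mul (measurable_lowCut R)).aestronglyMeasurable (Eventually.of_forall fun ξ => ?_)
    · refine memLp_indicator_const 2 (measurableSet_lowSet R) 1 (Or.inr ?_)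
      by_cases hR : 0 ≤ R
      · exact ((volume_lowSet_le hR).trans_lt ENNReal.ofReal_lt_top).ne
      · have : lowSet R ⊆ lowSet 0 := fun ξ (hξ : _ ≤ R) => hξ.trans (not_le.1 hR).le
        exact ((measure_mono this).trans_lt
          ((volume_lowSet_le le_rfl).trans_lt ENNReal.ofReal_lt_top)).ne
    · rw [norm_mul, RCLike.norm_conj, Circle.norm_coe, one_mul, lowCut, Set.indicator]
  refine ⟨hL.toLp _, fun F => ?_⟩
  rw [lowPart, Real.fourierInv_eq, L2.inner_def]
  refine integral_congr_ae ?_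
  filter_upwards [hL.coeFn_toLp, coeFn_mulFn (memMul_lowCut R F)] with ξ h1 h2
  rw [h1, h2, RCLike.inner_apply, Circle.smul_def, smul_eq_mul, map_mul, RCLike.conj_conj]
  have : (starRingEnd ℂ) (lowCut R ξ) = lowCut R ξ := by
    unfold lowCut; split_ifs <;> simp
  rw [this]
  ring

/-- Weak convergence together with boundedness in the energy space gives local strong
convergence. -/
theorem tendsto_setIntegral_norm_sq {F : ℕ → CL2} {K : ℝ} (hF : ∀ n, MemMul (sqwt 1) (F n))
    (hK : ∀ n, ‖mulFn (sqwt 1) (F n)‖ ≤ K)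
    (hw : ∀ G : CL2, Tendsto (fun n => (inner ℂ G (F n) : ℂ)) atTop (𝓝 0)) {s : Set Plane}
    (hs : volume s < ∞) :
    Tendsto (fun n => ∫ x in s, ‖(𝓕⁻ (F n) : CL2) x‖ ^ 2) atTop (𝓝 0) := by
  have hfin : IsFiniteMeasure (volume.restrict s) := ⟨by rwa [Measure.restrict_apply_univ]⟩
  -- Low parts tend to `0` pointwise by weak convergence and are bounded uniformly, so dominated
  -- convergence applies on a set of finite measure. The high parts are `O(1/R)` uniformly in `n`.
  have hlow : ∀ R : ℝ, 0 < R →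
      Tendsto (fun n => ∫ x in s, ‖lowPart R (F n) x‖ ^ 2) atTop (𝓝 0) := by
    intro R hR
    have := tendsto_integral_of_dominated_convergence (μ := volume.restrict s)
      (F := fun n x => ‖lowPart R (F n) x‖ ^ 2) (f := fun _ => (0 : ℝ))
      (fun _ => (2 * R ^ (3 / 4 : ℝ) * K) ^ 2)
      (fun n => ((continuous_lowPart R (F n)).norm.pow 2).aestronglyMeasurable)
      (integrable_const _)
      (fun n => Eventually.of_forall fun x => ?_) (Eventually.of_forall fun x => ?_)
    · simpa using this
    · rw [Real.norm_of_nonneg (by positivity)]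
      gcongr
      refine (norm_lowPart_le hR.le (F n) x).trans ?_
      gcongr
      exact (norm_le_norm_mulFn_sqwt (hF n)).trans (hK n)
    · obtain ⟨G, hG⟩ := exists_inner_eq_lowPart R x
      have h1 := ((hw G).norm).pow 2
      simp only [norm_zero] at h1
      simp only [hG]
      simpa using h1
  rw [Metric.tendsto_atTop]
  intro ε hε
  set R := 4 * (K ^ 2 + 1) / ε with hRdef
  have hR : 0 < R := by positivity
  obtain ⟨N, hN⟩ := Metric.tendsto_atTop.1 (hlow R hR) (ε / 4) (by positivity)
  refine ⟨N, fun n hn => ?_⟩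
  have h1 := hN n hn
  rw [Real.dist_eq, sub_zero, abs_of_nonneg (integral_nonneg fun x => by positivity)] at h1 ⊢
  have i1 := integrable_norm_lowPart_sq R (F n)
  have i2 := integrable_norm_sq (𝓕⁻ (mulFn (highCut R) (F n)) : CL2)
  have h2 : ∫ x in s, ‖(𝓕⁻ (mulFn (highCut R) (F n)) : CL2) x‖ ^ 2 < ε / 4 := by
    calc ∫ x in s, ‖(𝓕⁻ (mulFn (highCut R) (F n)) : CL2) x‖ ^ 2
        ≤ ∫ x, ‖(𝓕⁻ (mulFn (highCut R) (F n)) : CL2) x‖ ^ 2 :=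
          setIntegral_le_integral i2 (Eventually.of_forall fun x => by positivity)
      _ = ‖mulFn (highCut R) (F n)‖ ^ 2 := by rw [integral_norm_sq_eq, norm_fourierInv]
      _ ≤ ‖mulFn (sqwt 1) (F n)‖ ^ 2 / R := norm_highCut_sq_le (hF n) hR
      _ ≤ K ^ 2 / R := by gcongr; exact hK n
      _ < ε / 4 := by
          rw [div_lt_iff₀ hR, hRdef]
          field_simp
          linarith
  calc ∫ x in s, ‖(𝓕⁻ (F n) : CL2) x‖ ^ 2
      ≤ ∫ x in s, (2 * ‖lowPart R (F n) x‖ ^ 2 +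
          2 * ‖(𝓕⁻ (mulFn (highCut R) (F n)) : CL2) x‖ ^ 2) := by
        refine integral_mono_ae (integrable_norm_sq _).restrict
          ((i1.const_mul 2).add (i2.const_mul 2)).restrict ?_
        filter_upwards [ae_restrict_of_ae (fourierInv_ae_eq_lowPart_add R (F n))] with x hx
        rw [hx]
        have := norm_add_le (lowPart R (F n) x) ((𝓕⁻ (mulFn (highCut R) (F n)) : CL2) x)
        nlinarith [sq_nonneg (‖lowPart R (F n) x‖ - ‖(𝓕⁻ (mulFn (highCut R) (F n)) : CL2) x‖),
          norm_nonneg (lowPart R (F n) x + (𝓕⁻ (mulFn (highCut R) (F n)) : CL2) x)]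
    _ = 2 * (∫ x in s, ‖lowPart R (F n) x‖ ^ 2) +
          2 * ∫ x in s, ‖(𝓕⁻ (mulFn (highCut R) (F n)) : CL2) x‖ ^ 2 := by
        rw [integral_add (i1.const_mul 2).restrict (i2.const_mul 2).restrict, integral_const_mul,
          integral_const_mul]
    _ < ε := by linarith

theorem norm_fourierInv_fourierL2_ae (u : L2) :
    (fun x => ‖(𝓕⁻ (fourierL2 u) : CL2) x‖) =ᵐ[volume] fun x => |u x| := by
  rw [fourierInv_fourierL2]
  filter_upwards [coeFn_toComplex u] with x hx
  rw [hx, Complex.norm_real, Real.norm_eq_abs]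

theorem norm_le_norm_zLift {u : L2} (hu : MemZ u) : ‖u‖ ≤ ‖zLift 1 u‖ := by
  rw [← norm_fourierL2]
  exact norm_le_norm_mulFn_sqwt (hu.memMul zero_le_one)

/-! ### The nonlinear functional: continuity and splitting -/

/-- The functional `∫ f(u)`. -/
def functionalJ (f : ℝ → ℝ) (u : L2) : ℝ := ∫ x, f (u x)

section Power

variable {q : ℝ} {f : ℝ → ℝ}

theorem integrable_abs_rpow (hq : 2 < q) (hq' : q < 10 / 3) {u : L2} (hu : MemZ u) :
    Integrable fun x => |u x| ^ q := by
  refine (integrable_rpow_q hq hq' (hu.memMul zero_le_one)).congr ?_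
  filter_upwards [norm_fourierInv_fourierL2_ae u] with x hx
  rw [hx]

theorem exists_setIntegral_abs_rpow_le (hq : 2 < q) (hq' : q < 10 / 3) {δ : ℝ} (hδ : 0 < δ)
    (K : ℝ) : ∃ C : ℝ, 0 ≤ C ∧ ∀ u : L2, MemZ u → ‖zLift 1 u‖ ≤ K → ∀ s : Set Plane,
      ∫ x in s, |u x| ^ q ≤ δ + C * ∫ x in s, |u x| ^ 2 := by
  obtain ⟨C, hC, h⟩ := exists_integral_rpow_q_le hq hq' hδ K
  refine ⟨C, hC, fun u hu hK s => ?_⟩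
  have h1 := h _ (hu.memMul zero_le_one) hK s
  have e1 : ∫ x in s, ‖(𝓕⁻ (fourierL2 u) : CL2) x‖ ^ q = ∫ x in s, |u x| ^ q := by
    refine integral_congr_ae (ae_restrict_of_ae ?_)
    filter_upwards [norm_fourierInv_fourierL2_ae u] with x hx
    rw [hx]
  have e2 : ∫ x in s, ‖(𝓕⁻ (fourierL2 u) : CL2) x‖ ^ 2 = ∫ x in s, |u x| ^ 2 := by
    refine integral_congr_ae (ae_restrict_of_ae ?_)
    filter_upwards [norm_fourierInv_fourierL2_ae u] with x hx
    rw [hx]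
  rwa [e1, e2] at h1

theorem integral_abs_sq (u : L2) : ∫ x, |u x| ^ 2 = ‖u‖ ^ 2 := by
  simpa [Real.norm_eq_abs] using integral_norm_sq_eq u

theorem exists_integral_abs_rpow_le (hq : 2 < q) (hq' : q < 10 / 3) {δ : ℝ} (hδ : 0 < δ)
    (K : ℝ) : ∃ C : ℝ, 0 ≤ C ∧ ∀ u : L2, MemZ u → ‖zLift 1 u‖ ≤ K →
      ∫ x, |u x| ^ q ≤ δ + C * ‖u‖ ^ 2 := by
  obtain ⟨C, hC, h⟩ := exists_setIntegral_abs_rpow_le hq hq' hδ K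
  refine ⟨C, hC, fun u hu hK => ?_⟩
  have := h u hu hK Set.univ
  simpa only [Measure.restrict_univ, integral_abs_sq] using this

theorem exists_integral_abs_rpow_bound (hq : 2 < q) (hq' : q < 10 / 3) (K : ℝ) :
    ∃ S : ℝ, 0 < S ∧ ∀ u : L2, MemZ u → ‖zLift 1 u‖ ≤ K → ∫ x, |u x| ^ q ≤ S := by
  obtain ⟨C, hC, h⟩ := exists_integral_abs_rpow_le hq hq' one_pos K
  refine ⟨1 + C * K ^ 2, by positivity, fun u hu hK => (h u hu hK).trans ?_⟩
  gcongr
  exact (norm_le_norm_zLift hu).trans hK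

theorem IsPower.integrable_comp (hf : IsPower q f) (hq : 2 < q) (hq' : q < 10 / 3) {u : L2}
    (hu : MemZ u) : Integrable fun x => f (u x) := by
  refine (integrable_abs_rpow hq hq' hu).mono'
    (hf.continuous.comp_aestronglyMeasurable (Lp.aestronglyMeasurable u))
    (Eventually.of_forall fun x => ?_)
  rw [Real.norm_eq_abs, hf.abs_eq]

theorem IsPower.abs_functionalJ_le (hf : IsPower q f) (u : L2) :
    |functionalJ f u| ≤ ∫ x, |u x| ^ q := by
  rw [functionalJ, ← Real.norm_eq_abs]
  refine (norm_integral_le_integral_norm _).trans (le_of_eq ?_)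
  simp only [Real.norm_eq_abs, hf.abs_eq]

theorem IsPower.functionalJ_smul (hf : IsPower q f) {θ : ℝ} (hθ : 0 < θ) (u : L2) :
    functionalJ f (θ • u) = θ ^ q * functionalJ f u := by
  rw [functionalJ, functionalJ, ← integral_const_mul]
  refine integral_congr_ae ?_
  filter_upwards [Lp.coeFn_smul θ u] with x hx
  rw [hx, Pi.smul_apply, smul_eq_mul, hf.homog θ hθ]

theorem IsPower.apply_zero (hf : IsPower q f) (hq : 2 < q) : f 0 = 0 := by
  have := hf.abs_eq 0
  rw [abs_zero, Real.zero_rpow (by linarith)] at this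
  exact abs_eq_zero.1 this

/-- `∫ f(u)` is uniformly continuous on bounded sets of the energy space. -/
theorem IsPower.exists_abs_functionalJ_add_sub_le (hf : IsPower q f) (hq : 2 < q)
    (hq' : q < 10 / 3) (K : ℝ) {ε : ℝ} (hε : 0 < ε) :
    ∃ δ > 0, ∀ u r : L2, MemZ u → MemZ r → ‖zLift 1 u‖ ≤ K → ‖zLift 1 r‖ ≤ δ →
      |functionalJ f (u + r) - functionalJ f u| ≤ ε := by
  obtain ⟨S, hS, hSu⟩ := exists_integral_abs_rpow_bound hq hq' K
  -- One half of `ε` is spent on `∫ |u|^q ≤ S`, the other half on `(C + 1) ∫ |r|^q`, where the extra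
  -- `1` accounts for `f(r)` itself.
  obtain ⟨C, hC, hCab⟩ := hf.abs_add_sub_le (by linarith) (δ := ε / (2 * S)) (by positivity)
  obtain ⟨D, hD, hDu⟩ := exists_integral_abs_rpow_le hq hq'
    (δ := ε / (4 * (C + 1))) (by positivity) 1
  refine ⟨min 1 (ε / (4 * (C + 1) * (D + 1))), by positivity, fun u r hu hr hK hδ => ?_⟩
  have hr1 : ‖zLift 1 r‖ ≤ 1 := hδ.trans (min_le_left _ _)
  have hr2 : ‖r‖ ≤ ε / (4 * (C + 1) * (D + 1)) :=
    (norm_le_norm_zLift hr).trans (hδ.trans (min_le_right _ _))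
  have hr3 : ‖r‖ ≤ 1 := (norm_le_norm_zLift hr).trans hr1
  have iu := integrable_abs_rpow hq hq' hu
  have ir := integrable_abs_rpow hq hq' hr
  have hJ : functionalJ f (u + r) - functionalJ f u = ∫ x, (f ((u + r : L2) x) - f (u x)) :=
    (integral_sub (hf.integrable_comp hq hq' (hu.add hr)) (hf.integrable_comp hq hq' hu)).symm
  have hI : ∫ x, |r x| ^ q ≤ ε / (2 * (C + 1)) := by
    refine (hDu r hr hr1).trans ?_
    have h1 : D * ‖r‖ ^ 2 ≤ ε / (4 * (C + 1)) := by
      calc D * ‖r‖ ^ 2 = D * ‖r‖ * ‖r‖ := by ring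
        _ ≤ (D + 1) * ‖r‖ * 1 := by gcongr; linarith
        _ ≤ (D + 1) * (ε / (4 * (C + 1) * (D + 1))) * 1 := by gcongr
        _ = ε / (4 * (C + 1)) := by field_simp
    calc ε / (4 * (C + 1)) + D * ‖r‖ ^ 2 ≤ ε / (4 * (C + 1)) + ε / (4 * (C + 1)) := by gcongr
      _ = ε / (2 * (C + 1)) := by field_simp; norm_num
  rw [hJ]
  calc |∫ x, (f ((u + r : L2) x) - f (u x))|
      ≤ ∫ x, (ε / (2 * S) * |u x| ^ q + (C + 1) * |r x| ^ q) := by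
        rw [← Real.norm_eq_abs]
        refine norm_integral_le_of_norm_le ((iu.const_mul _).add (ir.const_mul _)) ?_
        filter_upwards [Lp.coeFn_add u r] with x hx
        rw [hx, Pi.add_apply, Real.norm_eq_abs]
        have h1 := hCab (u x) (r x)
        have h2 := hf.abs_eq (r x)
        have h3 : |f (u x + r x) - f (u x)| ≤
            |f (u x + r x) - f (u x) - f (r x)| + |f (r x)| := by
          have := abs_add_le (f (u x + r x) - f (u x) - f (r x)) (f (r x))
          simpa using this
        rw [h2] at h3
        linarith
    _ = ε / (2 * S) * (∫ x, |u x| ^ q) + (C + 1) * ∫ x, |r x| ^ q := by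
        rw [integral_add (iu.const_mul _) (ir.const_mul _), integral_const_mul, integral_const_mul]
    _ ≤ ε / (2 * S) * S + (C + 1) * (ε / (2 * (C + 1))) := by
        gcongr
        exact hSu u hu hK
    _ = ε := by field_simp; norm_num

/-- The Brezis–Lieb splitting. -/
theorem IsPower.tendsto_functionalJ_sub (hf : IsPower q f) (hq : 2 < q) (hq' : q < 10 / 3) {K : ℝ}
    {u : L2} (hu : MemZ u) {r : ℕ → L2} (hr : ∀ n, MemZ (r n)) (hK : ∀ n, ‖zLift 1 (r n)‖ ≤ K)
    (hloc : ∀ ρ : ℝ, Tendsto (fun n => ∫ x in Metric.closedBall 0 ρ, |r n x| ^ 2) atTop (𝓝 0)) :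
    Tendsto (fun n => functionalJ f (u + r n) - functionalJ f u - functionalJ f (r n)) atTop
      (𝓝 0) := by
  obtain ⟨S, hS, hSr⟩ := exists_integral_abs_rpow_bound hq hq' K
  have iu := integrable_abs_rpow hq hq' hu
  set U := ∫ x, |u x| ^ q with hU
  have hUnn : 0 ≤ U := integral_nonneg fun x => by positivity
  rw [Metric.tendsto_atTop]
  intro ε hε
  set δ := ε / (4 * (S + U + 1)) with hδ
  have hδpos : 0 < δ := by positivity
  obtain ⟨C, hC, hCab⟩ := hf.abs_add_sub_le (by linarith) hδpos
  have htail : Tendsto (fun ρ : ℝ => ∫ x in (Metric.closedBall (0 : Plane) ρ)ᶜ, |u x| ^ q) atTop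
      (𝓝 0) := by
    have h1 := (tendsto_setIntegral_of_monotone (μ := volume) (f := fun x => |u x| ^ q)
      (s := fun n : ℝ => Metric.closedBall (0 : Plane) n)
      (fun n => measurableSet_closedBall)
      (fun a b hab => Metric.closedBall_subset_closedBall hab) iu.integrableOn)
    have hun : (⋃ n : ℝ, Metric.closedBall (0 : Plane) n) = Set.univ := by
      refine Set.eq_univ_of_forall fun x => Set.mem_iUnion.2 ⟨‖x‖, ?_⟩
      simp
    rw [hun, Measure.restrict_univ] at h1
    have h2 := (tendsto_const_nhds (x := U)).sub h1
    rw [← hU, sub_self] at h2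
    refine h2.congr fun ρ => ?_
    rw [hU, ← integral_add_compl (measurableSet_closedBall (x := (0 : Plane)) (ε := ρ)) iu]
    ring
  obtain ⟨ρ, hρ⟩ := (htail.eventually (gt_mem_nhds
    (show (0 : ℝ) < ε / (4 * (C + 1)) by positivity))).exists
  obtain ⟨D, hD, hDr⟩ := exists_setIntegral_abs_rpow_le hq hq'
    (δ := ε / (8 * (C + 1))) (by positivity) K
  obtain ⟨N, hN⟩ := eventually_atTop.1 ((hloc ρ).eventually (gt_mem_nhds
    (show (0 : ℝ) < ε / (8 * (C + 1) * (D + 1)) by positivity)))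
  refine ⟨N, fun n hn => ?_⟩
  have ir := integrable_abs_rpow hq hq' (hr n)
  set B := Metric.closedBall (0 : Plane) ρ with hB
  have hBm : MeasurableSet B := measurableSet_closedBall
  have hIr : ∫ x in B, |r n x| ^ q ≤ ε / (4 * (C + 1)) := by
    refine (hDr (r n) (hr n) (hK n) B).trans ?_
    have h1 : D * ∫ x in B, |r n x| ^ 2 ≤ ε / (8 * (C + 1)) := by
      calc D * ∫ x in B, |r n x| ^ 2 ≤ (D + 1) * (ε / (8 * (C + 1) * (D + 1))) := by
            gcongr
            · linarith
            · exact (hN n hn).le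
        _ = ε / (8 * (C + 1)) := by field_simp
    calc _ ≤ ε / (8 * (C + 1)) + ε / (8 * (C + 1)) := by gcongr
      _ = _ := by field_simp; norm_num
  have hJ : functionalJ f (u + r n) - functionalJ f u - functionalJ f (r n) =
      ∫ x, (f ((u + r n : L2) x) - f (u x) - f (r n x)) := by
    have i1 := hf.integrable_comp hq hq' (hu.add (hr n))
    have i2 := hf.integrable_comp hq hq' hu
    have i3 := hf.integrable_comp hq hq' (hr n)
    have i12 : Integrable fun x => f ((u + r n : L2) x) - f (u x) := i1.sub i2
    rw [integral_sub i12 i3, integral_sub i1 i2]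
    rfl
  have j1 : Integrable fun x => |u x| ^ q + |r n x| ^ q := iu.add ir
  have j2 : Integrable fun x => B.indicator (fun x => |r n x| ^ q) x +
      Bᶜ.indicator (fun x => |u x| ^ q) x := (ir.indicator hBm).add (iu.indicator hBm.compl)
  rw [Real.dist_eq, sub_zero, hJ]
  calc |∫ x, (f ((u + r n : L2) x) - f (u x) - f (r n x))|
      ≤ ∫ x, (δ * (|u x| ^ q + |r n x| ^ q) + C * (B.indicator (fun x => |r n x| ^ q) x +
          Bᶜ.indicator (fun x => |u x| ^ q) x)) := by
        rw [← Real.norm_eq_abs]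
        refine norm_integral_le_of_norm_le ((j1.const_mul _).add (j2.const_mul _)) ?_
        filter_upwards [Lp.coeFn_add u (r n)] with x hx
        rw [hx, Pi.add_apply, Real.norm_eq_abs]
        have p1 : 0 ≤ |u x| ^ q := by positivity
        have p2 : 0 ≤ |r n x| ^ q := by positivity
        -- The pointwise inequality is not symmetric. In the ball the large constant falls on `r n`,
        -- which is locally small; outside it falls on `u`, whose tail is small.
        by_cases hxB : x ∈ B
        · rw [Set.indicator_of_mem hxB, Set.indicator_of_notMem (by simpa using hxB)]
          have h1 := hCab (u x) (r n x)
          nlinarith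
        · rw [Set.indicator_of_notMem hxB, Set.indicator_of_mem hxB]
          have h1 := hCab (r n x) (u x)
          rw [add_comm (r n x), sub_right_comm] at h1
          nlinarith
    _ = δ * (U + ∫ x, |r n x| ^ q) + C * ((∫ x in B, |r n x| ^ q) + ∫ x in Bᶜ, |u x| ^ q) := by
        rw [integral_add (j1.const_mul _) (j2.const_mul _), integral_const_mul,
          integral_const_mul, integral_add iu ir,
          integral_add (ir.indicator hBm) (iu.indicator hBm.compl), integral_indicator hBm,
          integral_indicator hBm.compl]
    _ ≤ δ * (U + S) + (C + 1) * (ε / (4 * (C + 1)) + ε / (4 * (C + 1))) := by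
        have h0 : 0 ≤ (∫ x in B, |r n x| ^ q) + ∫ x in Bᶜ, |u x| ^ q :=
          add_nonneg (integral_nonneg fun x => by positivity)
            (integral_nonneg fun x => by positivity)
        gcongr
        · exact hSr _ (hr n) (hK n)
        · linarith
    _ < ε := by
        have h1 : δ * (U + S) ≤ ε / 4 := by
          rw [hδ, div_mul_eq_mul_div, div_le_iff₀ (by positivity)]
          nlinarith
        have h2 : (C + 1) * (ε / (4 * (C + 1)) + ε / (4 * (C + 1))) = ε / 2 := by
          field_simp; norm_num
        linarith

end Power

theorem energyJ_eq (k m : ℕ) (u : L2) : energyJ k m u = functionalJ (oddPow (k + 2 * m) m) u := rfl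

/-! ### Behaviour of the functionals under translation and dilation -/

section Translate

variable (a : Plane)

theorem norm_fourierL2_translate_ae (u : L2) :
    (fun ξ => ‖fourierL2 (translate a u) ξ‖ₑ) =ᵐ[volume] fun ξ => ‖fourierL2 u ξ‖ₑ := by
  filter_upwards [fourierL2_translate a u] with ξ h
  rw [h, enorm_mul, ← ofReal_norm (_ : ℂ), Circle.norm_coe, ENNReal.ofReal_one, one_mul]

theorem dySq_translate (u : L2) : dySq (translate a u) = dySq u := by
  refine lintegral_congr_ae ?_
  filter_upwards [norm_fourierL2_translate_ae a u] with ξ h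
  rw [h]

theorem dxHalfSq_translate (u : L2) : dxHalfSq (translate a u) = dxHalfSq u := by
  refine lintegral_congr_ae ?_
  filter_upwards [norm_fourierL2_translate_ae a u] with ξ h
  rw [h]

theorem norm_translate (u : L2) : ‖translate a u‖ = ‖u‖ :=
  Lp.norm_compMeasurePreserving u (measurePreserving_add_right volume a)

theorem zNorm_translate (u : L2) : zNorm (translate a u) = zNorm u := by
  rw [zNorm, zNorm, dySq_translate, dxHalfSq_translate, ← ofReal_norm, ← ofReal_norm,
    norm_translate]

theorem MemZ.translate {u : L2} (hu : MemZ u) : MemZ (translate a u) := by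
  rw [MemZ, zNorm_translate]; exact hu

theorem energyI_translate (c : ℝ) (u : L2) : energyI c (translate a u) = energyI c u := by
  rw [energyI, energyI, dySq_translate, dxHalfSq_translate, norm_translate]

theorem functionalJ_translate (f : ℝ → ℝ) (u : L2) :
    functionalJ f (translate a u) = functionalJ f u := by
  rw [functionalJ, functionalJ, ← integral_add_right_eq_self (fun x => f (u x)) a]
  refine integral_congr_ae ?_
  filter_upwards [coeFn_translate a u] with x hx
  rw [hx]

theorem translate_sub (u v : L2) : translate a (u - v) = translate a u - translate a v :=
  map_sub (Lp.compMeasurePreserving (fun x => x + a) (measurePreserving_add_right volume a)) u v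

theorem translate_neg_translate (u : L2) : translate (-a) (translate a u) = u := by
  refine Lp.ext ?_
  have h := (measurePreserving_add_right (volume : Measure Plane) (-a)).quasiMeasurePreserving.ae
    (coeFn_translate a u)
  filter_upwards [coeFn_translate (-a) (translate a u), h] with x h1 h2
  rw [h1, h2, neg_add_cancel_right]

/-- Frequency cutoffs commute with translations. This brings a point where the low part is large to
the origin. -/
theorem lowPart_translate (R : ℝ) (u : L2) (x : Plane) :
    lowPart R (fourierL2 (translate a u)) x = lowPart R (fourierL2 u) (x + a) := by
  rw [lowPart, lowPart, Real.fourierInv_eq, Real.fourierInv_eq]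
  refine integral_congr_ae ?_
  filter_upwards [fourierL2_translate a u, coeFn_mulFn (memMul_lowCut R (fourierL2 u)),
    coeFn_mulFn (memMul_lowCut R (fourierL2 (translate a u)))] with ξ h1 h2 h3
  rw [h2, h3, h1, inner_add_right, AddChar.map_add_eq_mul]
  simp only [Circle.smul_def, smul_eq_mul, Circle.coe_mul]
  ring

end Translate

section Dilation

variable {α β : ℝ}

theorem lintegral_fourierL2_dilate (hα : 0 < α) (hβ : 0 < β) (u : L2) (w : Plane → ℝ≥0∞) :
    ∫⁻ ξ, w ξ * ‖fourierL2 (dilate hα.ne' hβ.ne' u) ξ‖ₑ ^ 2 =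
      ENNReal.ofReal (α * β)⁻¹ *
        ∫⁻ ξ, w (diag α β hα.ne' hβ.ne' ξ) * ‖fourierL2 u ξ‖ₑ ^ 2 := by
  have hab : 0 < α * β := mul_pos hα hβ
  have e : ∫⁻ ξ, w ξ * ‖fourierL2 (dilate hα.ne' hβ.ne' u) ξ‖ₑ ^ 2 =
      ∫⁻ ξ, ENNReal.ofReal ((α * β)⁻¹ ^ 2) *
        (w ξ * ‖fourierL2 u ((diag α β hα.ne' hβ.ne').symm ξ)‖ₑ ^ 2) := by
    refine lintegral_congr_ae ?_
    filter_upwards [fourierL2_dilate hα.ne' hβ.ne' u] with ξ h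
    rw [h, abs_of_pos (inv_pos.2 hab), enorm_smul, mul_pow, ← ofReal_norm (α * β)⁻¹,
      Real.norm_of_nonneg (inv_pos.2 hab).le, ← ENNReal.ofReal_pow (inv_pos.2 hab).le]
    ring
  have h2 := lintegral_comp_diag hα.ne' hβ.ne'
    (fun ξ => w ξ * ‖fourierL2 u ((diag α β hα.ne' hβ.ne').symm ξ)‖ₑ ^ 2)
  simp only [ContinuousLinearEquiv.symm_apply_apply] at h2
  rw [e, lintegral_const_mul' _ _ ENNReal.ofReal_ne_top, h2, abs_of_pos (inv_pos.2 hab),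
    ← mul_assoc, ← ENNReal.ofReal_mul (inv_pos.2 hab).le, sq]

theorem norm_sq_dilate (hα : 0 < α) (hβ : 0 < β) (u : L2) :
    ‖dilate hα.ne' hβ.ne' u‖ ^ 2 = (α * β)⁻¹ * ‖u‖ ^ 2 := by
  have h := lintegral_fourierL2_dilate hα hβ u (fun _ => 1)
  simp only [one_mul, lintegral_enorm_sq, enorm_fourierL2] at h
  have h' := congrArg ENNReal.toReal h
  simpa [ENNReal.toReal_mul, ENNReal.toReal_ofReal, hα.le, hβ.le] using h'

theorem dxHalfSq_dilate (hα : 0 < α) (hβ : 0 < β) (u : L2) :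
    dxHalfSq (dilate hα.ne' hβ.ne' u) = ENNReal.ofReal β⁻¹ * dxHalfSq u := by
  rw [dxHalfSq, lintegral_fourierL2_dilate hα hβ]
  have e : ∀ ξ : Plane, ENNReal.ofReal |2 * Real.pi * (diag α β hα.ne' hβ.ne' ξ) 0| *
      ‖fourierL2 u ξ‖ₑ ^ 2 =
      ENNReal.ofReal α * (ENNReal.ofReal |2 * Real.pi * ξ 0| * ‖fourierL2 u ξ‖ₑ ^ 2) := by
    intro ξ
    rw [diag_apply_zero, mul_left_comm, abs_mul, abs_of_pos hα, ENNReal.ofReal_mul hα.le, mul_assoc]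
  simp only [e]
  rw [lintegral_const_mul' _ _ ENNReal.ofReal_ne_top, ← mul_assoc,
    ← ENNReal.ofReal_mul (by positivity), dxHalfSq]
  congr 2
  field_simp

theorem dySq_dilate (hα : 0 < α) (hβ : 0 < β) (u : L2) :
    dySq (dilate hα.ne' hβ.ne' u) = ENNReal.ofReal (β / α) * dySq u := by
  rw [dySq, lintegral_fourierL2_dilate hα hβ]
  have e : ∀ ξ : Plane, ENNReal.ofReal ((2 * Real.pi * (diag α β hα.ne' hβ.ne' ξ) 1) ^ 2) *
      ‖fourierL2 u ξ‖ₑ ^ 2 =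
      ENNReal.ofReal (β ^ 2) *
        (ENNReal.ofReal ((2 * Real.pi * ξ 1) ^ 2) * ‖fourierL2 u ξ‖ₑ ^ 2) := by
    intro ξ
    rw [diag_apply_one, mul_left_comm, mul_pow, ENNReal.ofReal_mul (by positivity), mul_assoc]
  simp only [e]
  rw [lintegral_const_mul' _ _ ENNReal.ofReal_ne_top, ← mul_assoc,
    ← ENNReal.ofReal_mul (by positivity), dySq]
  congr 2
  field_simp

theorem functionalJ_dilate (hα : 0 < α) (hβ : 0 < β) (f : ℝ → ℝ) (u : L2) :
    functionalJ f (dilate hα.ne' hβ.ne' u) = (α * β)⁻¹ * functionalJ f u := by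
  have h := integral_comp_diag hα.ne' hβ.ne' (fun x => f (u x))
  rw [abs_of_pos (inv_pos.2 (mul_pos hα hβ)), smul_eq_mul] at h
  rw [functionalJ, functionalJ, ← h]
  refine integral_congr_ae ?_
  filter_upwards [coeFn_dilate hα.ne' hβ.ne' u] with x hx
  rw [hx]

theorem MemZ.dilate {u : L2} (hu : MemZ u) (hα : 0 < α) (hβ : 0 < β) :
    MemZ (dilate hα.ne' hβ.ne' u) := by
  rw [memZ_iff] at hu ⊢
  rw [dySq_dilate hα hβ, dxHalfSq_dilate hα hβ]
  exact ⟨ENNReal.mul_lt_top ENNReal.ofReal_lt_top hu.1,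
    ENNReal.mul_lt_top ENNReal.ofReal_lt_top hu.2⟩

/-- The energy of a dilate. -/
theorem energyI_dilate (hα : 0 < α) (hβ : 0 < β) (c : ℝ) (u : L2) :
    energyI c (dilate hα.ne' hβ.ne' u) =
      (1 / 2) * (c * ((α * β)⁻¹ * ‖u‖ ^ 2) + β⁻¹ * (dxHalfSq u).toReal +
        β / α * (dySq u).toReal) := by
  rw [energyI, norm_sq_dilate hα hβ, dxHalfSq_dilate hα hβ, dySq_dilate hα hβ, ENNReal.toReal_mul,
    ENNReal.toReal_mul, ENNReal.toReal_ofReal (by positivity), ENNReal.toReal_ofReal (by positivity)]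

end Dilation

/-! ### An admissible test function -/

theorem inner_ex (ξ : Plane) : inner ℝ ξ ex = ξ 0 := by
  simp [ex, EuclideanSpace.inner_single_right]

theorem inner_ey (ξ : Plane) : inner ℝ ξ ey = ξ 1 := by
  simp [ey, EuclideanSpace.inner_single_right]

theorem fourier_lineDerivOp_apply (ψ : 𝓢(Plane, ℂ)) (a ξ : Plane) :
    (𝓕 (∂_{a} ψ)) ξ = 2 * Real.pi * Complex.I * (inner ℝ ξ a : ℝ) * (𝓕 ψ) ξ := by
  rw [SchwartzMap.fourier_lineDerivOp_eq, smul_apply,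
    SchwartzMap.smulLeftCLM_apply_apply (Function.hasTemperateGrowth_inner_left a)]
  simp [mul_assoc]

/-- The square root of the weight is at most `2 + |2πξ₀| + |2πξ₁|`, and the transforms of `ψ` and of
its first derivatives are square integrable. -/
theorem memMul_sqwt_of_schwartz {F : CL2} {ψ : 𝓢(Plane, ℂ)}
    (h : F =ᵐ[volume] (𝓕 ψ : 𝓢(Plane, ℂ))) :
    MemMul (sqwt 1) F := by
  have m0 : MemLp (fun ξ => ‖(𝓕 ψ) ξ‖) 2 (volume : Measure Plane) := ((𝓕 ψ).memLp 2).norm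
  have m1 : MemLp (fun ξ => ‖(𝓕 (∂_{ex} ψ)) ξ‖) 2 (volume : Measure Plane) :=
    ((𝓕 (∂_{ex} ψ)).memLp 2).norm
  have m2 : MemLp (fun ξ => ‖(𝓕 (∂_{ey} ψ)) ξ‖) 2 (volume : Measure Plane) :=
    ((𝓕 (∂_{ey} ψ)).memLp 2).norm
  refine MemLp.of_le ((m0.const_mul 2).add (m1.add m2))
    ((measurable_sqwt 1).aestronglyMeasurable.mul (Lp.aestronglyMeasurable F)) ?_
  filter_upwards [h] with ξ hξ
  have e1 : ‖(𝓕 (∂_{ex} ψ)) ξ‖ = |2 * Real.pi * ξ 0| * ‖(𝓕 ψ) ξ‖ := by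
    rw [fourier_lineDerivOp_apply, inner_ex]
    simp [abs_mul]
  have e2 : ‖(𝓕 (∂_{ey} ψ)) ξ‖ = |2 * Real.pi * ξ 1| * ‖(𝓕 ψ) ξ‖ := by
    rw [fourier_lineDerivOp_apply, inner_ey]
    simp [abs_mul]
  have hs : ‖sqwt 1 ξ‖ ≤ 2 + |2 * Real.pi * ξ 0| + |2 * Real.pi * ξ 1| := by
    refine abs_le_of_sq_le_sq' ?_ (by positivity) |>.2
    rw [norm_sqwt_sq zero_le_one, wt, ← sq_abs (2 * Real.pi * ξ 1)]
    nlinarith [abs_nonneg (2 * Real.pi * ξ 0), abs_nonneg (2 * Real.pi * ξ 1),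
      mul_nonneg (abs_nonneg (2 * Real.pi * ξ 0)) (abs_nonneg (2 * Real.pi * ξ 1)),
      sq_nonneg |2 * Real.pi * ξ 0|]
  rw [hξ, norm_mul, Real.norm_of_nonneg]
  · simp only [Pi.add_apply, e1, e2]
    nlinarith [norm_nonneg ((𝓕 ψ) ξ)]
  · simp only [Pi.add_apply]; positivity

/-- A nonnegative nontrivial test function. -/
theorem exists_pos_energyJ {k m : ℕ} (hk : 0 < k) (hm : Odd m) :
    ∃ u : L2, MemZ u ∧ 0 < energyJ k m u := by
  let b : ContDiffBump (0 : Plane) := default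
  have hbc : HasCompactSupport b := b.hasCompactSupport
  have hbc' : HasCompactSupport fun x => (b x : ℂ) := hbc.comp_left Complex.ofReal_zero
  let ψ : 𝓢(Plane, ℂ) := hbc'.toSchwartzMap (Complex.ofRealCLM.contDiff.comp b.contDiff)
  have hψ : ∀ x, ψ x = (b x : ℂ) := fun x => rfl
  have hL : MemLp (fun x => b x) 2 (volume : Measure Plane) := b.continuous.memLp_of_hasCompactSupport hbc
  have hu : hL.toLp _ =ᵐ[volume] fun x => b x := hL.coeFn_toLp
  refine ⟨hL.toLp _, ?_, ?_⟩
  · rw [memZ_iff_memMul zero_le_one]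
    refine memMul_sqwt_of_schwartz (ψ := ψ) ?_
    have h1 : toComplex (hL.toLp _) = ψ.toLp 2 := by
      refine Lp.ext ?_
      filter_upwards [coeFn_toComplex (hL.toLp _), hu, ψ.coeFn_toLp 2] with x h1 h2 h3
      rw [h1, h2, h3, hψ]
    rw [fourierL2, h1, SchwartzMap.toLp_fourier_eq]
    exact (𝓕 ψ).coeFn_toLp 2
  · have hf := isPower_oddPow hk hm
    have hp : (0 : ℝ) ≤ (k : ℝ) / m := by positivity
    have e : energyJ k m (hL.toLp _) = ∫ x, b x ^ ((k : ℝ) / m + 2) := by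
      refine integral_congr_ae ?_
      filter_upwards [hu] with x hx
      rw [hx]
      have h1 := hf.abs_eq (b x)
      rw [abs_of_nonneg b.nonneg] at h1
      rw [← h1, abs_of_nonneg]
      rcases (b.nonneg (x := x)).eq_or_lt with h | h
      · rw [← h, oddPow_zero (by omega)]
      · rw [oddPow_of_pos h]; positivity
    rw [e]
    refine Continuous.integral_pos_of_hasCompactSupport_nonneg_nonzero (x := 0) ?_ ?_ ?_ ?_
    · exact b.continuous.rpow_const fun x => Or.inr (by positivity)
    · exact hbc.comp_left (g := fun t : ℝ => t ^ ((k : ℝ) / m + 2))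
        (Real.zero_rpow (by positivity))
    · intro x
      exact Real.rpow_nonneg b.nonneg _
    · have : b 0 = 1 := b.one_of_mem_closedBall (Metric.mem_closedBall_self b.rIn_pos.le)
      simp [this]

theorem energyI_nonneg {c : ℝ} (hc : 0 ≤ c) (u : L2) : 0 ≤ energyI c u := by
  rw [energyI]
  have := mul_nonneg hc (sq_nonneg ‖u‖)
  positivity

theorem norm_zLift_one_sq_le (c : ℝ) {u : L2} (hu : MemZ u) :
    min c 1 * ‖zLift 1 u‖ ^ 2 ≤ 2 * energyI c u := by
  rw [norm_zLift_sq zero_le_one hu, energyI, energyI]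
  have h1 : 0 ≤ ‖u‖ ^ 2 := by positivity
  have h2 : 0 ≤ (dxHalfSq u).toReal := by positivity
  have h3 : 0 ≤ (dySq u).toReal := by positivity
  have h4 : min c 1 ≤ c := min_le_left _ _
  have h5 : min c 1 ≤ 1 := min_le_right _ _
  nlinarith [mul_le_mul_of_nonneg_right h4 h1, mul_le_mul_of_nonneg_right h5 h2,
    mul_le_mul_of_nonneg_right h5 h3]

/-! ### The minimization problem and its scaling -/

/-- The set of energies of the functions with `J = lam`. -/
def energySet (k m : ℕ) (c lam : ℝ) : Set ℝ :=
  {r : ℝ | ∃ u : L2, MemZ u ∧ energyJ k m u = lam ∧ energyI c u = r}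

section Variational

variable {k m : ℕ}

theorem functionalJ_zero (f : ℝ → ℝ) (h0 : f 0 = 0) : functionalJ f (0 : L2) = 0 := by
  rw [functionalJ, ← integral_zero Plane ℝ]
  refine integral_congr_ae ?_
  filter_upwards [Lp.coeFn_zero ℝ 2 (volume : Measure Plane)] with x hx
  rw [hx, Pi.zero_apply, h0]

theorem memZ_zero : MemZ 0 := by
  obtain ⟨u, hu, -⟩ := exists_pos_energyJ (k := 1) (m := 1) one_pos odd_one
  simpa using hu.smul 0

theorem zLift_zero {c : ℝ} (hc : 0 ≤ c) : zLift c 0 = 0 := by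
  have := zLift_sub hc memZ_zero memZ_zero
  simpa using this

theorem energyJ_smul (hk : 0 < k) (hm : Odd m) {θ : ℝ} (hθ : 0 < θ) (u : L2) :
    energyJ k m (θ • u) = θ ^ ((k : ℝ) / m + 2) * energyJ k m u :=
  (isPower_oddPow hk hm).functionalJ_smul hθ u

/-- Multiplying `u` by `lam^{±1/(p+2)}` exchanges the constraints `J = 1` and `J = lam`, while `I`
scales quadratically. -/
theorem energySet_eq_smul (hk : 0 < k) (hm : Odd m) (c : ℝ) {lam : ℝ} (hlam : 0 < lam) :
    energySet k m c lam = lam ^ (2 / ((k : ℝ) / m + 2)) • energySet k m c 1 := by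
  set q := (k : ℝ) / m + 2 with hqdef
  have hq : 0 < q := by positivity
  ext r
  rw [Set.mem_smul_set]
  constructor
  · rintro ⟨u, hu, hJ, hI⟩
    set θ := lam ^ (-1 / q) with hθ
    have hθpos : 0 < θ := by positivity
    refine ⟨_, ⟨θ • u, hu.smul θ, ?_, rfl⟩, ?_⟩
    · rw [energyJ_smul hk hm hθpos, hJ, hθ, ← Real.rpow_mul hlam.le, div_mul_cancel₀ _ hq.ne',
        Real.rpow_neg_one, inv_mul_cancel₀ hlam.ne']
    · rw [energyI_smul, hI, hθ, smul_eq_mul, ← mul_assoc, ← Real.rpow_natCast, ← Real.rpow_mul hlam.le,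
        ← Real.rpow_add hlam]
      have : 2 / q + -1 / q * ((2 : ℕ) : ℝ) = 0 := by push_cast; ring
      rw [this, Real.rpow_zero, one_mul]
  · rintro ⟨s, ⟨u, hu, hJ, hI⟩, rfl⟩
    set θ := lam ^ (1 / q) with hθ
    have hθpos : 0 < θ := by positivity
    refine ⟨θ • u, hu.smul θ, ?_, ?_⟩
    · rw [energyJ_smul hk hm hθpos, hJ, hθ, ← Real.rpow_mul hlam.le, div_mul_cancel₀ _ hq.ne',
        Real.rpow_one, mul_one]
    · rw [energyI_smul, hI, hθ, smul_eq_mul, ← Real.rpow_natCast, ← Real.rpow_mul hlam.le]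
      congr 2
      push_cast
      ring

theorem minI_eq (hk : 0 < k) (hm : Odd m) (c : ℝ) {lam : ℝ} (hlam : 0 < lam) :
    minI k m c lam = lam ^ (2 / ((k : ℝ) / m + 2)) * minI k m c 1 := by
  change sInf (energySet k m c lam) = _ * sInf (energySet k m c 1)
  rw [energySet_eq_smul hk hm c hlam, Real.sInf_smul_of_nonneg (by positivity), smul_eq_mul]

/-- `J` is continuous at `0` in the energy space, so `J = 1` keeps the energy norm away from `0`.
The infimum is over a nonempty set, thanks to the test function and scaling. -/
theorem minI_one_pos (hk : 0 < k) (hm : Odd m) (hp43 : (k : ℝ) / m < 4 / 3) {c : ℝ} (hc : 0 < c) :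
    0 < minI k m c 1 := by
  have hkm : (0 : ℝ) < (k : ℝ) / m := by
    have := hm.pos
    positivity
  have hf := isPower_oddPow hk hm
  obtain ⟨δ, hδ, h⟩ := hf.exists_abs_functionalJ_add_sub_le (by linarith) (by linarith) 0
    (ε := 1 / 2) (by norm_num)
  have hlow : ∀ r ∈ energySet k m c 1, min c 1 * δ ^ 2 / 2 ≤ r := by
    rintro r ⟨u, hu, hJ, rfl⟩
    have h1 : δ < ‖zLift 1 u‖ := by
      by_contra hcon
      have := h 0 u memZ_zero hu (by rw [zLift_zero zero_le_one, norm_zero]) (not_lt.1 hcon)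
      rw [zero_add, functionalJ_zero _ (hf.apply_zero (by linarith)), sub_zero, ← energyJ_eq, hJ] at this
      norm_num at this
    have h2 := norm_zLift_one_sq_le c hu
    have h3 : δ ^ 2 ≤ ‖zLift 1 u‖ ^ 2 := by gcongr
    have h4 : 0 < min c 1 := by positivity
    nlinarith [mul_le_mul_of_nonneg_left h3 h4.le]
  have hne : (energySet k m c 1).Nonempty := by
    obtain ⟨u, hu, hJ⟩ := exists_pos_energyJ hk hm
    have : (energySet k m c (energyJ k m u)).Nonempty := ⟨_, u, hu, rfl, rfl⟩
    rw [energySet_eq_smul hk hm c hJ] at this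
    exact Set.smul_set_nonempty.1 this
  have : min c 1 * δ ^ 2 / 2 ≤ minI k m c 1 := le_csInf hne hlow
  refine lt_of_lt_of_le ?_ this
  positivity

theorem minI_one_mul_le (hk : 0 < k) (hm : Odd m) {c : ℝ} (hc : 0 < c) {v : L2} (hv : MemZ v)
    (hJ : 0 < energyJ k m v) :
    (energyJ k m v) ^ (2 / ((k : ℝ) / m + 2)) * minI k m c 1 ≤ energyI c v := by
  rw [← minI_eq hk hm c hJ]
  refine csInf_le ⟨0, ?_⟩ ⟨v, hv, rfl, rfl⟩
  rintro r ⟨u, -, -, rfl⟩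
  exact energyI_nonneg hc.le u

/-- The data of the minimization problem at the level `lam`, where `S = 2 I_lam`. -/
structure IsLevel (k m : ℕ) (c lam S : ℝ) : Prop where
  hk : 0 < k
  hm : Odd m
  hp43 : (k : ℝ) / m < 4 / 3
  hc : 0 < c
  S_pos : 0 < S
  lam_eq : lam = ((k : ℝ) / m + 1) * S
  minI_lam : minI k m c lam = S / 2

/-- The given `lam` satisfies `lam^{p/(p+2)} = 2(p+1) I_1`; multiplying by `lam^{2/(p+2)}` turns
this into `lam = 2(p+1) I_lam`. -/
theorem isLevel (hk : 0 < k) (hm : Odd m) {p : ℝ} (hp : p = (k : ℝ) / m) (hp43 : p < 4 / 3)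
    {c : ℝ} (hc : 0 < c) {lam : ℝ}
    (hlam : lam = (2 * (p + 1) * minI k m c 1) ^ ((p + 2) / p)) :
    IsLevel k m c lam (lam / (p + 1)) := by
  have hI := minI_one_pos hk hm (hp ▸ hp43) hc
  have hm0 := hm.pos
  have hpp : 0 < p := by rw [hp]; positivity
  have hb : 0 < 2 * (p + 1) * minI k m c 1 := by positivity
  have hl : 0 < lam := by rw [hlam]; positivity
  refine ⟨hk, hm, hp ▸ hp43, hc, by positivity, ?_, ?_⟩
  · rw [← hp]; field_simp
  · rw [minI_eq hk hm c hl, ← hp]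
    have h1 : 2 * (p + 1) * minI k m c 1 = lam ^ (p / (p + 2)) := by
      rw [hlam, ← Real.rpow_mul hb.le]
      have : (p + 2) / p * (p / (p + 2)) = 1 := by field_simp
      rw [this, Real.rpow_one]
    have h2 : lam ^ (2 / (p + 2)) * lam ^ (p / (p + 2)) = lam := by
      rw [← Real.rpow_add hl]
      have : 2 / (p + 2) + p / (p + 2) = 1 := by field_simp; ring
      rw [this, Real.rpow_one]
    rw [div_div, eq_div_iff (by positivity)]
    calc _ = lam ^ (2 / (p + 2)) * (2 * (p + 1) * minI k m c 1) := by ring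
      _ = lam := by rw [h1, h2]

variable {c lam S : ℝ}

theorem IsLevel.p_pos (h : IsLevel k m c lam S) : 0 < (k : ℝ) / m := by
  have := h.hm.pos
  have := h.hk
  positivity

theorem IsLevel.lam_pos (h : IsLevel k m c lam S) : 0 < lam := by
  rw [h.lam_eq]
  have := h.S_pos
  have := h.p_pos
  positivity

theorem IsLevel.groundSet_eq (h : IsLevel k m c lam S) :
    groundSet k m c lam = minimizers k m c lam := by
  have hp := h.p_pos
  have e := h.lam_eq
  have e2 := h.minI_lam
  ext u
  constructor
  · rintro ⟨hu, h1, h2⟩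
    refine ⟨hu, ?_, h1.trans h2⟩
    rw [e2]
    have h4 : ((k : ℝ) / m + 1) * (2 * energyI c u) = ((k : ℝ) / m + 1) * S := by
      rw [← e, ← h2]; ring
    have := mul_left_cancel₀ (by positivity) h4
    linarith
  · rintro ⟨hu, h1, h2⟩
    have h3 : 2 * ((k : ℝ) / m + 1) * energyI c u = lam := by
      rw [h1, e2, e]; ring
    exact ⟨hu, h2.trans h3.symm, h3⟩

/-- Minimality at the level `J(v)`, rescaled to the level `lam`. Where `J(v) ≤ 0` there is nothing
to prove, the right side being nonnegative. -/
theorem IsLevel.energyJ_le (h : IsLevel k m c lam S) {v : L2} (hv : MemZ v) :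
    energyJ k m v ≤ lam * (2 * energyI c v / S) ^ (((k : ℝ) / m + 2) / 2) := by
  have hp := h.p_pos
  have hS := h.S_pos
  have hl := h.lam_pos
  have hI := energyI_nonneg h.hc.le v
  rcases le_or_gt (energyJ k m v) 0 with hJ | hJ
  · exact hJ.trans (by positivity)
  · have h1 := minI_one_mul_le h.hk h.hm h.hc hv hJ
    have h2 := minI_eq h.hk h.hm c hl
    rw [h.minI_lam] at h2
    set q := (k : ℝ) / m + 2 with hq
    have hqpos : 0 < q := by positivity
    have hlq : 0 < lam ^ (2 / q) := by positivity
    have h3 : (energyJ k m v / lam) ^ (2 / q) ≤ 2 * energyI c v / S := by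
      rw [Real.div_rpow hJ.le hl.le, div_le_div_iff₀ hlq hS]
      have : S = 2 * (lam ^ (2 / q) * minI k m c 1) := by linarith
      rw [this]
      nlinarith
    have h4 := Real.rpow_le_rpow (by positivity) h3 (by positivity : 0 ≤ q / 2)
    rw [← Real.rpow_mul (by positivity)] at h4
    have : 2 / q * (q / 2) = 1 := by field_simp
    rw [this, Real.rpow_one, div_le_iff₀ hl] at h4
    linarith

/-- The inequality `J ≤ lam (2 I / S) ^ (q / 2)` for mass-preserving dilates. -/
theorem IsLevel.energyJ_dilate_le (h : IsLevel k m c lam S) {v : L2} (hv : MemZ v) {α β : ℝ}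
    (hα : 0 < α) (hβ : 0 < β) :
    (α * β) ^ ((k : ℝ) / m / 2) * energyJ k m v ≤
      lam * ((c * ‖v‖ ^ 2 + α * (dxHalfSq v).toReal + β ^ 2 * (dySq v).toReal) / S) ^
        (((k : ℝ) / m + 2) / 2) := by
  have hab : 0 < α * β := mul_pos hα hβ
  have hθ : 0 < √(α * β) := by positivity
  -- The amplitude `√(αβ)` keeps the mass fixed; the `x`-seminorm is then multiplied by `α`, the
  -- `y`-seminorm by `β²` and `J` by `(αβ)^{p/2}`.
  have h1 := h.energyJ_le ((hv.dilate hα hβ).smul (√(α * β)))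
  rw [energyJ_smul h.hk h.hm hθ, energyI_smul, Real.sq_sqrt hab.le, energyI_dilate hα hβ,
    energyJ_eq, functionalJ_dilate hα hβ, ← energyJ_eq, ← mul_assoc] at h1
  have e1 : √(α * β) ^ ((k : ℝ) / m + 2) * (α * β)⁻¹ = (α * β) ^ ((k : ℝ) / m / 2) := by
    rw [Real.sqrt_eq_rpow, ← Real.rpow_mul hab.le, ← Real.rpow_neg_one, ← Real.rpow_add hab]
    congr 1
    ring
  rw [e1] at h1
  refine h1.trans (le_of_eq ?_)
  congr 3
  field_simp

end Variational

/-! ### Pohozaev identities and the sharp Gagliardo–Nirenberg inequality -/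

/-- If `a + b t ^ n` touches `S t ^ r` from above at `t = 1`, then the slopes agree. -/
theorem slope_eq_of_touching {a b S r : ℝ} {n : ℕ} (h1 : a + b = S)
    (h : ∀ t : ℝ, 0 < t → S * t ^ r ≤ a + t ^ n * b) : n * b = S * r := by
  have hmin : IsLocalMin (fun t : ℝ => a + t ^ n * b - S * t ^ r) 1 := by
    filter_upwards [Ioi_mem_nhds zero_lt_one] with t ht
    have := h t ht
    simp only [one_pow, one_mul, Real.one_rpow, mul_one]
    linarith
  have hd : HasDerivAt (fun t : ℝ => a + t ^ n * b - S * t ^ r)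
      ((n * 1 ^ (n - 1)) * b - S * (r * 1 ^ (r - 1))) 1 :=
    (((hasDerivAt_pow n (1 : ℝ)).mul_const b).const_add a).sub
      ((Real.hasDerivAt_rpow_const (Or.inl one_ne_zero)).const_mul S)
  have h0 := hmin.hasDerivAt_eq_zero hd
  simp only [one_pow, Real.one_rpow, mul_one] at h0
  linarith

section Variational

variable {k m : ℕ} {c lam S : ℝ}

/-- For a minimizer `J = lam` cancels from the dilation inequality, and the power `2/(p+2)`
linearizes the right side. Equality at `α = β = 1` makes this a first-order condition. -/
theorem IsLevel.touching (h : IsLevel k m c lam S) {φ : L2} (hφ : φ ∈ minimizers k m c lam)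
    {α β : ℝ} (hα : 0 < α) (hβ : 0 < β) :
    S * (α * β) ^ (((k : ℝ) / m) / ((k : ℝ) / m + 2)) ≤
      c * ‖φ‖ ^ 2 + α * (dxHalfSq φ).toReal + β ^ 2 * (dySq φ).toReal := by
  have hp := h.p_pos
  have hS := h.S_pos
  have hl := h.lam_pos
  have hc := h.hc
  have h1 := h.energyJ_dilate_le hφ.1 hα hβ
  have hab : 0 < α * β := mul_pos hα hβ
  rw [hφ.2.2, mul_comm, mul_le_mul_iff_right₀ hl] at h1
  set p := (k : ℝ) / m
  set X := c * ‖φ‖ ^ 2 + α * (dxHalfSq φ).toReal + β ^ 2 * (dySq φ).toReal with hX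
  have hXnn : 0 ≤ X := by
    have := mul_nonneg hc.le (sq_nonneg ‖φ‖)
    positivity
  have h2 := Real.rpow_le_rpow (by positivity) h1 (by positivity : 0 ≤ 2 / (p + 2))
  rw [← Real.rpow_mul hab.le, ← Real.rpow_mul (by positivity)] at h2
  have e1 : p / 2 * (2 / (p + 2)) = p / (p + 2) := by field_simp
  have e2 : (p + 2) / 2 * (2 / (p + 2)) = 1 := by field_simp
  rw [e1, e2, Real.rpow_one, le_div_iff₀ hS] at h2
  linarith

/-- The Pohozaev identities. -/
theorem IsLevel.pohozaev (h : IsLevel k m c lam S) {φ : L2} (hφ : φ ∈ minimizers k m c lam) :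
    (dxHalfSq φ).toReal = S * (((k : ℝ) / m) / ((k : ℝ) / m + 2)) ∧
    2 * (dySq φ).toReal = S * (((k : ℝ) / m) / ((k : ℝ) / m + 2)) ∧
    c * ‖φ‖ ^ 2 + (dxHalfSq φ).toReal + (dySq φ).toReal = S := by
  have hsum : c * ‖φ‖ ^ 2 + (dxHalfSq φ).toReal + (dySq φ).toReal = S := by
    have h1 := hφ.2.1
    rw [h.minI_lam, energyI] at h1
    linarith
  refine ⟨?_, ?_, hsum⟩
  -- Varying `α` alone isolates the `x`-seminorm, which enters linearly; varying `β` alone isolates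
  -- the `y`-seminorm, which enters quadratically.
  · have := slope_eq_of_touching (n := 1) (a := c * ‖φ‖ ^ 2 + (dySq φ).toReal)
      (b := (dxHalfSq φ).toReal) (S := S) (r := ((k : ℝ) / m) / ((k : ℝ) / m + 2)) (by linarith)
      fun t ht => by
        have := h.touching hφ ht one_pos
        rw [mul_one, one_pow, one_mul] at this
        rw [pow_one]
        linarith
    simpa using this
  · have := slope_eq_of_touching (n := 2) (a := c * ‖φ‖ ^ 2 + (dxHalfSq φ).toReal)
      (b := (dySq φ).toReal) (S := S) (r := ((k : ℝ) / m) / ((k : ℝ) / m + 2)) (by linarith)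
      fun t ht => by
        have := h.touching hφ one_pos ht
        rwa [one_mul, one_mul] at this
    simpa using this

/-- The dilation `α = μ/a`, `β = √(μ/b)` brings all three quadratic terms to at most `μ` times those
of the minimizer, so their sum is at most `μ S`. Strict positivity of the ratios is needed to define
the dilation. -/
theorem IsLevel.energyJ_le_of_le (h : IsLevel k m c lam S) {φ : L2}
    (hφ : φ ∈ minimizers k m c lam) {v : L2} (hv : MemZ v) {μ a b : ℝ} (hμ : 0 < μ) (ha : 0 < a)
    (hb : 0 < b) (hM : ‖v‖ ^ 2 ≤ μ * ‖φ‖ ^ 2)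
    (hA : (dxHalfSq v).toReal ≤ a * (dxHalfSq φ).toReal)
    (hB : (dySq v).toReal ≤ b * (dySq φ).toReal) :
    energyJ k m v ≤ lam * (μ ^ (1 - (k : ℝ) / m / 4) * a ^ ((k : ℝ) / m / 2) *
      b ^ ((k : ℝ) / m / 4)) := by
  have hp := h.p_pos
  have hS := h.S_pos
  have hl := h.lam_pos
  have hc := h.hc
  obtain ⟨-, -, hsum⟩ := h.pohozaev hφ
  set p := (k : ℝ) / m with hpdef
  have hα : 0 < μ / a := by positivity
  have hβ : 0 < √(μ / b) := by positivity
  have h1 := h.energyJ_dilate_le hv hα hβ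
  rw [← hpdef, Real.sq_sqrt (by positivity)] at h1
  have hX : c * ‖v‖ ^ 2 + μ / a * (dxHalfSq v).toReal + μ / b * (dySq v).toReal ≤ μ * S := by
    have x1 : μ / a * (dxHalfSq v).toReal ≤ μ * (dxHalfSq φ).toReal := by
      calc μ / a * (dxHalfSq v).toReal ≤ μ / a * (a * (dxHalfSq φ).toReal) := by gcongr
        _ = _ := by field_simp
    have x2 : μ / b * (dySq v).toReal ≤ μ * (dySq φ).toReal := by
      calc μ / b * (dySq v).toReal ≤ μ / b * (b * (dySq φ).toReal) := by gcongr
        _ = _ := by field_simp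
    have x3 : c * ‖v‖ ^ 2 ≤ c * (μ * ‖φ‖ ^ 2) := by gcongr
    rw [← hsum]
    linarith
  have hXnn : 0 ≤ c * ‖v‖ ^ 2 + μ / a * (dxHalfSq v).toReal + μ / b * (dySq v).toReal := by
    have := mul_nonneg hc.le (sq_nonneg ‖v‖)
    positivity
  have h2 : (μ / a * √(μ / b)) ^ (p / 2) * energyJ k m v ≤ lam * μ ^ ((p + 2) / 2) := by
    refine h1.trans ?_
    gcongr
    rw [div_le_iff₀ hS]
    exact hX
  have hpos : 0 < (μ / a * √(μ / b)) ^ (p / 2) := by positivity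
  have h3 : energyJ k m v ≤ lam * μ ^ ((p + 2) / 2) / (μ / a * √(μ / b)) ^ (p / 2) := by
    rw [le_div_iff₀ hpos]
    linarith
  refine h3.trans (le_of_eq ?_)
  rw [mul_div_assoc]
  congr 1
  rw [div_eq_iff hpos.ne', Real.sqrt_eq_rpow, Real.mul_rpow (by positivity) (by positivity),
    ← Real.rpow_mul (by positivity), Real.div_rpow hμ.le ha.le, Real.div_rpow hμ.le hb.le]
  have e : (1 / 2 * (p / 2)) = p / 4 := by ring
  rw [e]
  have e2 : μ ^ ((p + 2) / 2) = μ ^ (1 - p / 4) * μ ^ (p / 2) * μ ^ (p / 4) := by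
    rw [← Real.rpow_add hμ, ← Real.rpow_add hμ]
    congr 1
    ring
  rw [e2]
  field_simp

/-- The sharp Gagliardo–Nirenberg inequality. -/
theorem IsLevel.energyJ_le_of_minimizer (h : IsLevel k m c lam S) {φ : L2}
    (hφ : φ ∈ minimizers k m c lam) {v : L2} (hv : MemZ v) {μ a b : ℝ} (hμ : 0 ≤ μ) (ha : 0 ≤ a)
    (hb : 0 ≤ b) (hM : ‖v‖ ^ 2 = μ * ‖φ‖ ^ 2)
    (hA : (dxHalfSq v).toReal = a * (dxHalfSq φ).toReal)
    (hB : (dySq v).toReal = b * (dySq φ).toReal) :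
    energyJ k m v ≤ lam * (μ ^ (1 - (k : ℝ) / m / 4) * a ^ ((k : ℝ) / m / 2) *
      b ^ ((k : ℝ) / m / 4)) := by
  have hp := h.p_pos
  have hp43 := h.hp43
  set p := (k : ℝ) / m with hpdef
  -- Ratios that vanish are allowed here: enlarge all three by `e > 0` and let `e → 0`. The
  -- exponents are nonnegative, so the right side is continuous.
  have hlim : Tendsto (fun e : ℝ => lam * ((μ + e) ^ (1 - p / 4) * (a + e) ^ (p / 2) *
      (b + e) ^ (p / 4))) (𝓝[>] 0) (𝓝 (lam * ((μ + 0) ^ (1 - p / 4) * (a + 0) ^ (p / 2) *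
      (b + 0) ^ (p / 4)))) := by
    refine Tendsto.mono_left (Continuous.tendsto ?_ 0) nhdsWithin_le_nhds
    refine continuous_const.mul (((?_ : Continuous _).mul ?_).mul ?_)
    · exact (continuous_const.add continuous_id).rpow_const fun x => Or.inr (by linarith)
    · exact (continuous_const.add continuous_id).rpow_const fun x => Or.inr (by positivity)
    · exact (continuous_const.add continuous_id).rpow_const fun x => Or.inr (by positivity)
  simp only [add_zero] at hlim
  refine ge_of_tendsto hlim ?_
  filter_upwards [self_mem_nhdsWithin] with e he
  have he' : 0 < e := he
  refine h.energyJ_le_of_le hφ hv (by positivity) (by positivity) (by positivity) ?_ ?_ ?_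
  · rw [hM]; gcongr; linarith
  · rw [hA]; gcongr; linarith
  · rw [hB]; gcongr; linarith

end Variational

/-! ### Mass and energy control minimizing sequences -/

/-- A quantitative form of the weighted inequality of the means for three numbers. -/
theorem variance_le_arith_sub_geom {w₁ w₂ w₃ x₁ x₂ x₃ : ℝ} (h₁ : 0 ≤ w₁) (h₂ : 0 ≤ w₂)
    (h₃ : 0 ≤ w₃) (hw : w₁ + w₂ + w₃ = 1) (hx₁ : 0 ≤ x₁) (hx₂ : 0 ≤ x₂) (hx₃ : 0 ≤ x₃) :
    w₁ * w₃ * (√x₁ - √x₃) ^ 2 + w₂ * w₃ * (√x₂ - √x₃) ^ 2 ≤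
      w₁ * x₁ + w₂ * x₂ + w₃ * x₃ - x₁ ^ w₁ * x₂ ^ w₂ * x₃ ^ w₃ := by
  -- Applied to the square roots. Squaring bounds the geometric mean by `(∑ wᵢ √xᵢ)²`, and the
  -- difference to `∑ wᵢ xᵢ` is a weighted variance of the `√xᵢ`.
  have h := Real.geom_mean_le_arith_mean3_weighted h₁ h₂ h₃ (Real.sqrt_nonneg x₁)
    (Real.sqrt_nonneg x₂) (Real.sqrt_nonneg x₃) hw
  have hsq : (√x₁ ^ w₁ * √x₂ ^ w₂ * √x₃ ^ w₃) ^ 2 = x₁ ^ w₁ * x₂ ^ w₂ * x₃ ^ w₃ := by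
    have key : ∀ x w : ℝ, 0 ≤ x → (√x ^ w) ^ 2 = x ^ w := fun x w hx => by
      rw [← Real.rpow_natCast, ← Real.rpow_mul (Real.sqrt_nonneg x), mul_comm,
        Real.rpow_mul (Real.sqrt_nonneg x), Real.rpow_natCast, Real.sq_sqrt hx]
    rw [mul_pow, mul_pow, key _ _ hx₁, key _ _ hx₂, key _ _ hx₃]
  have h' : x₁ ^ w₁ * x₂ ^ w₂ * x₃ ^ w₃ ≤ (w₁ * √x₁ + w₂ * √x₂ + w₃ * √x₃) ^ 2 := by
    rw [← hsq]
    gcongr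
  have s1 := Real.sq_sqrt hx₁
  have s2 := Real.sq_sqrt hx₂
  have s3 := Real.sq_sqrt hx₃
  have hw3 : w₃ = 1 - w₁ - w₂ := by linarith
  have e : w₁ * x₁ + w₂ * x₂ + w₃ * x₃ - (w₁ * √x₁ + w₂ * √x₂ + w₃ * √x₃) ^ 2 =
      w₁ * w₃ * (√x₁ - √x₃) ^ 2 + w₂ * w₃ * (√x₂ - √x₃) ^ 2 + w₁ * w₂ * (√x₁ - √x₂) ^ 2 := by
    conv_lhs => rw [← s1, ← s2, ← s3, Real.sqrt_sq (Real.sqrt_nonneg _),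
      Real.sqrt_sq (Real.sqrt_nonneg _), Real.sqrt_sq (Real.sqrt_nonneg _)]
    rw [hw3]
    ring
  have : 0 ≤ w₁ * w₂ * (√x₁ - √x₂) ^ 2 := by positivity
  linarith

theorem tendsto_one_of_sqrt_sub {x y : ℕ → ℝ} {w : ℝ} (hw : 0 < w) (hx : ∀ n, 0 ≤ x n)
    {D : ℕ → ℝ} (hD : Tendsto D atTop (𝓝 0)) (hy : Tendsto y atTop (𝓝 1))
    (h : ∀ n, w * (√(x n) - √(y n)) ^ 2 ≤ D n) : Tendsto x atTop (𝓝 1) := by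
  have h1 : Tendsto (fun n => (√(x n) - √(y n)) ^ 2) atTop (𝓝 0) := by
    refine squeeze_zero (fun n => sq_nonneg _) (g := fun n => D n / w) (fun n => ?_) ?_
    · rw [le_div_iff₀ hw]; linarith [h n]
    · simpa using hD.div_const w
  have h2 : Tendsto (fun n => √(x n) - √(y n)) atTop (𝓝 0) := by
    rw [tendsto_zero_iff_abs_tendsto_zero]
    have := (Real.continuous_sqrt.tendsto 0).comp h1
    rw [Real.sqrt_zero] at this
    refine this.congr fun n => ?_
    simp [Real.sqrt_sq_eq_abs]
  have h3 : Tendsto (fun n => √(y n)) atTop (𝓝 1) := by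
    have := (Real.continuous_sqrt.tendsto 1).comp hy
    rw [Real.sqrt_one] at this
    exact this
  have h4 := ((h2.add h3).pow 2)
  simp only [sub_add_cancel, zero_add, one_pow] at h4
  exact h4.congr fun n => Real.sq_sqrt (hx n)

/-- The stability of the equality case in the subcritical interpolation. -/
theorem tendsto_one_of_defect {p : ℝ} (hp : 0 < p) (hp43 : p < 4 / 3) {μ a b j : ℕ → ℝ}
    (hμ : ∀ n, 0 ≤ μ n) (ha : ∀ n, 0 ≤ a n) (hb : ∀ n, 0 ≤ b n)
    (hj : ∀ n, j n ≤ μ n ^ (1 - p / 4) * a n ^ (p / 2) * b n ^ (p / 4))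
    (hμ1 : Tendsto μ atTop (𝓝 1))
    (he : Tendsto (fun n => p / 2 * a n + p / 4 * b n - j n) atTop (𝓝 (p / 2 + p / 4 - 1))) :
    Tendsto a atTop (𝓝 1) ∧ Tendsto b atTop (𝓝 1) := by
  -- The weight left over by `p/2` and `p/4`; it is positive exactly when `p < 4/3`. The variable
  -- `y` below is chosen so that `y^{w₃} = μ^{1-p/4}`.
  set w₃ := 1 - 3 * p / 4 with hw₃
  have hw₃pos : 0 < w₃ := by linarith
  set y : ℕ → ℝ := fun n => μ n ^ ((1 - p / 4) / w₃) with hy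
  have hynn : ∀ n, 0 ≤ y n := fun n => Real.rpow_nonneg (hμ n) _
  have hy1 : Tendsto y atTop (𝓝 1) := by
    have := hμ1.rpow_const (p := (1 - p / 4) / w₃) (Or.inl one_ne_zero)
    simpa using this
  have hyw : ∀ n, y n ^ w₃ = μ n ^ (1 - p / 4) := fun n => by
    rw [hy]
    simp only
    rw [← Real.rpow_mul (hμ n), div_mul_cancel₀ _ hw₃pos.ne']
  -- Since `j` is at most the geometric mean, `D` bounds the defect in the inequality of the means,
  -- and the assumed limits give `D → 0`.
  set D : ℕ → ℝ := fun n => (p / 2 * a n + p / 4 * b n - j n) + w₃ * y n with hD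
  have hD0 : Tendsto D atTop (𝓝 0) := by
    have := he.add (hy1.const_mul w₃)
    have e : p / 2 + p / 4 - 1 + w₃ * 1 = 0 := by rw [hw₃]; ring
    rwa [e] at this
  have key : ∀ n, p / 2 * w₃ * (√(a n) - √(y n)) ^ 2 + p / 4 * w₃ * (√(b n) - √(y n)) ^ 2 ≤ D n := by
    intro n
    have := variance_le_arith_sub_geom (w₁ := p / 2) (w₂ := p / 4) (w₃ := w₃) (by positivity)
      (by positivity) hw₃pos.le (by rw [hw₃]; ring) (ha n) (hb n) (hynn n)
    refine this.trans ?_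
    rw [hyw, hD]
    simp only
    have hj' := hj n
    have e : a n ^ (p / 2) * b n ^ (p / 4) * μ n ^ (1 - p / 4) =
      μ n ^ (1 - p / 4) * a n ^ (p / 2) * b n ^ (p / 4) := by ring
    rw [e]
    linarith
  constructor
  · refine tendsto_one_of_sqrt_sub (w := p / 2 * w₃) (by positivity) ha hD0 hy1 fun n => ?_
    have : 0 ≤ p / 4 * w₃ * (√(b n) - √(y n)) ^ 2 := by positivity
    linarith [key n]
  · refine tendsto_one_of_sqrt_sub (w := p / 4 * w₃) (by positivity) hb hD0 hy1 fun n => ?_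
    have : 0 ≤ p / 2 * w₃ * (√(a n) - √(y n)) ^ 2 := by positivity
    linarith [key n]

/-- The conserved energy `½ ∫ (u 𝓗u_x + u_y²) - 1 / ((p + 1) (p + 2)) ∫ u^{p + 2}`. -/
def energyE (k m : ℕ) (u : L2) : ℝ :=
  (1 / 2) * ((dxHalfSq u).toReal + (dySq u).toReal) -
    energyJ k m u / (((k : ℝ) / m + 1) * ((k : ℝ) / m + 2))

/-- The Pohozaev identities determine all terms, so the value is common to all minimizers, and
likewise for the mass below. Hence a sequence approaching varying minimizers still has convergent
mass and energy. -/
theorem IsLevel.energyE_eq {k m : ℕ} {c lam S : ℝ} (h : IsLevel k m c lam S) {φ : L2}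
    (hφ : φ ∈ minimizers k m c lam) :
    energyE k m φ = S / ((k : ℝ) / m + 2) * ((k : ℝ) / m / 2 + (k : ℝ) / m / 4 - 1) := by
  have hp := h.p_pos
  obtain ⟨hA, hB, -⟩ := h.pohozaev hφ
  rw [energyE, hφ.2.2, hA, h.lam_eq]
  have hB' : (dySq φ).toReal = S * (((k : ℝ) / m) / ((k : ℝ) / m + 2)) / 2 := by linarith
  rw [hB']
  generalize (k : ℝ) / m = p at *
  field_simp
  ring

theorem IsLevel.norm_sq_eq {k m : ℕ} {c lam S : ℝ} (h : IsLevel k m c lam S) {φ : L2}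
    (hφ : φ ∈ minimizers k m c lam) :
    ‖φ‖ ^ 2 = S * (4 - (k : ℝ) / m) / (2 * c * ((k : ℝ) / m + 2)) := by
  have hp := h.p_pos
  have hc := h.hc
  obtain ⟨hA, hB, hs⟩ := h.pohozaev hφ
  have hB' : (dySq φ).toReal = S * (((k : ℝ) / m) / ((k : ℝ) / m + 2)) / 2 := by linarith
  rw [hA, hB'] at hs
  generalize (k : ℝ) / m = p at *
  field_simp at hs ⊢
  linarith

/-- Convergence of mass and energy to those of a minimizer gives a minimizing sequence. -/
theorem IsLevel.tendsto_of_energyE {k m : ℕ} {c lam S : ℝ} (h : IsLevel k m c lam S) {φ : L2}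
    (hφ : φ ∈ minimizers k m c lam) {v : ℕ → L2} (hv : ∀ n, MemZ (v n))
    (hM : Tendsto (fun n => ‖v n‖ ^ 2) atTop (𝓝 (‖φ‖ ^ 2)))
    (hE : Tendsto (fun n => energyE k m (v n)) atTop (𝓝 (energyE k m φ))) :
    Tendsto (fun n => energyI c (v n)) atTop (𝓝 (minI k m c lam)) ∧
      Tendsto (fun n => energyJ k m (v n)) atTop (𝓝 lam) := by
  have hp := h.p_pos
  have hp43 := h.hp43
  have hS := h.S_pos
  have hl := h.lam_pos
  have hc := h.hc
  have hM0 := h.norm_sq_eq hφ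
  have hE0 := h.energyE_eq hφ
  obtain ⟨hA, hB, -⟩ := h.pohozaev hφ
  have hI0 : energyI c φ = minI k m c lam := hφ.2.1
  set A₀ := (dxHalfSq φ).toReal with hA₀
  set B₀ := (dySq φ).toReal with hB₀
  have hlamS := h.lam_eq
  have hMpos : 0 < ‖φ‖ ^ 2 := by
    rw [hM0]
    have : 0 < 4 - (k : ℝ) / m := by linarith
    positivity
  have hApos : 0 < A₀ := by rw [hA]; positivity
  have hBpos : 0 < B₀ := by
    have : 0 < S * (((k : ℝ) / m) / ((k : ℝ) / m + 2)) := by positivity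
    linarith
  set μ : ℕ → ℝ := fun n => ‖v n‖ ^ 2 / ‖φ‖ ^ 2 with hμ
  set a : ℕ → ℝ := fun n => (dxHalfSq (v n)).toReal / A₀ with ha
  set b : ℕ → ℝ := fun n => (dySq (v n)).toReal / B₀ with hb
  have hμ1 : Tendsto μ atTop (𝓝 1) := by
    have := hM.div_const (‖φ‖ ^ 2)
    rwa [div_self hMpos.ne'] at this
  -- With the seminorms normalized by their Pohozaev values and `lam = (p+1) S`, a common factor
  -- `S/(p+2)` comes out of the energy.
  have hEn : ∀ n, (k : ℝ) / m / 2 * a n + (k : ℝ) / m / 4 * b n - energyJ k m (v n) / lam =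
      energyE k m (v n) / (S / ((k : ℝ) / m + 2)) := by
    intro n
    rw [energyE, ha, hb, hlamS]
    simp only
    have hB' : B₀ = S * (((k : ℝ) / m) / ((k : ℝ) / m + 2)) / 2 := by linarith
    rw [hB', hA]
    generalize (k : ℝ) / m = p at *
    field_simp
    ring
  have hab := tendsto_one_of_defect hp hp43 (μ := μ) (a := a) (b := b)
    (j := fun n => energyJ k m (v n) / lam) (fun n => by positivity) (fun n => by positivity)
    (fun n => by positivity) (fun n => ?_) hμ1 ?_
  · obtain ⟨ha1, hb1⟩ := hab
    have tA : Tendsto (fun n => (dxHalfSq (v n)).toReal) atTop (𝓝 A₀) := by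
      have := ha1.mul_const A₀
      rw [one_mul] at this
      refine this.congr fun n => ?_
      rw [ha]; field_simp
    have tB : Tendsto (fun n => (dySq (v n)).toReal) atTop (𝓝 B₀) := by
      have := hb1.mul_const B₀
      rw [one_mul] at this
      refine this.congr fun n => ?_
      rw [hb]; field_simp
    constructor
    · rw [← hI0]
      exact (((hM.const_mul c).add tA).add tB).const_mul (1 / 2)
    -- Once the seminorms converge, the limit of `J` is read off from that of the energy.
    · have hJE : ∀ u : L2, energyJ k m u = ((1 / 2) * ((dxHalfSq u).toReal + (dySq u).toReal) -
          energyE k m u) * (((k : ℝ) / m + 1) * ((k : ℝ) / m + 2)) := by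
        intro u
        rw [energyE]
        field_simp
        ring
      rw [← hφ.2.2, hJE φ]
      simp only [hJE (v _)]
      exact ((((tA.add tB).const_mul (1 / 2)).sub hE).mul_const _)
  · rw [div_le_iff₀ hl, mul_comm]
    refine h.energyJ_le_of_minimizer hφ (hv n) (by positivity) (by positivity) (by positivity)
      ?_ ?_ ?_
    · exact (div_mul_cancel₀ _ hMpos.ne').symm
    · rw [ha]; simp only; rw [← hA₀]; field_simp
    · rw [hb]; simp only; rw [← hB₀]; field_simp
  · simp only [hEn]
    have := hE.div_const (S / ((k : ℝ) / m + 2))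
    rwa [hE0, mul_div_cancel_left₀ _ (by positivity)] at this

/-! ### Weak compactness in the energy space -/

/-- Bounded sequences in `L²` have weakly convergent subsequences. -/
theorem exists_weak_subseq {g : ℕ → CL2} {K : ℝ} (hK : ∀ n, ‖g n‖ ≤ K) :
    ∃ (g₀ : CL2) (φ : ℕ → ℕ), StrictMono φ ∧
      ∀ G : CL2, Tendsto (fun n => (inner ℂ G (g (φ n)) : ℂ)) atTop (𝓝 (inner ℂ G g₀)) := by
  have hfact : Fact ((2 : ℝ≥0∞) ≠ ∞) := ⟨ENNReal.ofNat_ne_top⟩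
  have hsc : SecondCountableTopology CL2 := inferInstance
  have hseq := WeakDual.isSeqCompact_closedBall ℂ CL2 0 K
  let x : ℕ → WeakDual ℂ CL2 := fun n =>
    StrongDual.toWeakDual (InnerProductSpace.toDual ℂ CL2 (g n))
  have hx : ∀ n, x n ∈ WeakDual.toStrongDual ⁻¹' Metric.closedBall (0 : StrongDual ℂ CL2) K := by
    intro n
    rw [Set.mem_preimage, mem_closedBall_zero_iff]
    refine le_trans (le_of_eq ?_) (hK n)
    exact (InnerProductSpace.toDual ℂ CL2).norm_map (g n)
  obtain ⟨ℓ, -, φ, hφ, hlim⟩ := hseq hx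
  refine ⟨(InnerProductSpace.toDual ℂ CL2).symm (WeakDual.toStrongDual ℓ), φ, hφ, fun G => ?_⟩
  have h1 := (WeakBilin.tendsto_iff_forall_eval_tendsto _ (ContinuousLinearMap.coe_injective)).1 hlim G
  have h2 : Tendsto (fun n => (inner ℂ (g (φ n)) G : ℂ)) atTop
      (𝓝 (inner ℂ ((InnerProductSpace.toDual ℂ CL2).symm (WeakDual.toStrongDual ℓ)) G)) := by
    rw [InnerProductSpace.toDual_symm_apply]
    exact h1
  have h3 := (Complex.continuous_conj.tendsto _).comp h2
  rw [inner_conj_symm] at h3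
  refine h3.congr fun n => ?_
  simp [inner_conj_symm]

theorem inner_toComplex (u v : L2) : (inner ℂ (toComplex u) (toComplex v) : ℂ) =
    ((∫ x, u x * v x : ℝ) : ℂ) := by
  rw [L2.inner_def, ← integral_complex_ofReal]
  refine integral_congr_ae ?_
  filter_upwards [coeFn_toComplex u, coeFn_toComplex v] with x h1 h2
  rw [h1, h2]
  simp [mul_comm]

/-- A weak limit of real functions is real. -/
theorem exists_toComplex_eq {f : CL2} {v : ℕ → L2}
    (hw : ∀ G : CL2, Tendsto (fun n => (inner ℂ G (toComplex (v n)) : ℂ)) atTop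
      (𝓝 (inner ℂ G f))) : ∃ u : L2, toComplex u = f := by
  let w : L2 := Complex.imCLM.compLp f
  let u : L2 := Complex.reCLM.compLp f
  have hwc : w =ᵐ[volume] fun x => (f x).im := Complex.imCLM.coeFn_compLp f
  have huc : u =ᵐ[volume] fun x => (f x).re := Complex.reCLM.coeFn_compLp f
  -- Testing against the imaginary part `w` of the limit: the pairings with real functions are real,
  -- while the imaginary part of the limit pairing is `‖w‖²`.
  have h1 : (inner ℂ (toComplex w) f : ℂ).im = 0 := by
    have h2 := (Complex.continuous_im.tendsto _).comp (hw (toComplex w))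
    refine tendsto_nhds_unique h2 ?_
    refine tendsto_const_nhds.congr fun n => ?_
    simp [inner_toComplex]
  have h3 : (inner ℂ (toComplex w) f : ℂ).im = ‖w‖ ^ 2 := by
    have hint := L2.integrable_inner (𝕜 := ℂ) (toComplex w) f
    rw [L2.inner_def, ← integral_norm_sq_eq]
    change Complex.imCLM _ = _
    rw [← Complex.imCLM.integral_comp_comm hint]
    refine integral_congr_ae ?_
    filter_upwards [coeFn_toComplex w, hwc] with x e1 e2
    rw [e1, e2]
    simp [sq]
  have hw0 : w = 0 := by
    rw [h3] at h1
    exact norm_eq_zero.1 (pow_eq_zero_iff two_ne_zero |>.1 h1)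
  refine ⟨u, Lp.ext ?_⟩
  rw [hw0] at hwc
  filter_upwards [coeFn_toComplex u, huc, hwc, Lp.coeFn_zero ℝ 2 (volume : Measure Plane)]
    with x e1 e2 e3 e4
  rw [e1, e2]
  apply Complex.ext
  · simp
  · rw [e4] at e3
    simpa using e3

theorem inner_fourierL2 (G : CL2) (u : L2) :
    (inner ℂ G (toComplex u) : ℂ) = inner ℂ (𝓕 G : CL2) (fourierL2 u) :=
  (Lp.inner_fourier_eq G (toComplex u)).symm

theorem measurable_inv_sqwt (c : ℝ) : Measurable fun ξ => (sqwt c ξ)⁻¹ := (measurable_sqwt c).inv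

theorem norm_inv_sqwt_le {c : ℝ} (hc : 0 < c) (ξ : Plane) : ‖(sqwt c ξ)⁻¹‖ ≤ (√c)⁻¹ := by
  rw [norm_inv, sqwt, Complex.norm_real, Real.norm_of_nonneg (Real.sqrt_nonneg _)]
  gcongr
  exact le_wt c ξ

theorem sqwt_ne_zero {c : ℝ} (hc : 0 < c) (ξ : Plane) : sqwt c ξ ≠ 0 := by
  rw [sqwt, Complex.ofReal_ne_zero]
  exact (Real.sqrt_pos.2 (wt_pos hc ξ)).ne'

theorem memMul_inv_sqwt {c : ℝ} (hc : 0 < c) (G : CL2) : MemMul (fun ξ => (sqwt c ξ)⁻¹) G :=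
  memMul_of_bound (measurable_inv_sqwt c) (norm_inv_sqwt_le hc) G

theorem mulFn_congr {g h : Plane → ℂ} (e : ∀ ξ, g ξ = h ξ) (F : CL2) : mulFn g F = mulFn h F := by
  rw [funext e]

theorem memMul_one (F : CL2) : MemMul (fun _ => 1) F := by
  simpa [MemMul] using Lp.memLp F

theorem mulFn_one (F : CL2) : mulFn (fun _ => 1) F = F := by
  refine Lp.ext ?_
  filter_upwards [coeFn_mulFn (memMul_one F)] with ξ h
  rw [h, one_mul]

theorem memMul_congr {g h : Plane → ℂ} (e : ∀ ξ, g ξ = h ξ) {F : CL2} (hF : MemMul g F) :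
    MemMul h F := by
  rwa [← funext e]

theorem mulFn_inv_sqwt_zLift {c : ℝ} (hc : 0 < c) {u : L2} (hu : MemZ u) :
    mulFn (fun ξ => (sqwt c ξ)⁻¹) (zLift c u) = fourierL2 u := by
  have e : ∀ ξ, 1 = (sqwt c ξ)⁻¹ * sqwt c ξ := fun ξ => (inv_mul_cancel₀ (sqwt_ne_zero hc ξ)).symm
  rw [zLift, mulFn_mulFn (hu.memMul hc.le) (memMul_congr e (memMul_one _)),
    ← mulFn_congr e, mulFn_one]

theorem memMul_sqwt_mulFn_inv {c : ℝ} (hc : 0 < c) (G : CL2) :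
    MemMul (sqwt c) (mulFn (fun ξ => (sqwt c ξ)⁻¹) G) ∧
      mulFn (sqwt c) (mulFn (fun ξ => (sqwt c ξ)⁻¹) G) = G := by
  have e : ∀ ξ, 1 = sqwt c ξ * (sqwt c ξ)⁻¹ := fun ξ => (mul_inv_cancel₀ (sqwt_ne_zero hc ξ)).symm
  have h1 : MemMul (fun ξ => sqwt c ξ * (sqwt c ξ)⁻¹) G := memMul_congr e (memMul_one _)
  refine ⟨(memMul_mulFn_iff (memMul_inv_sqwt hc G)).2 h1, ?_⟩
  rw [mulFn_mulFn (memMul_inv_sqwt hc G) h1, ← mulFn_congr e, mulFn_one]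

theorem conj_inv_sqwt (c : ℝ) (ξ : Plane) : (starRingEnd ℂ) (sqwt c ξ)⁻¹ = (sqwt c ξ)⁻¹ := by
  rw [sqwt, map_inv₀, Complex.conj_ofReal]

theorem inner_mulFn_inv_sqwt {c : ℝ} (hc : 0 < c) (G F : CL2) :
    (inner ℂ G (mulFn (fun ξ => (sqwt c ξ)⁻¹) F) : ℂ) =
      inner ℂ (mulFn (fun ξ => (sqwt c ξ)⁻¹) G) F := by
  have h := inner_mulFn_left (memMul_inv_sqwt hc G)
    (memMul_congr (fun ξ => (conj_inv_sqwt c ξ).symm) (memMul_inv_sqwt hc F))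
  rw [h, mulFn_congr (conj_inv_sqwt c)]

/-- Weak compactness in the energy space. -/
theorem exists_weak_limit {c : ℝ} (hc : 0 < c) {v : ℕ → L2} (hv : ∀ n, MemZ (v n)) {K : ℝ}
    (hK : ∀ n, ‖zLift c (v n)‖ ≤ K) :
    ∃ (u : L2) (φ : ℕ → ℕ), StrictMono φ ∧ MemZ u ∧
      (∀ G : CL2, Tendsto (fun n => (inner ℂ G (zLift c (v (φ n))) : ℂ)) atTop
        (𝓝 (inner ℂ G (zLift c u)))) ∧
      ∀ G : CL2, Tendsto (fun n => (inner ℂ G (fourierL2 (v (φ n))) : ℂ)) atTop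
        (𝓝 (inner ℂ G (fourierL2 u))) := by
  obtain ⟨g, φ, hφ, hw⟩ := exists_weak_subseq hK
  set F : CL2 := mulFn (fun ξ => (sqwt c ξ)⁻¹) g with hF
  -- The weak limit `g` is taken for the weighted transforms and then divided by the weight. This
  -- division is bounded and self-adjoint, so it respects weak limits, and the limit lies in the
  -- energy space automatically.
  have hwF : ∀ G : CL2, Tendsto (fun n => (inner ℂ G (fourierL2 (v (φ n))) : ℂ)) atTop
      (𝓝 (inner ℂ G F)) := by
    intro G
    have h1 := hw (mulFn (fun ξ => (sqwt c ξ)⁻¹) G)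
    rw [← inner_mulFn_inv_sqwt hc] at h1
    refine h1.congr fun n => ?_
    rw [← inner_mulFn_inv_sqwt hc, mulFn_inv_sqwt_zLift hc (hv _)]
  obtain ⟨u, hu⟩ : ∃ u : L2, toComplex u = (𝓕⁻ F : CL2) := by
    refine exists_toComplex_eq (v := fun n => v (φ n)) fun G => ?_
    have h1 := hwF (𝓕 G : CL2)
    have e : (inner ℂ (𝓕 G : CL2) F : ℂ) = inner ℂ G (𝓕⁻ F : CL2) := by
      rw [← Lp.inner_fourier_eq G (𝓕⁻ F : CL2)]
      congr 1
      exact ((Lp.fourierTransformₗᵢ Plane ℂ).apply_symm_apply F).symm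
    rw [e] at h1
    refine h1.congr fun n => ?_
    rw [inner_fourierL2]
  have huF : fourierL2 u = F := by
    rw [fourierL2, hu]
    exact (Lp.fourierTransformₗᵢ Plane ℂ).apply_symm_apply F
  obtain ⟨hm, hg⟩ := memMul_sqwt_mulFn_inv hc g
  refine ⟨u, φ, hφ, ?_, ?_, ?_⟩
  · rw [memZ_iff_memMul hc.le, huF]; exact hm
  · rw [zLift, huF, hF, hg]; exact hw
  · rw [huF]; exact hwF

/-- Strict subadditivity in numerical form: for `0 < t < 1` and `s > 1` both powers lie strictly
below their bases. It excludes dichotomy. -/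
theorem eq_one_of_one_le_rpow_add {t s : ℝ} (hs : 1 < s) (ht0 : 0 < t) (ht1 : t ≤ 1)
    (h : 1 ≤ t ^ s + (1 - t) ^ s) : t = 1 := by
  by_contra hne
  have htlt : t < 1 := lt_of_le_of_ne ht1 hne
  have h1 : t ^ s < t := by
    have := Real.rpow_lt_rpow_of_exponent_gt ht0 htlt hs
    rwa [Real.rpow_one] at this
  have h2 : (1 - t) ^ s < 1 - t := by
    have := Real.rpow_lt_rpow_of_exponent_gt (sub_pos.2 htlt) (by linarith) hs
    rwa [Real.rpow_one] at this
  linarith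

theorem norm_zLift_one_le {c : ℝ} (hc : 0 < c) {u : L2} (hu : MemZ u) :
    ‖zLift 1 u‖ ≤ (√(min c 1))⁻¹ * ‖zLift c u‖ := by
  have h := norm_zLift_one_sq_le c hu
  rw [← norm_zLift_sq hc.le hu] at h
  have hm : 0 < min c 1 := by positivity
  refine abs_le_of_sq_le_sq' ?_ (by positivity) |>.2
  rw [mul_pow, inv_pow, Real.sq_sqrt hm.le, inv_mul_eq_div, le_div_iff₀ hm]
  linarith

/-! ### Compactness of minimizing sequences up to translations -/

section Compactness

variable {k m : ℕ} {c lam S : ℝ}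

/-- Excludes vanishing: uniformly small low frequency parts would give `|J| ≤ ∫ |u|^{p+2} ≤ lam/2`.
-/
theorem IsLevel.exists_lowPart (h : IsLevel k m c lam S) (K : ℝ) :
    ∃ R η : ℝ, 0 < η ∧ ∀ u : L2, MemZ u → ‖zLift 1 u‖ ≤ K → lam / 2 < energyJ k m u →
      ∃ x, η < ‖lowPart R (fourierL2 u) x‖ := by
  have hp := h.p_pos
  have hp43 := h.hp43
  have hl := h.lam_pos
  obtain ⟨R, η, -, hη, hRη⟩ := exists_integral_rpow_q_le_of_lowPart (q := (k : ℝ) / m + 2)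
    (by linarith) (by linarith) K (ε := lam / 2) (by positivity)
  refine ⟨R, η, hη, fun u hu hK hJ => ?_⟩
  by_contra! hcon
  have h1 := hRη _ (hu.memMul zero_le_one) hK hcon
  have h2 := (isPower_oddPow h.hk h.hm).abs_functionalJ_le u
  have e1 : ∫ x, ‖(𝓕⁻ (fourierL2 u) : CL2) x‖ ^ ((k : ℝ) / m + 2) =
      ∫ x, |u x| ^ ((k : ℝ) / m + 2) := by
    refine integral_congr_ae ?_
    filter_upwards [norm_fourierInv_fourierL2_ae u] with x hx
    rw [hx]
  rw [e1] at h1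
  rw [← energyJ_eq] at h2
  linarith [le_abs_self (energyJ k m u)]

/-- A weakly convergent minimizing sequence with nonzero weak limit converges strongly. -/
theorem IsLevel.tendsto_of_weak (h : IsLevel k m c lam S) {v : ℕ → L2} (hv : ∀ n, MemZ (v n))
    {K : ℝ} (hK : ∀ n, ‖zLift c (v n)‖ ≤ K) {u : L2} (hu : MemZ u)
    (hI : Tendsto (fun n => energyI c (v n)) atTop (𝓝 (S / 2)))
    (hJ : Tendsto (fun n => energyJ k m (v n)) atTop (𝓝 lam))
    (hw : ∀ G : CL2, Tendsto (fun n => (inner ℂ G (zLift c (v n)) : ℂ)) atTop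
        (𝓝 (inner ℂ G (zLift c u))))
    (hw' : ∀ G : CL2, Tendsto (fun n => (inner ℂ G (fourierL2 (v n)) : ℂ)) atTop
        (𝓝 (inner ℂ G (fourierL2 u))))
    (hu0 : fourierL2 u ≠ 0) :
    u ∈ minimizers k m c lam ∧ Tendsto (fun n => ‖zLift 1 (v n - u)‖) atTop (𝓝 0) := by
  have hp := h.p_pos
  have hp43 := h.hp43
  have hl := h.lam_pos
  have hS := h.S_pos
  have hc := h.hc
  have hf := isPower_oddPow h.hk h.hm
  set q := (k : ℝ) / m + 2 with hq
  have hr : ∀ n, MemZ (v n - u) := fun n => (hv n).sub hu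
  have hzr : ∀ n, zLift c (v n - u) = zLift c (v n) - zLift c u :=
    fun n => zLift_sub hc.le (hv n) hu
  have hKr : ∀ n, ‖zLift 1 (v n - u)‖ ≤ (√(min c 1))⁻¹ * (K + ‖zLift c u‖) := by
    intro n
    refine (norm_zLift_one_le hc (hr n)).trans ?_
    gcongr
    rw [hzr]
    exact (norm_sub_le _ _).trans (by gcongr; exact hK n)
  -- splitting of the quadratic part
  have hnorm : Tendsto (fun n => ‖zLift c (v n - u)‖ ^ 2) atTop (𝓝 (S - ‖zLift c u‖ ^ 2)) := by
    have h1 : Tendsto (fun n => ‖zLift c (v n)‖ ^ 2) atTop (𝓝 S) := by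
      have := hI.const_mul 2
      rw [mul_div_cancel₀ _ two_ne_zero] at this
      exact this.congr fun n => (norm_zLift_sq hc.le (hv n)).symm
    have h2 := (Complex.continuous_re.tendsto _).comp (hw (zLift c u))
    rw [inner_self_eq_norm_sq_to_K] at h2
    have h3 := (h1.sub (h2.const_mul 2)).add_const (‖zLift c u‖ ^ 2)
    have e : S - 2 * ((‖zLift c u‖ : ℂ) ^ 2).re + ‖zLift c u‖ ^ 2 = S - ‖zLift c u‖ ^ 2 := by
      rw [← Complex.ofReal_pow, Complex.ofReal_re]
      ring
    have h4 : Tendsto (fun n => ‖zLift c (v n - u)‖ ^ 2) atTop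
        (𝓝 (S - 2 * ((‖zLift c u‖ : ℂ) ^ 2).re + ‖zLift c u‖ ^ 2)) := by
      refine h3.congr fun n => ?_
      rw [hzr, norm_sub_sq (𝕜 := ℂ), inner_re_symm]
      simp
    rwa [e] at h4
  -- The share of the quadratic energy carried by the weak limit; the remainder `v n - u` carries `1
  -- - t` in the limit.
  set t := ‖zLift c u‖ ^ 2 / S with ht
  have hgS : ‖zLift c u‖ ^ 2 ≤ S := by
    have := ge_of_tendsto hnorm (Eventually.of_forall fun n => by positivity)
    linarith
  have hu2 : ‖zLift c u‖ ^ 2 = 2 * energyI c u := norm_zLift_sq hc.le hu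
  have htpos : 0 < t := by
    have hne : zLift c u ≠ 0 := by
      intro h0
      refine hu0 ?_
      rw [← mulFn_inv_sqwt_zLift hc hu, h0]
      have h3 := norm_mulFn_le (memMul_inv_sqwt hc 0) (norm_inv_sqwt_le hc)
      rw [norm_zero, mul_zero] at h3
      exact norm_le_zero_iff.1 h3
    have := norm_pos_iff.2 hne
    positivity
  have ht1 : t ≤ 1 := by rw [ht, div_le_one hS]; exact hgS
  -- splitting of the nonlinear part
  have hloc : ∀ ρ : ℝ, Tendsto (fun n => ∫ x in Metric.closedBall (0 : Plane) ρ,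
      |(v n - u : L2) x| ^ 2) atTop (𝓝 0) := by
    intro ρ
    have h1 := tendsto_setIntegral_norm_sq (F := fun n => fourierL2 (v n - u))
      (fun n => (hr n).memMul zero_le_one) hKr (fun G => ?_)
      (s := Metric.closedBall (0 : Plane) ρ) measure_closedBall_lt_top
    · refine h1.congr fun n => integral_congr_ae (ae_restrict_of_ae ?_)
      filter_upwards [norm_fourierInv_fourierL2_ae (v n - u)] with x hx
      rw [hx]
    · have h2 := (hw' G).sub_const (inner ℂ G (fourierL2 u))
      rw [sub_self] at h2
      refine h2.congr fun n => ?_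
      rw [fourierL2_sub, inner_sub_right]
  have hBL := hf.tendsto_functionalJ_sub (by linarith) (by linarith) hu hr hKr hloc
  have hJsum : Tendsto (fun n => energyJ k m u + energyJ k m (v n - u)) atTop (𝓝 lam) := by
    have h1 := hJ.sub hBL
    rw [sub_zero] at h1
    refine h1.congr fun n => ?_
    rw [add_sub_cancel, ← energyJ_eq, ← energyJ_eq, ← energyJ_eq]
    ring
  have hJu : energyJ k m u ≤ lam * t ^ (q / 2) := by
    have := h.energyJ_le hu
    rwa [← hu2] at this
  have hJr : ∀ n, energyJ k m (v n - u) ≤ lam * (‖zLift c (v n - u)‖ ^ 2 / S) ^ (q / 2) := by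
    intro n
    have := h.energyJ_le (hr n)
    rwa [← norm_zLift_sq hc.le (hr n)] at this
  have hlimr : Tendsto (fun n => lam * t ^ (q / 2) +
      lam * (‖zLift c (v n - u)‖ ^ 2 / S) ^ (q / 2)) atTop
      (𝓝 (lam * t ^ (q / 2) + lam * ((S - ‖zLift c u‖ ^ 2) / S) ^ (q / 2))) := by
    refine tendsto_const_nhds.add (Tendsto.const_mul lam ?_)
    exact (hnorm.div_const S).rpow_const (Or.inr (by positivity))
  -- Each piece of `J` is bounded by its share of the energy to the power `q/2 > 1`, yet the pieces
  -- add up to `lam`. So `t = 1`, no energy is left for the remainder, and the convergence is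
  -- strong.
  have hge := le_of_tendsto_of_tendsto' hJsum hlimr fun n => add_le_add hJu (hJr n)
  have e1 : (S - ‖zLift c u‖ ^ 2) / S = 1 - t := by rw [ht]; field_simp
  rw [e1, ← mul_add, le_mul_iff_one_le_right hl] at hge
  have htone := eq_one_of_one_le_rpow_add (by linarith : 1 < q / 2) htpos ht1 hge
  have huS : ‖zLift c u‖ ^ 2 = S := by
    rw [ht, div_eq_one_iff_eq hS.ne'] at htone
    exact htone
  have hconv : Tendsto (fun n => ‖zLift 1 (v n - u)‖) atTop (𝓝 0) := by
    rw [huS, sub_self] at hnorm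
    have h1 : Tendsto (fun n => ‖zLift c (v n - u)‖) atTop (𝓝 0) := by
      have := (Real.continuous_sqrt.tendsto 0).comp hnorm
      rw [Real.sqrt_zero] at this
      exact this.congr fun n => Real.sqrt_sq (norm_nonneg _)
    have h2 := h1.const_mul (√(min c 1))⁻¹
    rw [mul_zero] at h2
    exact squeeze_zero (fun n => norm_nonneg _) (fun n => norm_zLift_one_le hc (hr n)) h2
  refine ⟨⟨hu, ?_, ?_⟩, hconv⟩
  · rw [h.minI_lam]; linarith
  · have hJr0 : Tendsto (fun n => energyJ k m (v n - u)) atTop (𝓝 0) := by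
      rw [Metric.tendsto_atTop]
      intro ε hε
      obtain ⟨δ, hδ, hδJ⟩ := hf.exists_abs_functionalJ_add_sub_le (by linarith) (by linarith) 0
        (half_pos hε)
      obtain ⟨N, hN⟩ := Metric.tendsto_atTop.1 hconv δ hδ
      refine ⟨N, fun n hn => ?_⟩
      have h1 := hN n hn
      rw [Real.dist_eq, sub_zero, abs_of_nonneg (norm_nonneg _)] at h1
      have h2 := hδJ 0 (v n - u) memZ_zero (hr n) (by rw [zLift_zero zero_le_one, norm_zero]) h1.le
      rw [zero_add, functionalJ_zero _ (hf.apply_zero (by linarith)), sub_zero, ← energyJ_eq] at h2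
      rw [Real.dist_eq, sub_zero]
      linarith
    have h1 := hJr0.const_add (energyJ k m u)
    rw [add_zero] at h1
    exact tendsto_nhds_unique h1 hJsum

/-- Minimizing sequences are compact up to translations. -/
theorem IsLevel.exists_translate (h : IsLevel k m c lam S) {v : ℕ → L2} (hv : ∀ n, MemZ (v n))
    (hI : Tendsto (fun n => energyI c (v n)) atTop (𝓝 (minI k m c lam)))
    (hJ : Tendsto (fun n => energyJ k m (v n)) atTop (𝓝 lam)) :
    ∃ (u : L2) (φ : ℕ → ℕ) (a : ℕ → Plane), StrictMono φ ∧ u ∈ minimizers k m c lam ∧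
      Tendsto (fun n => ‖zLift 1 (translate (a n) (v (φ n)) - u)‖) atTop (𝓝 0) := by
  have hl := h.lam_pos
  have hc := h.hc
  rw [h.minI_lam] at hI
  obtain ⟨D, hD⟩ := hI.bddAbove_range
  have hDn : ∀ n, energyI c (v n) ≤ D := fun n => hD (Set.mem_range_self n)
  have hKc : ∀ u : L2, MemZ u → energyI c u ≤ D → ‖zLift c u‖ ≤ √(2 * D) := fun u hu hn => by
    refine Real.le_sqrt_of_sq_le ?_
    rw [norm_zLift_sq hc.le hu]
    linarith
  obtain ⟨R, η, hη, hlow⟩ := h.exists_lowPart ((√(min c 1))⁻¹ * √(2 * D))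
  have hex : ∀ᶠ n in atTop, ∃ x, η < ‖lowPart R (fourierL2 (v n)) x‖ := by
    filter_upwards [hJ.eventually (lt_mem_nhds (half_lt_self hl))] with n hn
    refine hlow (v n) (hv n) ?_ hn
    refine (norm_zLift_one_le hc (hv n)).trans ?_
    gcongr
    exact hKc _ (hv n) (hDn n)
  obtain ⟨N, hN⟩ := eventually_atTop.1 hex
  choose! a ha using hN
  -- The point of concentration is moved to the origin. It exists only from `N` on, hence the shift
  -- of the index.
  set w : ℕ → L2 := fun n => translate (a (n + N)) (v (n + N)) with hw
  have hwZ : ∀ n, MemZ (w n) := fun n => (hv _).translate _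
  have hwI : ∀ n, energyI c (w n) = energyI c (v (n + N)) := fun n => energyI_translate _ _ _
  have hwJ : ∀ n, energyJ k m (w n) = energyJ k m (v (n + N)) := fun n =>
    functionalJ_translate _ _ _
  have hwK : ∀ n, ‖zLift c (w n)‖ ≤ √(2 * D) := fun n => hKc _ (hwZ n) (by rw [hwI]; exact hDn _)
  obtain ⟨u, φ, hφ, hu, hw1, hw2⟩ := exists_weak_limit hc hwZ hwK
  -- The low part at the origin is weakly continuous and stays above `η` in modulus along the
  -- sequence.
  have hu0 : fourierL2 u ≠ 0 := by
    intro h0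
    obtain ⟨G, hG⟩ := exists_inner_eq_lowPart R (0 : Plane)
    have h1 := (hw2 G).norm
    rw [h0, inner_zero_right, norm_zero] at h1
    have h2 : η ≤ 0 := by
      refine ge_of_tendsto h1 (Eventually.of_forall fun n => ?_)
      rw [← hG, hw]
      simp only
      rw [lowPart_translate, zero_add]
      exact (ha _ (Nat.le_add_left _ _)).le
    linarith
  have hshift : Tendsto (fun n => φ n + N) atTop atTop :=
    tendsto_atTop_mono (fun n => Nat.le_add_right _ _) hφ.tendsto_atTop
  obtain ⟨hmin, hconv⟩ := h.tendsto_of_weak (v := fun n => w (φ n)) (fun n => hwZ _)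
    (fun n => hwK _) hu
    ((hI.comp hshift).congr fun n => (hwI _).symm) ((hJ.comp hshift).congr fun n => (hwJ _).symm)
    hw1 hw2 hu0
  exact ⟨u, fun n => φ n + N, fun n => a (φ n + N),
    fun i j hij => Nat.add_lt_add_right (hφ hij) N, hmin, hconv⟩

end Compactness

/-! ### Hermitian symmetry of transforms of real functions -/

/-- The complex conjugate of a Schwartz function. -/
def conjSchwartz (ψ : 𝓢(Plane, ℂ)) : 𝓢(Plane, ℂ) :=
  SchwartzMap.postcompCLM (𝕜 := ℝ) (Complex.conjCLE : ℂ →L[ℝ] ℂ) ψ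

theorem conjSchwartz_apply (ψ : 𝓢(Plane, ℂ)) (x : Plane) :
    conjSchwartz ψ x = (starRingEnd ℂ) (ψ x) := rfl

/-- The reflection `ξ ↦ ψ (-ξ)` of a Schwartz function. -/
def negSchwartz (ψ : 𝓢(Plane, ℂ)) : 𝓢(Plane, ℂ) :=
  SchwartzMap.compCLMOfContinuousLinearEquiv ℂ (ContinuousLinearEquiv.neg ℝ) ψ

theorem negSchwartz_apply (ψ : 𝓢(Plane, ℂ)) (x : Plane) : negSchwartz ψ x = ψ (-x) := rfl

theorem fourier_negSchwartz (ψ : 𝓢(Plane, ℂ)) (x : Plane) :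
    (𝓕 (negSchwartz ψ)) x = (𝓕 ψ) (-x) := by
  rw [fourier_apply_eq_schwartz, fourier_apply_eq_schwartz, ← integral_neg_eq_self]
  simp [negSchwartz_apply]

theorem fourier_conjSchwartz (ψ : 𝓢(Plane, ℂ)) (x : Plane) :
    (𝓕 (conjSchwartz ψ)) x = (starRingEnd ℂ) ((𝓕 ψ) (-x)) := by
  rw [fourier_apply_eq_schwartz, fourier_apply_eq_schwartz, ← integral_conj]
  refine integral_congr_ae (Eventually.of_forall fun v => ?_)
  simp only [conjSchwartz_apply, Circle.smul_def, smul_eq_mul, map_mul, inner_neg_right, neg_neg]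
  rw [← Circle.coe_inv_eq_conj, ← AddChar.map_neg_eq_inv]

/-- The Fourier transform of a real function is Hermitian. -/
theorem fourierL2_neg (u : L2) :
    ∀ᵐ ξ, fourierL2 u (-ξ) = (starRingEnd ℂ) (fourierL2 u ξ) := by
  have hmp := Measure.measurePreserving_neg (volume : Measure Plane)
  let A : CL2 := Lp.compMeasurePreserving (fun x => -x) hmp (fourierL2 u)
  let B : CL2 := (Complex.conjCLE : ℂ →L[ℝ] ℂ).compLp (fourierL2 u)
  have hA : A =ᵐ[volume] fun ξ => fourierL2 u (-ξ) := Lp.coeFn_compMeasurePreserving _ hmp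
  have hB : B =ᵐ[volume] fun ξ => (starRingEnd ℂ) (fourierL2 u ξ) :=
    (Complex.conjCLE : ℂ →L[ℝ] ℂ).coeFn_compLp _
  have hAB : A = B := by
    refine eq_of_integral_mul_schwartz fun ψ => ?_
    have e1 : ∫ x, A x * ψ x = ∫ x, (u x : ℂ) * (𝓕 ψ) (-x) := by
      have h1 : ∫ x, A x * ψ x = ∫ x, fourierL2 u (-x) * ψ x := by
        refine integral_congr_ae ?_
        filter_upwards [hA] with x hx
        rw [hx]
      rw [h1, ← integral_neg_eq_self]
      have h2 := integral_fourierL2_mul u (negSchwartz ψ)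
      simp only [fourier_negSchwartz, negSchwartz_apply] at h2
      simpa using h2
    have e2 : ∫ x, B x * ψ x = ∫ x, (u x : ℂ) * (𝓕 ψ) (-x) := by
      have h2 := congrArg (starRingEnd ℂ) (integral_fourierL2_mul u (conjSchwartz ψ))
      rw [← integral_conj, ← integral_conj] at h2
      simp only [fourier_conjSchwartz, conjSchwartz_apply, map_mul, Complex.conj_conj,
        Complex.conj_ofReal] at h2
      rw [← h2]
      refine integral_congr_ae ?_
      filter_upwards [hB] with x hx
      rw [hx]
    rw [e1, e2]
  filter_upwards [hA, hB] with ξ h1 h2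
  rw [← h1, ← h2, hAB]

/-- A Hermitian square integrable function is the Fourier transform of a real function. -/
theorem exists_fourierL2_eq {F : CL2} (hF : ∀ᵐ ξ, F (-ξ) = (starRingEnd ℂ) (F ξ)) :
    ∃ v : L2, fourierL2 v = F := by
  let f : CL2 := 𝓕⁻ F
  let w : L2 := Complex.imCLM.compLp f
  let u : L2 := Complex.reCLM.compLp f
  have hwc : w =ᵐ[volume] fun x => (f x).im := Complex.imCLM.coeFn_compLp f
  have huc : u =ᵐ[volume] fun x => (f x).re := Complex.reCLM.coeFn_compLp f
  have hf : f = toComplex u + Complex.I • toComplex w := by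
    refine Lp.ext ?_
    filter_upwards [hwc, huc, coeFn_toComplex u, coeFn_toComplex w,
      Lp.coeFn_add (toComplex u) (Complex.I • toComplex w),
      Lp.coeFn_smul Complex.I (toComplex w)] with x h1 h2 h3 h4 h5 h6
    rw [h5, Pi.add_apply, h6, Pi.smul_apply, h3, h4, h1, h2, smul_eq_mul, mul_comm,
      Complex.re_add_im]
  have hF' : F = fourierL2 u + Complex.I • fourierL2 w := by
    have h1 : F = (𝓕 f : CL2) := ((Lp.fourierTransformₗᵢ Plane ℂ).apply_symm_apply F).symm
    rw [h1, hf]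
    exact ((Lp.fourierTransformₗᵢ Plane ℂ).map_add _ _).trans
      (congrArg₂ _ rfl ((Lp.fourierTransformₗᵢ Plane ℂ).map_smul _ _))
  have hFc : F =ᵐ[volume] fun ξ => fourierL2 u ξ + Complex.I * fourierL2 w ξ := by
    filter_upwards [Lp.coeFn_add (fourierL2 u) (Complex.I • fourierL2 w),
      Lp.coeFn_smul Complex.I (fourierL2 w)] with ξ h1 h2
    rw [hF', h1, Pi.add_apply, h2, Pi.smul_apply, smul_eq_mul]
  have hmp := Measure.measurePreserving_neg (volume : Measure Plane)
  refine ⟨u, Lp.ext ?_⟩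
  filter_upwards [hF, hFc, hmp.quasiMeasurePreserving.ae hFc, fourierL2_neg u,
    fourierL2_neg w] with ξ h1 h2 h3 h4 h5
  -- Reflection sends `û + iŵ` to `conj û + i conj ŵ`, conjugation sends it to `conj û - i conj ŵ`;
  -- the symmetry of `F` equates the two.
  have hw : fourierL2 w ξ = 0 := by
    rw [h3, h2, h4, h5, map_add, map_mul, Complex.conj_I, add_right_inj, neg_mul,
      eq_neg_iff_add_eq_zero, ← two_mul] at h1
    simpa using h1
  rw [h2, hw, mul_zero, add_zero]

/-! ### Sobolev weights and frequency truncation -/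

/-- The squared Japanese bracket `1 + |2πξ|²`. -/
def jb (ξ : Plane) : ℝ := 1 + ‖(2 * Real.pi) • ξ‖ ^ 2

theorem jb_eq (ξ : Plane) : jb ξ = 1 + (2 * Real.pi * ξ 0) ^ 2 + (2 * Real.pi * ξ 1) ^ 2 := by
  rw [jb, EuclideanSpace.norm_sq_eq, Fin.sum_univ_two]
  simp only [PiLp.smul_apply, smul_eq_mul, Real.norm_eq_abs, sq_abs]
  ring

theorem one_le_jb (ξ : Plane) : 1 ≤ jb ξ := by
  unfold jb
  have := sq_nonneg ‖(2 * Real.pi) • ξ‖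
  linarith

theorem jb_pos (ξ : Plane) : 0 < jb ξ := one_pos.trans_le (one_le_jb ξ)

theorem jb_neg (ξ : Plane) : jb (-ξ) = jb ξ := by
  rw [jb, jb, smul_neg, norm_neg]

theorem continuous_jb : Continuous jb := by
  unfold jb
  fun_prop

theorem wt_zero_le_jb (ξ : Plane) : wt 0 ξ ≤ jb ξ := by
  rw [jb_eq, wt, zero_add]
  nlinarith [sq_abs (2 * Real.pi * ξ 0), sq_nonneg (|2 * Real.pi * ξ 0| - 1 / 2)]

theorem wt_one_le_jb (ξ : Plane) : wt 1 ξ ≤ 2 * jb ξ := by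
  have h1 := wt_zero_le_jb ξ
  have h2 := one_le_jb ξ
  have : wt 1 ξ = 1 + wt 0 ξ := by rw [wt, wt]; ring
  linarith

theorem abs_le_sqrt_jb (ξ : Plane) : |2 * Real.pi * ξ 0| ≤ √(jb ξ) := by
  refine Real.abs_le_sqrt ?_
  rw [jb_eq]
  nlinarith [sq_nonneg (2 * Real.pi * ξ 1)]

/-- The weight `(1 + |2πξ|²)^(s/2)` as a complex multiplier. -/
def jbPow (s : ℝ) (ξ : Plane) : ℂ := ((jb ξ ^ (s / 2) : ℝ) : ℂ)

theorem measurable_jbPow (s : ℝ) : Measurable (jbPow s) :=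
  Complex.measurable_ofReal.comp (continuous_jb.measurable.pow_const _)

theorem norm_jbPow (s : ℝ) (ξ : Plane) : ‖jbPow s ξ‖ = jb ξ ^ (s / 2) := by
  rw [jbPow, Complex.norm_real, Real.norm_of_nonneg (Real.rpow_nonneg (jb_pos ξ).le _)]

theorem enorm_jbPow_sq (s : ℝ) (ξ : Plane) : ‖jbPow s ξ‖ₑ ^ 2 = ENNReal.ofReal (jb ξ ^ s) := by
  rw [← ofReal_norm, ← ENNReal.ofReal_pow (norm_nonneg _), norm_jbPow, ← Real.rpow_natCast,
    ← Real.rpow_mul (jb_pos ξ).le]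
  congr 2
  push_cast
  ring

theorem lintegral_jbPow (s : ℝ) (u : L2) :
    hsNorm s u = (∫⁻ ξ, ‖jbPow s ξ‖ₑ ^ 2 * ‖fourierL2 u ξ‖ₑ ^ 2) ^ (1 / 2 : ℝ) := by
  simp only [enorm_jbPow_sq]
  rfl

theorem hsNorm_lt_top_iff (s : ℝ) (u : L2) :
    hsNorm s u < ∞ ↔ MemMul (jbPow s) (fourierL2 u) := by
  rw [lintegral_jbPow, memMul_iff (measurable_jbPow s),
    ENNReal.rpow_lt_top_iff_of_pos (by norm_num)]

/-- The weighted transform of `u`, whose `L²` norm is the norm of `H^s`. -/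
def hsLift (s : ℝ) (u : L2) : CL2 := mulFn (jbPow s) (fourierL2 u)

theorem hsNorm_eq {s : ℝ} {u : L2} (hu : MemMul (jbPow s) (fourierL2 u)) :
    hsNorm s u = ‖hsLift s u‖ₑ := by
  rw [lintegral_jbPow, ← enorm_mulFn_sq hu, hsLift, ← ENNReal.rpow_natCast, ← ENNReal.rpow_mul]
  norm_num

theorem hsLift_sub {s : ℝ} {u v : L2} (hu : MemMul (jbPow s) (fourierL2 u))
    (hv : MemMul (jbPow s) (fourierL2 v)) : hsLift s (u - v) = hsLift s u - hsLift s v := by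
  rw [hsLift, fourierL2_sub, mulFn_sub hu hv]
  rfl

theorem one_le_norm_jbPow {s : ℝ} (hs : 0 ≤ s) (ξ : Plane) : 1 ≤ ‖jbPow s ξ‖ := by
  rw [norm_jbPow]
  exact Real.one_le_rpow (one_le_jb ξ) (by positivity)

theorem norm_le_norm_hsLift {s : ℝ} (hs : 0 ≤ s) {u : L2} (hu : MemMul (jbPow s) (fourierL2 u)) :
    ‖u‖ ≤ ‖hsLift s u‖ := by
  have := norm_mulFn_le_mulFn hu (memMul_one (fourierL2 u)) (C := 1) fun ξ => by
    rw [norm_one, one_mul]; exact one_le_norm_jbPow hs ξ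
  rwa [mulFn_one, one_mul, norm_fourierL2] at this

theorem memLp_jbPow_neg {s : ℝ} (hs : 1 < s) : MemLp (jbPow (-s)) 2 (volume : Measure Plane) := by
  rw [memLp_two_iff_integrable_sq_norm (measurable_jbPow _).aestronglyMeasurable]
  have h := integrable_rpow_neg_one_add_norm_sq (E := Plane) (μ := volume) (r := 2 * s)
    (by simpa using hs)
  refine h.mono' ((measurable_jbPow _).norm.pow_const 2).aestronglyMeasurable
    (Eventually.of_forall fun ξ => ?_)
  rw [norm_jbPow, Real.norm_of_nonneg (by have := jb_pos ξ; positivity), ← Real.rpow_natCast,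
    ← Real.rpow_mul (jb_pos ξ).le]
  have e : -s / 2 * ((2 : ℕ) : ℝ) = -(2 * s) / 2 := by push_cast; ring
  rw [e]
  refine Real.rpow_le_rpow_of_nonpos (by positivity) ?_ (by linarith)
  rw [jb, norm_smul, Real.norm_of_nonneg (by positivity), mul_pow]
  have h1 : 1 ≤ (2 * Real.pi) ^ 2 := by nlinarith [Real.pi_gt_three]
  nlinarith [sq_nonneg ‖ξ‖]

/-- The embedding `H^s ⊂ L^∞` for `s > 1`. -/
theorem exists_abs_le_norm_hsLift {s : ℝ} (hs : 1 < s) :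
    ∃ C : ℝ, 0 ≤ C ∧ ∀ u : L2, MemMul (jbPow s) (fourierL2 u) →
      ∀ᵐ x, |u x| ≤ C * ‖hsLift s u‖ := by
  -- The transform of `u` is the product of two `L²` functions, this inverse weight and the weighted
  -- transform, hence integrable.
  obtain ⟨b, hb⟩ : ∃ b : CL2, b =ᵐ[volume] jbPow (-s) := ⟨_, (memLp_jbPow_neg hs).coeFn_toLp⟩
  refine ⟨‖b‖, norm_nonneg _, fun u hu => ?_⟩
  have hprod : fourierL2 u =ᵐ[volume] fun ξ => b ξ * hsLift s u ξ := by
    filter_upwards [hb, coeFn_mulFn hu] with ξ h1 h2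
    rw [h1, hsLift, h2, ← mul_assoc, jbPow, jbPow, ← Complex.ofReal_mul,
      ← Real.rpow_add (jb_pos ξ)]
    simp [neg_div]
  have hint : Integrable (fourierL2 u) :=
    ((Lp.memLp b).integrable_mul (Lp.memLp (hsLift s u))).congr hprod.symm
  have hle : (∫⁻ ξ, ‖fourierL2 u ξ‖ₑ).toReal ≤ ‖b‖ * ‖hsLift s u‖ := by
    refine ENNReal.toReal_le_of_le_ofReal (by positivity) ?_
    rw [ENNReal.ofReal_mul (norm_nonneg _), ofReal_norm, ofReal_norm, Lp.enorm_def, Lp.enorm_def,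
      ← eLpNorm_one_eq_lintegral_enorm, eLpNorm_congr_ae hprod]
    have := eLpNorm_smul_le_mul_eLpNorm (p := 2) (q := 2) (r := 1) (μ := volume)
      (Lp.aestronglyMeasurable (hsLift s u)) (Lp.aestronglyMeasurable b)
    exact this
  filter_upwards [norm_fourierInv_fourierL2_ae u, fourierInv_ae_eq hint] with x h1 h2
  rw [← h1, h2]
  exact (norm_fourierInv_le hint x).trans hle

open Classical in
/-- The characteristic function of the frequencies with `1 + |2πξ|² ≤ R`. -/
def ballCut (R : ℝ) (ξ : Plane) : ℂ := if jb ξ ≤ R then 1 else 0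

theorem measurable_ballCut (R : ℝ) : Measurable (ballCut R) :=
  Measurable.ite (measurableSet_le continuous_jb.measurable measurable_const) measurable_const
    measurable_const

theorem norm_ballCut_le (R : ℝ) (ξ : Plane) : ‖ballCut R ξ‖ ≤ 1 := by
  unfold ballCut; split_ifs <;> simp

theorem norm_mul_ballCut_le {R C : ℝ} (hC : 0 ≤ C) {g : Plane → ℂ}
    (hg : ∀ ξ, jb ξ ≤ R → ‖g ξ‖ ≤ C) (ξ : Plane) : ‖g ξ * ballCut R ξ‖ ≤ C := by
  unfold ballCut
  split_ifs with h
  · simpa using hg ξ h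
  · simpa using hC

theorem memMul_ballCut (R : ℝ) (F : CL2) : MemMul (ballCut R) F :=
  memMul_of_bound (measurable_ballCut R) (norm_ballCut_le R) F

/-- The cutoff is real and even, so it preserves the Hermitian symmetry. The truncation therefore
stays real, as the nonlinearity requires. -/
theorem exists_fourierL2_eq_ballCut (R : ℝ) (u : L2) :
    ∃ v : L2, fourierL2 v = mulFn (ballCut R) (fourierL2 u) := by
  refine exists_fourierL2_eq ?_
  have hmp := Measure.measurePreserving_neg (volume : Measure Plane)
  have h := coeFn_mulFn (memMul_ballCut R (fourierL2 u))
  filter_upwards [h, hmp.quasiMeasurePreserving.ae h, fourierL2_neg u] with ξ h1 h2 h3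
  rw [h1, h2, h3, map_mul]
  congr 1
  rw [ballCut, ballCut, jb_neg]
  split_ifs <;> simp

/-- The part of `u` with frequencies `1 + |2πξ|² ≤ R`. -/
def truncate (R : ℝ) (u : L2) : L2 := (exists_fourierL2_eq_ballCut R u).choose

theorem fourierL2_truncate (R : ℝ) (u : L2) :
    fourierL2 (truncate R u) = mulFn (ballCut R) (fourierL2 u) :=
  (exists_fourierL2_eq_ballCut R u).choose_spec

theorem fourierL2_sub_truncate (R : ℝ) (u : L2) :
    fourierL2 (u - truncate R u) =ᵐ[volume] fun ξ => (1 - ballCut R ξ) * fourierL2 u ξ := by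
  rw [fourierL2_sub, fourierL2_truncate]
  filter_upwards [coeFn_mulFn (memMul_ballCut R (fourierL2 u)),
    Lp.coeFn_sub (fourierL2 u) (mulFn (ballCut R) (fourierL2 u))] with ξ h1 h2
  rw [h2, Pi.sub_apply, h1]
  ring

theorem memMul_truncate {g : Plane → ℂ} {u : L2} (hg : Measurable g)
    (hu : MemMul g (fourierL2 u)) (R : ℝ) : MemMul g (fourierL2 (truncate R u)) := by
  rw [fourierL2_truncate, memMul_mulFn_iff (memMul_ballCut R _)]
  refine hu.of_le (C := 1) (hg.mul (measurable_ballCut R)) fun ξ => ?_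
  rw [norm_mul, one_mul]
  exact mul_le_of_le_one_right (norm_nonneg _) (norm_ballCut_le R ξ)

theorem norm_mulFn_truncate_le {g : Plane → ℂ} {u : L2} (hg : Measurable g)
    (hu : MemMul g (fourierL2 u)) (R : ℝ) :
    ‖mulFn g (fourierL2 (truncate R u))‖ ≤ ‖mulFn g (fourierL2 u)‖ := by
  refine Lp.norm_le_norm_of_ae_le ?_
  filter_upwards [coeFn_mulFn (memMul_truncate hg hu R), coeFn_mulFn hu,
    coeFn_mulFn (memMul_ballCut R (fourierL2 u))] with ξ h1 h2 h3
  rw [h1, h2, fourierL2_truncate, h3, norm_mul, norm_mul, norm_mul]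
  gcongr
  exact mul_le_of_le_one_left (norm_nonneg _) (norm_ballCut_le R ξ)

/-- Frequencies above the cutoff are small in weaker weighted norms. -/
theorem norm_mulFn_sub_truncate_le {g : Plane → ℂ} {u : L2} {s C R : ℝ}
    (hg : MemMul g (fourierL2 u)) (hgm : Measurable g) (hu : MemMul (jbPow s) (fourierL2 u))
    (hC : 0 ≤ C) (h : ∀ ξ, R ≤ jb ξ → ‖g ξ‖ ≤ C * jb ξ ^ (s / 2)) :
    ‖mulFn g (fourierL2 (u - truncate R u))‖ ≤ C * ‖hsLift s u‖ := by
  have hg' : MemMul g (fourierL2 (u - truncate R u)) := by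
    rw [fourierL2_sub]
    exact hg.sub (memMul_truncate hgm hg R)
  refine Lp.norm_le_mul_norm_of_ae_le_mul ?_
  filter_upwards [coeFn_mulFn hg', coeFn_mulFn hu, fourierL2_sub_truncate R u] with ξ h1 h2 h3
  rw [h1, hsLift, h2, h3, norm_mul, norm_mul, norm_mul, norm_jbPow]
  unfold ballCut
  split_ifs with hR
  · have := jb_pos ξ
    simp only [sub_self, norm_zero, zero_mul, mul_zero]
    positivity
  · simp only [sub_zero, norm_one, one_mul]
    rw [← mul_assoc]
    exact mul_le_mul_of_nonneg_right (h ξ (not_le.1 hR).le) (norm_nonneg _)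

theorem norm_sub_truncate_le {u : L2} {s R : ℝ} (hs : 0 ≤ s) (hR : 0 < R)
    (hu : MemMul (jbPow s) (fourierL2 u)) :
    ‖u - truncate R u‖ ≤ R ^ (-s / 2) * ‖hsLift s u‖ := by
  have := norm_mulFn_sub_truncate_le (g := fun _ => 1) (R := R) (C := R ^ (-s / 2))
    (memMul_one _) measurable_const hu (by positivity) fun ξ h => by
      rw [norm_one]
      calc (1 : ℝ) = R ^ (-s / 2) * R ^ (s / 2) := by
            rw [← Real.rpow_add hR, neg_div, neg_add_cancel, Real.rpow_zero]
        _ ≤ _ := by gcongr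
  rwa [mulFn_one, norm_fourierL2] at this

theorem norm_sqwt_one_le (ξ : Plane) : ‖sqwt 1 ξ‖ ≤ 2 * jb ξ ^ (1 / 2 : ℝ) := by
  rw [← Real.sqrt_eq_rpow]
  refine abs_le_of_sq_le_sq' ?_ (by positivity) |>.2
  rw [norm_sqwt_sq zero_le_one, mul_pow, Real.sq_sqrt (jb_pos ξ).le]
  linarith [wt_one_le_jb ξ, jb_pos ξ]

theorem memZ_of_jbPow {s : ℝ} (hs : 1 ≤ s) {u : L2} (hu : MemMul (jbPow s) (fourierL2 u)) :
    MemZ u := by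
  rw [memZ_iff_memMul zero_le_one]
  refine hu.of_le (measurable_sqwt 1) (C := 2) fun ξ => (norm_sqwt_one_le ξ).trans ?_
  rw [norm_jbPow]
  gcongr
  exact one_le_jb ξ

theorem MemZ.truncate {u : L2} (hu : MemZ u) (R : ℝ) : MemZ (truncate R u) := by
  rw [memZ_iff_memMul zero_le_one] at hu ⊢
  exact memMul_truncate (measurable_sqwt 1) hu R

theorem norm_zLift_sub_truncate_le {u : L2} {s R : ℝ} (hs : 1 ≤ s) (hR : 0 < R)
    (hu : MemMul (jbPow s) (fourierL2 u)) :
    ‖zLift 1 (u - BOZK.truncate R u)‖ ≤ 2 * R ^ ((1 - s) / 2) * ‖hsLift s u‖ := by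
  refine norm_mulFn_sub_truncate_le ((memZ_of_jbPow hs hu).memMul zero_le_one) (measurable_sqwt 1) hu
    (by positivity) fun ξ h => (norm_sqwt_one_le ξ).trans ?_
  have hj := jb_pos ξ
  calc 2 * jb ξ ^ (1 / 2 : ℝ) = 2 * jb ξ ^ ((1 - s) / 2) * jb ξ ^ (s / 2) := by
        rw [mul_assoc, ← Real.rpow_add hj]; congr 2; ring
    _ ≤ _ := by
        gcongr 2 * ?_ * _
        exact Real.rpow_le_rpow_of_nonpos hR h (by linarith)

/-- Multiplication by a bounded function as a bounded operator. -/
theorem exists_mulFn_clm {g : Plane → ℂ} (hg : Measurable g) {C : ℝ} (hC : ∀ ξ, ‖g ξ‖ ≤ C) :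
    ∃ T : CL2 →L[ℝ] CL2, ∀ F, T F = mulFn g F :=
  ⟨LinearMap.mkContinuous
    { toFun := mulFn g
      map_add' := fun F G => mulFn_add (memMul_of_bound hg hC F) (memMul_of_bound hg hC G)
      map_smul' := fun r F => mulFn_smul (memMul_of_bound hg hC F) r } C
    fun F => norm_mulFn_le (memMul_of_bound hg hC F) hC, fun _ => rfl⟩

theorem continuous_mulFn {g : Plane → ℂ} (hg : Measurable g) {C : ℝ} (hC : ∀ ξ, ‖g ξ‖ ≤ C) :
    Continuous (mulFn g) := by
  obtain ⟨T, hT⟩ := exists_mulFn_clm hg hC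
  rw [← funext hT]
  exact T.continuous

theorem hasDerivWithinAt_mulFn {g : Plane → ℂ} (hg : Measurable g) {C : ℝ} (hC : ∀ ξ, ‖g ξ‖ ≤ C)
    {V : ℝ → CL2} {V' : CL2} {S : Set ℝ} {t : ℝ} (h : HasDerivWithinAt V V' S t) :
    HasDerivWithinAt (fun τ => mulFn g (V τ)) (mulFn g V') S t := by
  obtain ⟨T, hT⟩ := exists_mulFn_clm hg hC
  have := T.hasFDerivAt.comp_hasDerivWithinAt t h
  rw [hT] at this
  simpa only [Function.comp_def, hT] using this

theorem inner_fourierL2_fourierL2 (u v : L2) :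
    (inner ℂ (fourierL2 u) (fourierL2 v) : ℂ) = ((∫ x, u x * v x : ℝ) : ℂ) := by
  rw [← inner_toComplex, inner_fourierL2]
  rfl

theorem integrable_mul (u v : L2) : Integrable fun x => u x * v x :=
  (Lp.memLp u).integrable_mul (Lp.memLp v)

/-! ### Nonlinear functionals along differentiable paths -/

open Classical in
/-- The composition `f(u)` in `L²`, with the value `0` if it is not square integrable. -/
def compL2 (f : ℝ → ℝ) (u : L2) : L2 :=
  if h : MemLp (fun x => f (u x)) 2 (volume : Measure Plane) then h.toLp _ else 0

/-- `F` is a primitive of the locally Lipschitz function `f`, and both vanish at `0`. -/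
structure IsPrimitive (f F : ℝ → ℝ) : Prop where
  hasDerivAt : ∀ x, HasDerivAt F (f x) x
  zero_left : f 0 = 0
  zero_right : F 0 = 0
  lipschitz : ∀ K : ℝ, ∃ C : ℝ, 0 ≤ C ∧ ∀ a b, |a| ≤ K → |b| ≤ K → |f a - f b| ≤ C * |a - b|

section Primitive

variable {f F : ℝ → ℝ} {K C : ℝ}

theorem IsPrimitive.continuous_left (hf : IsPrimitive f F) : Continuous f := by
  refine continuous_iff_continuousAt.2 fun x => ?_
  obtain ⟨C, hC, h⟩ := hf.lipschitz (|x| + 1)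
  rw [ContinuousAt, tendsto_iff_norm_sub_tendsto_zero]
  have h0 : Tendsto (fun y => C * |y - x|) (𝓝 x) (𝓝 0) := by
    have : Continuous fun y => C * |y - x| := by fun_prop
    simpa using this.tendsto x
  refine squeeze_zero' (Eventually.of_forall fun y => norm_nonneg _) ?_ h0
  filter_upwards [Metric.ball_mem_nhds x one_pos] with y hy
  rw [Metric.mem_ball, Real.dist_eq] at hy
  refine h y x ?_ (by linarith)
  have := abs_sub_abs_le_abs_sub y x
  linarith

theorem IsPrimitive.continuous_right (hf : IsPrimitive f F) : Continuous F :=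
  continuous_iff_continuousAt.2 fun x => (hf.hasDerivAt x).continuousAt

/-- Mean value inequality for `y ↦ F y - f a * y`, whose derivative `f y - f a` is at most `C |b -
a|` on the segment. -/
theorem IsPrimitive.taylor (hf : IsPrimitive f F) (hC : 0 ≤ C)
    (hL : ∀ a b, |a| ≤ K → |b| ≤ K → |f a - f b| ≤ C * |a - b|) {a b : ℝ} (ha : |a| ≤ K)
    (hb : |b| ≤ K) : |F b - F a - f a * (b - a)| ≤ C * (b - a) ^ 2 := by
  have hseg : ∀ x ∈ Set.uIcc a b, |x| ≤ K ∧ |x - a| ≤ |b - a| := by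
    intro x hx
    refine ⟨?_, Set.abs_sub_left_of_mem_uIcc hx⟩
    rw [Set.mem_uIcc] at hx
    rw [abs_le] at ha hb ⊢
    rcases hx with hx | hx <;> constructor <;> linarith [hx.1, hx.2]
  have hd : ∀ x ∈ Set.uIcc a b, HasDerivWithinAt (fun y => F y - f a * y) (f x - f a)
      (Set.uIcc a b) x := fun x _ => by
    have := (hf.hasDerivAt x).sub ((hasDerivAt_id x).const_mul (f a))
    rw [mul_one] at this
    exact this.hasDerivWithinAt
  have h := (convex_uIcc a b).norm_image_sub_le_of_norm_hasDerivWithin_le (C := C * |b - a|) hd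
    (fun x hx => (hL x a (hseg x hx).1 ha).trans
      (mul_le_mul_of_nonneg_left (hseg x hx).2 hC)) Set.left_mem_uIcc Set.right_mem_uIcc
  rw [Real.norm_eq_abs, Real.norm_eq_abs, mul_assoc, ← abs_mul, ← sq, abs_sq] at h
  refine le_of_eq_of_le ?_ h
  congr 1
  ring

theorem IsPrimitive.memLp_comp (hf : IsPrimitive f F)
    (hL : ∀ a b, |a| ≤ K → |b| ≤ K → |f a - f b| ≤ C * |a - b|) {u : L2} (hu : ∀ᵐ x, |u x| ≤ K) :
    MemLp (fun x => f (u x)) 2 (volume : Measure Plane) := by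
  refine MemLp.of_le_mul (c := C) (Lp.memLp u)
    (hf.continuous_left.comp_aestronglyMeasurable (Lp.aestronglyMeasurable u)) ?_
  filter_upwards [hu] with x hx
  have := hL (u x) 0 hx (by simpa using (abs_nonneg _).trans hx)
  simpa [hf.zero_left] using this

theorem IsPrimitive.coeFn_compL2 (hf : IsPrimitive f F)
    (hL : ∀ a b, |a| ≤ K → |b| ≤ K → |f a - f b| ≤ C * |a - b|) {u : L2} (hu : ∀ᵐ x, |u x| ≤ K) :
    compL2 f u =ᵐ[volume] fun x => f (u x) := by
  rw [compL2, dif_pos (hf.memLp_comp hL hu)]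
  exact MemLp.coeFn_toLp _

theorem IsPrimitive.norm_compL2_sub_le (hf : IsPrimitive f F)
    (hL : ∀ a b, |a| ≤ K → |b| ≤ K → |f a - f b| ≤ C * |a - b|) {u v : L2} (hu : ∀ᵐ x, |u x| ≤ K)
    (hv : ∀ᵐ x, |v x| ≤ K) : ‖compL2 f u - compL2 f v‖ ≤ C * ‖u - v‖ := by
  refine Lp.norm_le_mul_norm_of_ae_le_mul ?_
  filter_upwards [hu, hv, hf.coeFn_compL2 hL hu, hf.coeFn_compL2 hL hv,
    Lp.coeFn_sub (compL2 f u) (compL2 f v), Lp.coeFn_sub u v] with x h1 h2 h3 h4 h5 h6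
  rw [h5, h6, Pi.sub_apply, Pi.sub_apply, h3, h4]
  exact hL _ _ h1 h2

theorem IsPrimitive.integrable (hf : IsPrimitive f F) (hC : 0 ≤ C)
    (hL : ∀ a b, |a| ≤ K → |b| ≤ K → |f a - f b| ≤ C * |a - b|) {u : L2} (hu : ∀ᵐ x, |u x| ≤ K) :
    Integrable fun x => F (u x) := by
  refine ((integrable_norm_sq u).const_mul C).mono'
    (hf.continuous_right.comp_aestronglyMeasurable (Lp.aestronglyMeasurable u)) ?_
  filter_upwards [hu] with x hx
  have := hf.taylor hC hL (a := 0) (b := u x) (by simpa using (abs_nonneg _).trans hx) hx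
  simpa [hf.zero_left, hf.zero_right] using this

/-- The integrated Taylor bound. Parseval moves the linear term to the Fourier side, where the time
derivative of a solution is available. -/
theorem IsPrimitive.abs_functionalJ_sub_le (hf : IsPrimitive f F) (hC : 0 ≤ C)
    (hL : ∀ a b, |a| ≤ K → |b| ≤ K → |f a - f b| ≤ C * |a - b|) {v w : L2} (hv : ∀ᵐ x, |v x| ≤ K)
    (hw : ∀ᵐ x, |w x| ≤ K) :
    |functionalJ F w - functionalJ F v -
      (inner ℂ (fourierL2 (compL2 f v)) (fourierL2 w - fourierL2 v) : ℂ).re| ≤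
        C * ‖fourierL2 w - fourierL2 v‖ ^ 2 := by
  have hi : Integrable fun x => F (w x) - F (v x) :=
    (hf.integrable hC hL hw).sub (hf.integrable hC hL hv)
  rw [← fourierL2_sub, inner_fourierL2_fourierL2, Complex.ofReal_re, norm_fourierL2,
    ← integral_norm_sq_eq, functionalJ, functionalJ, ← integral_const_mul,
    ← integral_sub (hf.integrable hC hL hw) (hf.integrable hC hL hv),
    ← integral_sub hi (integrable_mul _ _), ← Real.norm_eq_abs]
  refine norm_integral_le_of_norm_le ((integrable_norm_sq (w - v)).const_mul C) ?_
  filter_upwards [hv, hw, hf.coeFn_compL2 hL hv, Lp.coeFn_sub w v] with x h1 h2 h3 h4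
  rw [h3, h4, Pi.sub_apply, Real.norm_eq_abs, Real.norm_eq_abs, sq_abs]
  exact hf.taylor hC hL h1 h2

/-- The chain rule for `∫ F(v)` along a differentiable bounded path. -/
theorem IsPrimitive.hasDerivWithinAt_functionalJ (hf : IsPrimitive f F) (hC : 0 ≤ C)
    (hL : ∀ a b, |a| ≤ K → |b| ≤ K → |f a - f b| ≤ C * |a - b|) {v : ℝ → L2} {V' : CL2} {S : Set ℝ} {t : ℝ}
    (ht : t ∈ S) (hV : HasDerivWithinAt (fun τ => fourierL2 (v τ)) V' S t)
    (hv : ∀ τ ∈ S, ∀ᵐ x, |v τ x| ≤ K) :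
    HasDerivWithinAt (fun τ => functionalJ F (v τ))
      (inner ℂ (fourierL2 (compL2 f (v t))) V' : ℂ).re S t := by
  set c := fourierL2 (compL2 f (v t)) with hc
  have h1 : HasDerivWithinAt (fun τ => (inner ℂ c (fourierL2 (v τ) - fourierL2 (v t)) : ℂ).re)
      (inner ℂ c V' : ℂ).re S t := by
    have h := (hasDerivWithinAt_const t S c).inner ℂ (hV.sub_const (fourierL2 (v t)))
    rw [inner_zero_left, add_zero] at h
    exact Complex.reCLM.hasFDerivAt.comp_hasDerivWithinAt t h
  have h2 : HasDerivWithinAt (fun τ => functionalJ F (v τ) - functionalJ F (v t) -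
      (inner ℂ c (fourierL2 (v τ) - fourierL2 (v t)) : ℂ).re) 0 S t := by
    rw [hasDerivWithinAt_iff_isLittleO]
    simp only [sub_self, inner_zero_right, Complex.zero_re, sub_zero, smul_zero]
    have hO : (fun τ => fourierL2 (v τ) - fourierL2 (v t)) =O[𝓝[S] t] fun τ => τ - t :=
      hV.hasFDerivWithinAt.isBigO_sub
    have ho : (fun τ : ℝ => (τ - t) ^ 2) =o[𝓝[S] t] fun τ => τ - t := by
      have h0 : Tendsto (fun τ : ℝ => τ - t) (𝓝[S] t) (𝓝 0) := by
        have : Continuous fun τ : ℝ => τ - t := by fun_prop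
        have h := this.tendsto t
        rw [sub_self] at h
        exact h.mono_left nhdsWithin_le_nhds
      have := (Asymptotics.isLittleO_one_iff ℝ).2 h0
      simpa [sq] using this.mul_isBigO (Asymptotics.isBigO_refl (fun τ : ℝ => τ - t) (𝓝[S] t))
    refine Asymptotics.IsBigO.trans_isLittleO ?_ ho
    refine Asymptotics.IsBigO.trans ?_ (hO.norm_left.pow 2)
    refine Asymptotics.IsBigO.of_bound C ?_
    filter_upwards [self_mem_nhdsWithin] with τ hτ
    rw [Real.norm_eq_abs, norm_pow, norm_norm]
    exact hf.abs_functionalJ_sub_le hC hL (hv t ht) (hv τ hτ)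
  have h3 := (h2.add h1).add_const (functionalJ F (v t))
  rw [zero_add] at h3
  refine h3.congr_of_mem (fun τ _ => ?_) ht
  simp

end Primitive

/-! ### Band-limited differentiation and the nonlinearity of the equation -/

/-- The symbol `2πiξ₀` of `∂ₓ`, cut off. -/
def dxCut (R : ℝ) (ξ : Plane) : ℂ := Complex.I * ((2 * Real.pi * ξ 0 : ℝ) : ℂ) * ballCut R ξ

theorem measurable_dxCut (R : ℝ) : Measurable (dxCut R) := by
  refine Measurable.mul ?_ (measurable_ballCut R)
  have : Continuous fun ξ : Plane => Complex.I * ((2 * Real.pi * ξ 0 : ℝ) : ℂ) := by fun_prop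
  exact this.measurable

theorem norm_dxCut_le (R : ℝ) (ξ : Plane) : ‖dxCut R ξ‖ ≤ √R := by
  refine norm_mul_ballCut_le (g := fun ξ => Complex.I * ((2 * Real.pi * ξ 0 : ℝ) : ℂ))
    (Real.sqrt_nonneg R) (fun ξ h => ?_) ξ
  rw [norm_mul, Complex.norm_I, one_mul, Complex.norm_real, Real.norm_eq_abs]
  exact (abs_le_sqrt_jb ξ).trans (Real.sqrt_le_sqrt h)

theorem memMul_dxCut (R : ℝ) (G : CL2) : MemMul (dxCut R) G :=
  memMul_of_bound (measurable_dxCut R) (norm_dxCut_le R) G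

theorem norm_mulFn_dxCut_le (R : ℝ) (G : CL2) : ‖mulFn (dxCut R) G‖ ≤ √R * ‖G‖ :=
  norm_mulFn_le (memMul_dxCut R G) (norm_dxCut_le R)

/-- On frequencies with `|2πξ₀| ≤ √R`, the bound `|e^{iθ} - 1 - iθ| ≤ θ²` for `|θ| ≤ 1` gives a
remainder of order `R τ²`, uniformly in `ξ`. -/
theorem hasDerivAt_fourierL2_translate (R : ℝ) (u : L2) :
    HasDerivAt (fun τ : ℝ => fourierL2 (translate (τ • ex) (truncate R u)))
      (mulFn (dxCut R) (fourierL2 (truncate R u))) 0 := by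
  set v := truncate R u with hv
  have h0 : translate ((0 : ℝ) • ex) v = v := by
    refine Lp.ext ?_
    filter_upwards [coeFn_translate ((0 : ℝ) • ex) v] with x hx
    rw [hx, zero_smul, add_zero]
  rw [hasDerivAt_iff_isLittleO]
  have ho : (fun τ : ℝ => (τ - 0) ^ 2) =o[𝓝 0] fun τ : ℝ => τ - 0 := by
    simpa using Asymptotics.isLittleO_pow_id (𝕜 := ℝ) one_lt_two
  refine Asymptotics.IsBigO.trans_isLittleO ?_ ho
  refine Asymptotics.IsBigO.of_bound (R * ‖fourierL2 v‖) ?_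
  have hsmall : ∀ᶠ τ : ℝ in 𝓝 0, |τ| * √R ≤ 1 := by
    have : Continuous fun τ : ℝ => |τ| * √R := by fun_prop
    have h := this.tendsto 0
    rw [abs_zero, zero_mul] at h
    exact h.eventually_le_const one_pos
  filter_upwards [hsmall] with τ hτ
  rw [h0, sub_zero, norm_pow, Real.norm_eq_abs, sq_abs, mul_right_comm]
  refine Lp.norm_le_mul_norm_of_ae_le_mul ?_
  filter_upwards [fourierL2_translate (τ • ex) v, coeFn_mulFn (memMul_dxCut R (fourierL2 v)),
    coeFn_mulFn (memMul_ballCut R (fourierL2 u)),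
    Lp.coeFn_sub (fourierL2 (translate (τ • ex) v) - fourierL2 v)
      (τ • mulFn (dxCut R) (fourierL2 v)),
    Lp.coeFn_sub (fourierL2 (translate (τ • ex) v)) (fourierL2 v),
    Lp.coeFn_smul τ (mulFn (dxCut R) (fourierL2 v))] with ξ h1 h2 h3 h4 h5 h6
  rw [h4, Pi.sub_apply, h5, Pi.sub_apply, h6, Pi.smul_apply, h1, h2]
  rw [← fourierL2_truncate, ← hv] at h3
  by_cases hξ : jb ξ ≤ R
  · have e : ((Real.fourierChar (inner ℝ ξ (τ • ex)) : Circle) : ℂ) * fourierL2 v ξ - fourierL2 v ξ -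
        τ • (dxCut R ξ * fourierL2 v ξ) =
        (Complex.exp (((τ * (2 * Real.pi * ξ 0) : ℝ) : ℂ) * Complex.I) - 1 -
          ((τ * (2 * Real.pi * ξ 0) : ℝ) : ℂ) * Complex.I) * fourierL2 v ξ := by
      rw [Real.fourierChar_apply, inner_smul_right, inner_ex, dxCut, ballCut, if_pos hξ,
        Complex.real_smul]
      have : 2 * Real.pi * (τ * ξ 0) = τ * (2 * Real.pi * ξ 0) := by ring
      rw [this]
      push_cast
      ring
    rw [e, norm_mul]
    have hb : |τ * (2 * Real.pi * ξ 0)| ≤ |τ| * √R := by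
      rw [abs_mul]
      gcongr
      exact (abs_le_sqrt_jb ξ).trans (Real.sqrt_le_sqrt hξ)
    have hn : ‖((τ * (2 * Real.pi * ξ 0) : ℝ) : ℂ) * Complex.I‖ = |τ * (2 * Real.pi * ξ 0)| := by
      rw [norm_mul, Complex.norm_I, mul_one, Complex.norm_real, Real.norm_eq_abs]
    have hR : 0 ≤ R := (jb_pos ξ).le.trans hξ
    gcongr
    refine (Complex.norm_exp_sub_one_sub_id_le (by rw [hn]; exact hb.trans hτ)).trans ?_
    rw [hn]
    calc |τ * (2 * Real.pi * ξ 0)| ^ 2 ≤ (|τ| * √R) ^ 2 := by gcongr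
      _ = R * τ ^ 2 := by rw [mul_pow, sq_abs, Real.sq_sqrt hR]; ring
  · have : fourierL2 v ξ = 0 := by rw [h3, ballCut, if_neg hξ, zero_mul]
    simp [this]

/-- `∫ f(v) vₓ = 0` for band-limited `v`. -/
theorem IsPrimitive.re_inner_dxCut_eq_zero {f F : ℝ → ℝ} (hf : IsPrimitive f F) {R K : ℝ} {u : L2}
    (hv : ∀ᵐ x, |truncate R u x| ≤ K) :
    (inner ℂ (fourierL2 (compL2 f (truncate R u)))
      (mulFn (dxCut R) (fourierL2 (truncate R u))) : ℂ).re = 0 := by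
  obtain ⟨C, hC, hL⟩ := hf.lipschitz K
  set v := truncate R u with hvd
  have h0 : translate ((0 : ℝ) • ex) v = v := by
    refine Lp.ext ?_
    filter_upwards [coeFn_translate ((0 : ℝ) • ex) v] with x hx
    rw [hx, zero_smul, add_zero]
  have hb : ∀ τ ∈ (Set.univ : Set ℝ), ∀ᵐ x, |translate (τ • ex) v x| ≤ K := fun τ _ => by
    have h := (measurePreserving_add_right (volume : Measure Plane)
      (τ • ex)).quasiMeasurePreserving.ae hv
    filter_upwards [h, coeFn_translate (τ • ex) v] with x h1 h2
    rw [h2]; exact h1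
  -- `∫ F(v)` is constant along translations in `x`, and its derivative at `τ = 0` is the integral
  -- in question.
  have h1 := hf.hasDerivWithinAt_functionalJ hC hL (Set.mem_univ 0)
    (hasDerivAt_fourierL2_translate R u).hasDerivWithinAt hb
  rw [h0] at h1
  simp only [functionalJ_translate] at h1
  exact (hasDerivWithinAt_univ.1 h1).unique (hasDerivAt_const 0 (functionalJ F v))

/-- The derivative `u^p` of the flux is bounded on bounded sets because `p > 0`; this gives the
local Lipschitz bound by the mean value inequality. -/
theorem isPrimitive_oddPow {k m : ℕ} (hk : 0 < k) (hm : Odd m) :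
    IsPrimitive (fun x => oddPow (k + m) m x / ((k : ℝ) / m + 1))
      (fun x => oddPow (k + 2 * m) m x / (((k : ℝ) / m + 1) * ((k : ℝ) / m + 2))) := by
  have hm' : (0 : ℝ) < m := by exact_mod_cast hm.pos
  have hk' : (0 : ℝ) < k := by exact_mod_cast hk
  have hp : 0 < (k : ℝ) / m := by positivity
  refine ⟨fun x => ?_, ?_, ?_, fun K => ⟨|K| ^ ((k : ℝ) / m), by positivity, fun a b ha hb => ?_⟩⟩
  · have h := (hasDerivAt_oddPow (j := k + m) (by omega) hm x).div_const
      (((k : ℝ) / m + 1) * ((k : ℝ) / m + 2))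
    have e : k + m + m = k + 2 * m := by ring
    rw [e] at h
    refine h.congr_deriv ?_
    have e2 : ((k + m : ℕ) : ℝ) / m + 1 = (k : ℝ) / m + 2 := by push_cast; field_simp; ring
    rw [e2]
    field_simp
  · rw [oddPow_zero (by omega), zero_div]
  · rw [oddPow_zero (by omega), zero_div]
  · have hK : ∀ x, |x| ≤ K → |oddPow k m x| ≤ |K| ^ ((k : ℝ) / m) := fun x hx => by
      rw [abs_oddPow hk hm.pos]
      exact Real.rpow_le_rpow (abs_nonneg x) (hx.trans (le_abs_self K)) hp.le
    have hd : ∀ x ∈ Set.Icc (-K) K, HasDerivWithinAt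
        (fun x => oddPow (k + m) m x / ((k : ℝ) / m + 1)) (oddPow k m x) (Set.Icc (-K) K) x := by
      intro x _
      refine ((hasDerivAt_oddPow hk hm x).div_const _).hasDerivWithinAt.congr_deriv ?_
      field_simp
    exact (convex_Icc (-K) K).norm_image_sub_le_of_norm_hasDerivWithin_le hd
      (fun x hx => hK x (abs_le.2 hx)) (abs_le.1 hb) (abs_le.1 ha)

/-! ### The equation and its cancellations on the Fourier side -/

theorem fourier_hilbert (u : L2) :
    (𝓕 (hilbert u) : CL2) =ᵐ[volume] fun ξ => hilbertSymbol ξ * fourierL2 u ξ := by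
  have h : (𝓕 (hilbert u) : CL2) = (memLp_hilbertSymbol_mul (fourierL2 u)).toLp _ :=
    (Lp.fourierTransformₗᵢ Plane ℂ).apply_symm_apply _
  rw [h]
  exact MemLp.coeFn_toLp _

theorem exists_lineDerivOp_fourier_eq (ψ : 𝓢(Plane, ℂ)) (a : Plane) :
    ∃ η : 𝓢(Plane, ℂ), ∂_{a} (𝓕 ψ) = 𝓕 η ∧
      ∀ ξ, η ξ = -(2 * Real.pi * Complex.I) * ((inner ℝ ξ a : ℝ) : ℂ) * ψ ξ := by
  refine ⟨_, SchwartzMap.lineDerivOp_fourier_eq ψ a, fun ξ => ?_⟩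
  rw [smul_apply, SchwartzMap.smulLeftCLM_apply_apply (Function.hasTemperateGrowth_inner_left a)]
  simp [mul_assoc]

theorem integrable_mul_schwartz (G : CL2) (ψ : 𝓢(Plane, ℂ)) : Integrable fun ξ => G ξ * ψ ξ :=
  (Lp.memLp G).integrable_mul (ψ.memLp 2)

/-- The symbol `|2πξ₀| + (2πξ₁)²` as a complex multiplier. -/
def wtZero (ξ : Plane) : ℂ := ((wt 0 ξ : ℝ) : ℂ)

theorem measurable_wtZero : Measurable wtZero :=
  Complex.measurable_ofReal.comp (continuous_wt 0).measurable

theorem norm_wtZero_le {s : ℝ} (hs : 2 ≤ s) (ξ : Plane) : ‖wtZero ξ‖ ≤ 1 * ‖jbPow s ξ‖ := by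
  rw [wtZero, Complex.norm_real, Real.norm_of_nonneg (le_wt 0 ξ), norm_jbPow, one_mul]
  refine (wt_zero_le_jb ξ).trans ?_
  calc jb ξ = jb ξ ^ (1 : ℝ) := (Real.rpow_one _).symm
    _ ≤ _ := Real.rpow_le_rpow_of_exponent_le (one_le_jb ξ) (by linarith)

theorem memMul_wtZero {s : ℝ} (hs : 2 ≤ s) {F : CL2} (hF : MemMul (jbPow s) F) :
    MemMul wtZero F :=
  hF.of_le measurable_wtZero (norm_wtZero_le hs)

/-- The transform of the variational derivative `𝓗uₓ - u_yy - f(u)` of the energy. -/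
def gradHat (f : ℝ → ℝ) (u : L2) : CL2 := mulFn wtZero (fourierL2 u) - fourierL2 (compL2 f u)

/-- The linear part of the equation on the Fourier side. -/
theorem integral_linear_part (u : L2) (ψ : 𝓢(Plane, ℂ)) (hu : MemMul wtZero (fourierL2 u)) :
    (∫ x, hilbert u x * (∂_{ex} (∂_{ex} (𝓕 ψ : 𝓢(Plane, ℂ)))) x) +
      (∫ x, (u x : ℂ) * (∂_{ex} (∂_{ey} (∂_{ey} (𝓕 ψ : 𝓢(Plane, ℂ))))) x) =
      ∫ ξ, Complex.I * ((2 * Real.pi * ξ 0 : ℝ) : ℂ) * mulFn wtZero (fourierL2 u) ξ * ψ ξ := by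
  obtain ⟨η₁, h₁, e₁⟩ := exists_lineDerivOp_fourier_eq ψ ex
  obtain ⟨η₂, h₂, e₂⟩ := exists_lineDerivOp_fourier_eq η₁ ex
  obtain ⟨ζ₁, j₁, f₁⟩ := exists_lineDerivOp_fourier_eq ψ ey
  obtain ⟨ζ₂, j₂, f₂⟩ := exists_lineDerivOp_fourier_eq ζ₁ ey
  obtain ⟨ζ₃, j₃, f₃⟩ := exists_lineDerivOp_fourier_eq ζ₂ ex
  rw [h₁, h₂, j₁, j₂, j₃, ← integral_fourier_mul, ← integral_fourierL2_mul,
    ← integral_add (integrable_mul_schwartz _ _) (integrable_mul_schwartz _ _)]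
  refine integral_congr_ae ?_
  filter_upwards [fourier_hilbert u, coeFn_mulFn hu] with ξ g₁ g₂
  rw [g₁, g₂, e₂, e₁, f₃, f₂, f₁, inner_ex, inner_ey, hilbertSymbol, wtZero, wt]
  have habs : ((|2 * Real.pi * ξ 0| : ℝ) : ℂ) =
      (Real.sign (ξ 0) : ℂ) * ((2 * Real.pi * ξ 0 : ℝ) : ℂ) := by
    rw [← Complex.ofReal_mul]
    congr 1
    rcases lt_trichotomy (ξ 0) 0 with h | h | h
    · rw [Real.sign_of_neg h, abs_of_neg (mul_neg_of_pos_of_neg (by positivity) h)]; ring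
    · simp [h]
    · rw [Real.sign_of_pos h, abs_of_pos (by positivity)]; ring
  push_cast [habs]
  linear_combination (4 * Real.pi ^ 2 * Complex.I * (ξ 0 : ℂ) * fourierL2 u ξ * ψ ξ * 2 * Real.pi *
    (ξ 1) ^ 2 + 4 * Real.pi ^ 2 * Complex.I * (ξ 0 : ℂ) ^ 2 * (Real.sign (ξ 0) : ℂ) *
      fourierL2 u ξ * ψ ξ) * (-1 : ℂ) * Complex.I_sq

/-- A weakly differentiable path with continuous derivative is differentiable. -/
theorem hasDerivWithinAt_of_weak {b : ℝ} (hb : 0 ≤ b) {V V' : ℝ → CL2}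
    (hc : ContinuousOn V' (Set.Icc 0 b))
    (h : ∀ t ∈ Set.Icc 0 b, ∀ ψ : 𝓢(Plane, ℂ),
      HasDerivWithinAt (fun τ => ∫ ξ, V τ ξ * ψ ξ) (∫ ξ, V' t ξ * ψ ξ) (Set.Icc 0 b) t) :
    ∀ t ∈ Set.Icc 0 b, HasDerivWithinAt V (V' t) (Set.Icc 0 b) t := by
  let W : ℝ → CL2 := Set.IccExtend hb ((Set.Icc 0 b).domRestrict V')
  have hW : Continuous W := (continuousOn_iff_continuous_domRestrict.1 hc).Icc_extend'
  have hWV : ∀ t ∈ Set.Icc 0 b, W t = V' t := fun t ht => Set.IccExtend_of_mem hb _ ht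
  -- The integral of the weak derivative. Every pairing of `V - Y` with a test function has
  -- derivative zero and vanishes at `0`, so the two paths agree.
  let Y : ℝ → CL2 := fun t => V 0 + ∫ σ in (0 : ℝ)..t, W σ
  have hY : ∀ t, HasDerivAt Y (W t) t := fun t =>
    ((hW.integral_hasStrictDerivAt 0 t).hasDerivAt).const_add (V 0)
  have hVY : ∀ t ∈ Set.Icc 0 b, V t = Y t := by
    intro t ht
    refine eq_of_integral_mul_schwartz fun ψ => ?_
    have hl : ∀ G : CL2, ∫ ξ, G ξ * ψ ξ =
        inner ℂ (((conjSchwartz ψ).memLp 2 volume).toLp _ : CL2) G := fun G => by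
      rw [L2.inner_def]
      refine integral_congr_ae ?_
      filter_upwards [((conjSchwartz ψ).memLp 2 (volume : Measure Plane)).coeFn_toLp] with ξ hξ
      rw [hξ, conjSchwartz_apply, RCLike.inner_apply]
      simp
    set c : CL2 := ((conjSchwartz ψ).memLp 2 volume).toLp _
    have hd : ∀ σ ∈ Set.Icc 0 b, HasDerivWithinAt (fun τ => (inner ℂ c (V τ) : ℂ) - inner ℂ c (Y τ))
        0 (Set.Icc 0 b) σ := by
      intro σ hσ
      have h1 := h σ hσ ψ
      simp only [hl] at h1
      have h2 := (hasDerivWithinAt_const σ (Set.Icc 0 b) c).inner ℂ (hY σ).hasDerivWithinAt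
      rw [inner_zero_left, add_zero, hWV σ hσ] at h2
      have h3 := h1.sub h2
      rw [sub_self] at h3
      exact h3
    have h4 := (convex_Icc 0 b).norm_image_sub_le_of_norm_hasDerivWithin_le (C := 0) hd
      (fun σ _ => norm_zero.le) (Set.left_mem_Icc.2 hb) ht
    have h0 : Y 0 = V 0 := by simp [Y]
    rw [h0, sub_self, sub_zero, zero_mul, norm_le_zero_iff, sub_eq_zero] at h4
    rw [hl, hl, h4]
  intro t ht
  rw [← hWV t ht]
  exact (hY t).hasDerivWithinAt.congr_of_mem hVY ht

theorem re_inner_eq_integral (G H : CL2) :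
    (inner ℂ G H : ℂ).re = ∫ ξ, ((starRingEnd ℂ) (G ξ) * H ξ).re := by
  rw [L2.inner_def]
  have h := Complex.reCLM.integral_comp_comm (L2.integrable_inner (𝕜 := ℂ) G H)
  rw [Complex.reCLM_apply] at h
  rw [← h]
  refine integral_congr_ae (Eventually.of_forall fun ξ => ?_)
  simp only [Complex.reCLM_apply, RCLike.inner_apply]
  rw [mul_comm]

theorem re_inner_congr {G H G' H' : CL2}
    (h : ∀ᵐ ξ, ((starRingEnd ℂ) (G ξ) * H ξ).re = ((starRingEnd ℂ) (G' ξ) * H' ξ).re) :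
    (inner ℂ G H : ℂ).re = (inner ℂ G' H' : ℂ).re := by
  rw [re_inner_eq_integral, re_inner_eq_integral]
  exact integral_congr_ae h

theorem coeFn_gradHat {f : ℝ → ℝ} {u : L2} (hu : MemMul wtZero (fourierL2 u)) :
    gradHat f u =ᵐ[volume]
      fun ξ => ((wt 0 ξ : ℝ) : ℂ) * fourierL2 u ξ - fourierL2 (compL2 f u) ξ := by
  filter_upwards [coeFn_mulFn hu,
    Lp.coeFn_sub (mulFn wtZero (fourierL2 u)) (fourierL2 (compL2 f u))] with ξ h1 h2
  rw [gradHat, h2, Pi.sub_apply, h1, wtZero]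

theorem re_conj_mul_I (z : ℂ) (a : ℝ) : ((starRingEnd ℂ) z * (Complex.I * (a : ℂ) * z)).re = 0 := by
  simp
  ring

/-- The rate of change of the truncated mass. -/
theorem re_inner_mass {f F : ℝ → ℝ} (hf : IsPrimitive f F) {R K : ℝ} {u : L2}
    (hu : MemMul wtZero (fourierL2 u)) (hv : ∀ᵐ x, |truncate R u x| ≤ K) :
    (inner ℂ (fourierL2 (truncate R u)) (mulFn (dxCut R) (gradHat f u)) : ℂ).re =
      (inner ℂ (mulFn (dxCut R) (fourierL2 (truncate R u)))
        (fourierL2 (compL2 f u) - fourierL2 (compL2 f (truncate R u))) : ℂ).re := by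
  -- The linear part drops out: its symbol is a real weight times an imaginary one. In the nonlinear
  -- part the minus sign of the gradient is absorbed by the skew symmetry of `∂ₓ`.
  have h1 : (inner ℂ (fourierL2 (truncate R u)) (mulFn (dxCut R) (gradHat f u)) : ℂ).re =
      (inner ℂ (mulFn (dxCut R) (fourierL2 (truncate R u))) (fourierL2 (compL2 f u)) : ℂ).re := by
    refine re_inner_congr ?_
    rw [fourierL2_truncate]
    filter_upwards [coeFn_gradHat (f := f) hu, coeFn_mulFn (memMul_ballCut R (fourierL2 u)),
      coeFn_mulFn (memMul_dxCut R (gradHat f u)),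
      coeFn_mulFn (memMul_dxCut R (mulFn (ballCut R) (fourierL2 u)))] with ξ g1 g2 g3 g4
    rw [g3, g4, g1, g2, dxCut, ballCut]
    split_ifs
    · simp
      ring
    · simp
  rw [h1, inner_sub_right, Complex.sub_re]
  have h2 := hf.re_inner_dxCut_eq_zero hv
  rw [← inner_conj_symm, Complex.conj_re] at h2
  rw [h2, sub_zero]

theorem measurable_sqwt_ballCut (R : ℝ) : Measurable fun ξ => sqwt 0 ξ * ballCut R ξ :=
  (measurable_sqwt 0).mul (measurable_ballCut R)

theorem norm_sqwt_ballCut_le (R : ℝ) (ξ : Plane) : ‖sqwt 0 ξ * ballCut R ξ‖ ≤ √R := by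
  refine norm_mul_ballCut_le (Real.sqrt_nonneg R) (fun ξ h => Real.le_sqrt_of_sq_le ?_) ξ
  rw [norm_sqwt_sq le_rfl]
  exact (wt_zero_le_jb ξ).trans h

theorem memMul_sqwt_ballCut (R : ℝ) (G : CL2) : MemMul (fun ξ => sqwt 0 ξ * ballCut R ξ) G :=
  memMul_of_bound (measurable_sqwt_ballCut R) (norm_sqwt_ballCut_le R) G

theorem zLift_truncate (R : ℝ) {u : L2} (hu : MemZ u) :
    zLift 0 (truncate R u) =
      mulFn (fun ξ => sqwt 0 ξ * ballCut R ξ) (fourierL2 (truncate R u)) := by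
  refine Lp.ext ?_
  filter_upwards [coeFn_mulFn ((hu.truncate R).memMul le_rfl),
    coeFn_mulFn (memMul_sqwt_ballCut R (fourierL2 (truncate R u))),
    coeFn_mulFn (memMul_ballCut R (fourierL2 u))] with ξ h1 h2 h3
  rw [zLift, h1, h2, fourierL2_truncate, h3, ballCut]
  split_ifs <;> simp

/-- The rate of change of the truncated quadratic part of the energy. -/
theorem re_inner_energy {f : ℝ → ℝ} {R : ℝ} {u : L2} (hu : MemMul wtZero (fourierL2 u)) :
    (inner ℂ (mulFn (fun ξ => sqwt 0 ξ * ballCut R ξ) (fourierL2 (truncate R u)))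
      (mulFn (fun ξ => sqwt 0 ξ * ballCut R ξ) (mulFn (dxCut R) (gradHat f u))) : ℂ).re =
      (inner ℂ (fourierL2 (compL2 f u)) (mulFn (dxCut R) (gradHat f u)) : ℂ).re := by
  refine re_inner_congr ?_
  filter_upwards [coeFn_gradHat (f := f) hu, coeFn_mulFn (memMul_ballCut R (fourierL2 u)),
    coeFn_mulFn (memMul_dxCut R (gradHat f u)),
    coeFn_mulFn (memMul_sqwt_ballCut R (fourierL2 (truncate R u))),
    coeFn_mulFn (memMul_sqwt_ballCut R (mulFn (dxCut R) (gradHat f u)))] with ξ g1 g2 g3 g4 g5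
  rw [g5, g4, g3, fourierL2_truncate, g2, dxCut, ballCut]
  split_ifs
  · have hs : sqwt 0 ξ * sqwt 0 ξ = ((wt 0 ξ : ℝ) : ℂ) := by
      rw [sqwt, ← Complex.ofReal_mul, Real.mul_self_sqrt (le_wt 0 ξ)]
    have hc : (starRingEnd ℂ) (sqwt 0 ξ) = sqwt 0 ξ := Complex.conj_ofReal _
    -- The weighted transform is the gradient plus the transform of `f(u)`; the gradient paired with
    -- its own `x`-derivative has no real part.
    have hw : ((wt 0 ξ : ℝ) : ℂ) * (starRingEnd ℂ) (fourierL2 u ξ) =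
        (starRingEnd ℂ) (gradHat f u ξ) + (starRingEnd ℂ) (fourierL2 (compL2 f u) ξ) := by
      rw [g1, ← map_add, sub_add_cancel, map_mul, Complex.conj_ofReal]
    have h0 := re_conj_mul_I (gradHat f u ξ) (2 * Real.pi * ξ 0)
    simp only [mul_one, one_mul, map_mul, hc]
    rw [show sqwt 0 ξ * (starRingEnd ℂ) (fourierL2 u ξ) *
        (sqwt 0 ξ * (Complex.I * ((2 * Real.pi * ξ 0 : ℝ) : ℂ) * gradHat f u ξ)) =
        (sqwt 0 ξ * sqwt 0 ξ) * (starRingEnd ℂ) (fourierL2 u ξ) *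
          (Complex.I * ((2 * Real.pi * ξ 0 : ℝ) : ℂ) * gradHat f u ξ) by ring, hs, hw, add_mul,
      Complex.add_re, h0, zero_add]
  · simp

theorem norm_zLift_zero_le {u : L2} (hu : MemZ u) : ‖zLift 0 u‖ ≤ ‖zLift 1 u‖ := by
  have h := norm_mulFn_le_mulFn (hu.memMul zero_le_one) (hu.memMul le_rfl) (C := 1) fun ξ => by
    rw [one_mul]
    refine abs_le_of_sq_le_sq' ?_ (norm_nonneg _) |>.2
    rw [norm_sqwt_sq le_rfl, norm_sqwt_sq zero_le_one, wt, wt]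
    linarith
  rwa [one_mul] at h

theorem energyE_eq_zLift {k m : ℕ} {u : L2} (hu : MemZ u) :
    energyE k m u = (1 / 2) * ‖zLift 0 u‖ ^ 2 -
      functionalJ (fun x => oddPow (k + 2 * m) m x / (((k : ℝ) / m + 1) * ((k : ℝ) / m + 2))) u := by
  rw [energyE, norm_zLift_sq le_rfl hu, energyI, functionalJ, integral_div, energyJ]
  ring

/-- The energy is uniformly continuous on bounded sets of the energy space. -/
theorem tendsto_energyE_sub {k m : ℕ} (hk : 0 < k) (hm : Odd m) (hp : (k : ℝ) / m < 4 / 3)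
    {φ v : ℕ → L2} {K : ℝ} (hφ : ∀ n, MemZ (φ n)) (hv : ∀ n, MemZ (v n))
    (hK : ∀ n, ‖zLift 1 (φ n)‖ ≤ K)
    (h : Tendsto (fun n => ‖zLift 1 (v n - φ n)‖) atTop (𝓝 0)) :
    Tendsto (fun n => energyE k m (v n) - energyE k m (φ n)) atTop (𝓝 0) := by
  have hm' : (0 : ℝ) < m := by exact_mod_cast hm.pos
  have hk' : (0 : ℝ) < k := by exact_mod_cast hk
  have hp0 : 0 < (k : ℝ) / m := by positivity
  have hJ : Tendsto (fun n => energyJ k m (v n) - energyJ k m (φ n)) atTop (𝓝 0) := by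
    rw [Metric.tendsto_atTop]
    intro ε hε
    obtain ⟨δ, hδ, hd⟩ := (isPower_oddPow hk hm).exists_abs_functionalJ_add_sub_le (by linarith)
      (by linarith) K (half_pos hε)
    obtain ⟨N, hN⟩ := eventually_atTop.1 (h.eventually_le_const hδ)
    refine ⟨N, fun n hn => ?_⟩
    have := hd (φ n) (v n - φ n) (hφ n) ((hv n).sub (hφ n)) (hK n) (hN n hn)
    rw [add_sub_cancel] at this
    rw [Real.dist_eq, sub_zero, energyJ_eq, energyJ_eq]
    linarith
  have hQ : Tendsto (fun n => ‖zLift 0 (v n)‖ ^ 2 - ‖zLift 0 (φ n)‖ ^ 2) atTop (𝓝 0) := by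
    have h2 : Tendsto (fun n => ‖zLift 1 (v n - φ n)‖ * (‖zLift 1 (v n - φ n)‖ + 2 * K)) atTop
        (𝓝 0) := by
      have := h.mul (h.add_const (2 * K))
      rwa [zero_mul] at this
    refine squeeze_zero_norm (fun n => ?_) h2
    have h3 : ‖zLift 0 (v n) - zLift 0 (φ n)‖ ≤ ‖zLift 1 (v n - φ n)‖ := by
      rw [← zLift_sub le_rfl (hv n) (hφ n)]
      exact norm_zLift_zero_le ((hv n).sub (hφ n))
    have h4 := norm_sub_norm_le (zLift 0 (v n)) (zLift 0 (φ n))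
    have h5 := abs_norm_sub_norm_le (zLift 0 (v n)) (zLift 0 (φ n))
    have h6 := (norm_zLift_zero_le (hφ n)).trans (hK n)
    rw [sq_sub_sq, Real.norm_eq_abs, abs_mul, mul_comm, abs_of_nonneg (a := _ + _) (by positivity)]
    exact mul_le_mul (h5.trans h3) (by linarith) (by positivity) (by positivity)
  have := (hQ.const_mul (1 / 2)).sub (hJ.div_const (((k : ℝ) / m + 1) * ((k : ℝ) / m + 2)))
  rw [mul_zero, zero_div, sub_zero] at this
  refine this.congr fun n => ?_
  rw [norm_zLift_sq le_rfl (hv n), norm_zLift_sq le_rfl (hφ n), energyE, energyE, energyI, energyI]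
  ring

/-- The primitive of `u^p uₓ` in the equation. -/
abbrev flux (k m : ℕ) (x : ℝ) : ℝ := oddPow (k + m) m x / ((k : ℝ) / m + 1)

theorem integral_flux_part (G : CL2) {ψ η : 𝓢(Plane, ℂ)}
    (hη : ∀ ξ, η ξ = -(2 * Real.pi * Complex.I) * ((inner ℝ ξ ex : ℝ) : ℂ) * ψ ξ) :
    ∫ ξ, Complex.I * ((2 * Real.pi * ξ 0 : ℝ) : ℂ) * G ξ * ψ ξ = -∫ ξ, G ξ * η ξ := by
  rw [← integral_neg]
  refine integral_congr_ae (Eventually.of_forall fun ξ => ?_)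
  simp only [hη, inner_ex]
  push_cast
  ring

/-! ### Regularity in time of truncated solutions -/

section Solution

variable {k m : ℕ} {s : ℝ} {T : EReal} {u : ℝ → L2}

theorem IsSolution.memMul_jbPow (h : IsSolution k m (-1) 1 s T u) {t : ℝ} (h0 : 0 ≤ t)
    (hT : (t : EReal) < T) : MemMul (jbPow s) (fourierL2 (u t)) :=
  (hsNorm_lt_top_iff s (u t)).1 (h.memHs t h0 hT)

theorem IsSolution.continuousOn_hsLift (h : IsSolution k m (-1) 1 s T u) {b : ℝ}
    (hb : (b : EReal) < T) : ContinuousOn (fun τ => hsLift s (u τ)) (Set.Icc 0 b) := by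
  intro t ht
  have hlt : ∀ τ ∈ Set.Icc 0 b, (τ : EReal) < T := fun τ hτ =>
    (EReal.coe_le_coe_iff.2 hτ.2).trans_lt hb
  rw [ContinuousWithinAt, tendsto_iff_edist_tendsto_0]
  refine ((h.continuous t ht.1 (hlt t ht)).mono_left
    (nhdsWithin_mono t Set.Icc_subset_Ici_self)).congr' ?_
  filter_upwards [self_mem_nhdsWithin] with τ hτ
  have h1 := h.memMul_jbPow hτ.1 (hlt τ hτ)
  have h2 := h.memMul_jbPow ht.1 (hlt t ht)
  rw [edist_eq_enorm_sub, ← hsLift_sub h1 h2, hsNorm_eq]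
  rw [fourierL2_sub]
  exact h1.sub h2

/-- The equation tested with `𝓕 ψ`. Its three terms combine into the Hamiltonian form `u_t = ∂ₓ(𝓗uₓ
- u_yy - f(u))`. -/
theorem IsSolution.hasDerivWithinAt_fourier (h : IsSolution k m (-1) 1 s T u) (hs : 2 ≤ s) {t : ℝ}
    (h0 : 0 ≤ t) (hT : (t : EReal) < T)
    (hf : compL2 (flux k m) (u t) =ᵐ[volume] fun x => flux k m (u t x)) (ψ : 𝓢(Plane, ℂ)) :
    HasDerivWithinAt (fun τ => ∫ ξ, fourierL2 (u τ) ξ * ψ ξ)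
      (∫ ξ, Complex.I * ((2 * Real.pi * ξ 0 : ℝ) : ℂ) * gradHat (flux k m) (u t) ξ * ψ ξ)
      (Set.Ici 0) t := by
  have hwt := memMul_wtZero hs (h.memMul_jbPow h0 hT)
  have he := h.equation t h0 hT (𝓕 ψ)
  simp only [← integral_fourierL2_mul] at he
  refine he.congr_deriv ?_
  have hlin := integral_linear_part (u t) ψ hwt
  obtain ⟨η, h₁, e₁⟩ := exists_lineDerivOp_fourier_eq ψ ex
  rw [integral_flux_part _ e₁] at hlin ⊢
  have hfl : ∫ x, ((oddPow (k + m) m (u t x) / ((k : ℝ) / m + 1) : ℝ) : ℂ) *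
      (∂_{ex} (𝓕 ψ : 𝓢(Plane, ℂ))) x = ∫ ξ, fourierL2 (compL2 (flux k m) (u t)) ξ * η ξ := by
    rw [h₁, integral_fourierL2_mul]
    refine integral_congr_ae ?_
    filter_upwards [hf] with x hx
    rw [hx]
  have hg : ∫ ξ, gradHat (flux k m) (u t) ξ * η ξ =
      (∫ ξ, mulFn wtZero (fourierL2 (u t)) ξ * η ξ) -
        ∫ ξ, fourierL2 (compL2 (flux k m) (u t)) ξ * η ξ := by
    rw [← integral_sub (integrable_mul_schwartz _ _) (integrable_mul_schwartz _ _)]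
    refine integral_congr_ae ?_
    filter_upwards [Lp.coeFn_sub (mulFn wtZero (fourierL2 (u t)))
      (fourierL2 (compL2 (flux k m) (u t)))] with ξ hξ
    rw [gradHat, hξ, Pi.sub_apply, sub_mul]
  rw [hfl, hg]
  push_cast
  linear_combination hlin

/-- Uniform bounds for a solution on a compact time interval. -/
theorem IsSolution.exists_bound (h : IsSolution k m (-1) 1 s T u) (hs : 2 < s) {b : ℝ}
    (hb : (b : EReal) < T) :
    ∃ B K : ℝ, 0 ≤ B ∧ ∀ τ ∈ Set.Icc 0 b, ‖hsLift s (u τ)‖ ≤ B ∧ (∀ᵐ x, |u τ x| ≤ K) ∧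
      ∀ R, ∀ᵐ x, |truncate R (u τ) x| ≤ K := by
  have hlt : ∀ τ ∈ Set.Icc 0 b, (τ : EReal) < T := fun τ hτ =>
    (EReal.coe_le_coe_iff.2 hτ.2).trans_lt hb
  obtain ⟨B, hB⟩ := isCompact_Icc.exists_bound_of_continuousOn (h.continuousOn_hsLift hb)
  obtain ⟨C, hC, hCu⟩ := exists_abs_le_norm_hsLift (s := s) (by linarith)
  refine ⟨max B 0, C * max B 0, le_max_right _ _, fun τ hτ => ?_⟩
  have hB' : ‖hsLift s (u τ)‖ ≤ max B 0 := (hB τ hτ).trans (le_max_left _ _)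
  have hmem := h.memMul_jbPow hτ.1 (hlt τ hτ)
  refine ⟨hB', ?_, fun R => ?_⟩
  · filter_upwards [hCu _ hmem] with x hx
    exact hx.trans (by gcongr)
  · filter_upwards [hCu _ (memMul_truncate (measurable_jbPow s) hmem R)] with x hx
    refine hx.trans ?_
    gcongr
    exact (norm_mulFn_truncate_le (measurable_jbPow s) hmem R).trans hB'

/-- For `s ≥ 2` the `H^s` weight dominates the symbol of the linear part, and `H^s ⊂ L^∞` makes the
flux Lipschitz in `L²` along the solution. -/
theorem IsSolution.continuousOn_gradHat (h : IsSolution k m (-1) 1 s T u) (hs : 2 < s) (hk : 0 < k)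
    (hm : Odd m) {b : ℝ} (hb : (b : EReal) < T) :
    ContinuousOn (fun τ => gradHat (flux k m) (u τ)) (Set.Icc 0 b) := by
  have hf := isPrimitive_oddPow hk hm
  have hlt : ∀ τ ∈ Set.Icc 0 b, (τ : EReal) < T := fun τ hτ =>
    (EReal.coe_le_coe_iff.2 hτ.2).trans_lt hb
  obtain ⟨B, K, hB0, hB⟩ := h.exists_bound hs hb
  obtain ⟨C, hC, hL⟩ := hf.lipschitz K
  intro t ht
  have hc := h.continuousOn_hsLift hb t ht
  rw [ContinuousWithinAt, tendsto_iff_norm_sub_tendsto_zero] at hc ⊢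
  have h1 := hc.const_mul (1 + C)
  rw [mul_zero] at h1
  refine squeeze_zero' (Eventually.of_forall fun τ => norm_nonneg _) ?_ h1
  filter_upwards [self_mem_nhdsWithin] with τ hτ
  have g1 := h.memMul_jbPow hτ.1 (hlt τ hτ)
  have g2 := h.memMul_jbPow ht.1 (hlt t ht)
  have g3 : MemMul (jbPow s) (fourierL2 (u τ - u t)) := by
    rw [fourierL2_sub]; exact g1.sub g2
  have e : gradHat (flux k m) (u τ) - gradHat (flux k m) (u t) =
      mulFn wtZero (fourierL2 (u τ - u t)) -
        fourierL2 (compL2 (flux k m) (u τ) - compL2 (flux k m) (u t)) := by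
    rw [gradHat, gradHat, fourierL2_sub, fourierL2_sub,
      mulFn_sub (memMul_wtZero hs.le g1) (memMul_wtZero hs.le g2)]
    abel
  rw [e, ← hsLift_sub g1 g2, add_mul]
  refine (norm_sub_le _ _).trans (add_le_add ?_ ?_)
  · exact norm_mulFn_le_mulFn g3 (memMul_wtZero hs.le g3) (norm_wtZero_le hs.le)
  · rw [norm_fourierL2]
    refine (hf.norm_compL2_sub_le hL (hB τ hτ).2.1 (hB t ht).2.1).trans ?_
    gcongr
    exact norm_le_norm_hsLift (by linarith) g3

/-- Truncations of a solution are differentiable in time. -/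
theorem IsSolution.hasDerivWithinAt_truncate (h : IsSolution k m (-1) 1 s T u) (hs : 2 < s)
    (hk : 0 < k) (hm : Odd m) {b : ℝ} (hb0 : 0 ≤ b) (hb : (b : EReal) < T) (R : ℝ) :
    ∀ t ∈ Set.Icc 0 b, HasDerivWithinAt (fun τ => fourierL2 (truncate R (u τ)))
      (mulFn (dxCut R) (gradHat (flux k m) (u t))) (Set.Icc 0 b) t := by
  have hf := isPrimitive_oddPow hk hm
  have hlt : ∀ τ ∈ Set.Icc 0 b, (τ : EReal) < T := fun τ hτ =>
    (EReal.coe_le_coe_iff.2 hτ.2).trans_lt hb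
  obtain ⟨B, K, hB0, hB⟩ := h.exists_bound hs hb
  obtain ⟨C, hC, hL⟩ := hf.lipschitz K
  -- The sharp cutoff does not preserve Schwartz functions, so the weak equation is first localized
  -- by a smooth cutoff equal to `1` where `jb ξ ≤ R`; the sharp cutoff is applied afterwards as a
  -- bounded operator.
  let χ : ContDiffBump (0 : Plane) := ⟨√R + 1, √R + 2, by positivity, by linarith⟩
  let g : Plane → ℂ := fun ξ => ((χ ξ : ℝ) : ℂ)
  have hgs : ContDiff ℝ (↑(⊤ : ℕ∞)) g := Complex.ofRealCLM.contDiff.comp χ.contDiff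
  have hgc : HasCompactSupport g := χ.hasCompactSupport.comp_left Complex.ofReal_zero
  let g' : Plane → ℂ := fun ξ => g ξ * (Complex.I * ((2 * Real.pi * ξ 0 : ℝ) : ℂ))
  have hg'c : Continuous g' := by
    have : Continuous fun ξ : Plane => Complex.I * ((2 * Real.pi * ξ 0 : ℝ) : ℂ) := by fun_prop
    exact hgs.continuous.mul this
  have hg's : HasCompactSupport g' := hgc.mul_right
  obtain ⟨A, hA⟩ := hgc.exists_bound_of_continuous hgs.continuous
  obtain ⟨A', hA'⟩ := hg's.exists_bound_of_continuous hg'c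
  have hgone : ∀ ξ, jb ξ ≤ R → g ξ = 1 := fun ξ hξ => by
    have h1 : χ ξ = 1 := by
      refine χ.one_of_mem_closedBall ?_
      rw [mem_closedBall_zero_iff]
      have h2 : ‖ξ‖ ≤ √R := by
        refine Real.le_sqrt_of_sq_le ?_
        rw [jb, norm_smul, Real.norm_of_nonneg (by positivity), mul_pow] at hξ
        have h1 : 1 ≤ (2 * Real.pi) ^ 2 := by nlinarith [Real.pi_gt_three]
        nlinarith [sq_nonneg ‖ξ‖]
      exact h2.trans (by linarith)
    simp [g, h1]
  have hm1 : ∀ G, MemMul g G := memMul_of_bound hgs.continuous.measurable hA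
  have hm2 : ∀ G, MemMul g' G := memMul_of_bound hg'c.measurable hA'
  have key := hasDerivWithinAt_of_weak hb0 (V := fun τ => mulFn g (fourierL2 (u τ)))
    (V' := fun τ => mulFn g' (gradHat (flux k m) (u τ)))
    ((continuous_mulFn hg'c.measurable hA').comp_continuousOn (h.continuousOn_gradHat hs hk hm hb))
    (fun t ht ψ => by
      let ρ : 𝓢(Plane, ℂ) := (hgc.mul_right (f' := ψ)).toSchwartzMap (hgs.mul (ψ.smooth ⊤))
      have hρ : ∀ ξ, ρ ξ = g ξ * ψ ξ := fun ξ => rfl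
      have h1 := (h.hasDerivWithinAt_fourier hs.le ht.1 (hlt t ht)
        (hf.coeFn_compL2 hL (hB t ht).2.1) ρ).mono
          (Set.Icc_subset_Ici_self : Set.Icc 0 b ⊆ Set.Ici 0)
      have e1 : ∀ τ, ∫ ξ, mulFn g (fourierL2 (u τ)) ξ * ψ ξ = ∫ ξ, fourierL2 (u τ) ξ * ρ ξ := by
        intro τ
        refine integral_congr_ae ?_
        filter_upwards [coeFn_mulFn (hm1 (fourierL2 (u τ)))] with ξ hξ
        rw [hξ, hρ]
        ring
      simp only [e1]
      refine h1.congr_deriv ?_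
      refine integral_congr_ae ?_
      filter_upwards [coeFn_mulFn (hm2 (gradHat (flux k m) (u t)))] with ξ hξ
      rw [hξ, hρ]
      simp only [g']
      ring)
  intro t ht
  have h2 := hasDerivWithinAt_mulFn (measurable_ballCut R) (norm_ballCut_le R) (key t ht)
  have e1 : ∀ τ, mulFn (ballCut R) (mulFn g (fourierL2 (u τ))) = fourierL2 (truncate R (u τ)) := by
    intro τ
    refine Lp.ext ?_
    rw [fourierL2_truncate]
    filter_upwards [coeFn_mulFn (hm1 (fourierL2 (u τ))),
      coeFn_mulFn (memMul_ballCut R (fourierL2 (u τ))),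
      coeFn_mulFn (memMul_ballCut R (mulFn g (fourierL2 (u τ))))] with ξ g1 g2 g3
    rw [g3, g1, g2, ballCut]
    split_ifs with hR
    · rw [hgone ξ hR, one_mul]
    · simp
  simp only [e1] at h2
  refine h2.congr_deriv (Lp.ext ?_)
  filter_upwards [coeFn_mulFn (hm2 (gradHat (flux k m) (u t))),
    coeFn_mulFn (memMul_dxCut R (gradHat (flux k m) (u t))),
    coeFn_mulFn (memMul_ballCut R (mulFn g' (gradHat (flux k m) (u t))))] with ξ g1 g2 g3
  rw [g3, g1, g2, dxCut, ballCut]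
  split_ifs with hR
  · simp only [g', hgone ξ hR]
    ring
  · simp

end Solution

/-! ### Conservation of mass and energy -/

section Conservation

variable {k m : ℕ} {s : ℝ} {T : EReal} {u : ℝ → L2}

theorem sqrt_mul_rpow {R : ℝ} (hR : 0 < R) (s : ℝ) : √R * R ^ (-s / 2) = R ^ ((1 - s) / 2) := by
  rw [Real.sqrt_eq_rpow, ← Real.rpow_add hR]
  congr 1
  ring

theorem tendsto_rpow_cutoff {s : ℝ} (hs : 2 < s) :
    Tendsto (fun n : ℕ => ((n : ℝ) + 1) ^ ((1 - s) / 2)) atTop (𝓝 0) := by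
  have h1 : Tendsto (fun n : ℕ => (n : ℝ) + 1) atTop atTop :=
    tendsto_atTop_add_const_right _ _ tendsto_natCast_atTop_atTop
  have h2 := (tendsto_rpow_neg_atTop (y := (s - 1) / 2) (by linarith)).comp h1
  refine h2.congr fun n => ?_
  rw [Function.comp_apply]
  congr 1
  ring

theorem tendsto_zLift_truncate {v : L2} (hs : 2 < s) (hv : MemMul (jbPow s) (fourierL2 v)) :
    Tendsto (fun n : ℕ => ‖zLift 1 (truncate ((n : ℝ) + 1) v - v)‖) atTop (𝓝 0) := by
  have h1 := ((tendsto_rpow_cutoff hs).const_mul 2).mul_const ‖hsLift s v‖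
  rw [mul_zero, zero_mul] at h1
  refine squeeze_zero (fun n => norm_nonneg _) (fun n => ?_) h1
  have hZ := memZ_of_jbPow (by linarith) hv
  rw [zLift_sub zero_le_one (hZ.truncate _) hZ, norm_sub_rev,
    ← zLift_sub zero_le_one hZ (hZ.truncate _)]
  exact norm_zLift_sub_truncate_le (by linarith) (by positivity) hv

theorem tendsto_norm_sq_truncate {v : L2} (hs : 2 < s) (hv : MemMul (jbPow s) (fourierL2 v)) :
    Tendsto (fun n : ℕ => ‖truncate ((n : ℝ) + 1) v‖ ^ 2) atTop (𝓝 (‖v‖ ^ 2)) := by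
  have hZ := memZ_of_jbPow (by linarith) hv
  have h : Tendsto (fun n : ℕ => truncate ((n : ℝ) + 1) v) atTop (𝓝 v) := by
    rw [tendsto_iff_norm_sub_tendsto_zero]
    exact squeeze_zero (fun n => norm_nonneg _)
      (fun n => norm_le_norm_zLift ((hZ.truncate _).sub hZ)) (tendsto_zLift_truncate hs hv)
  exact h.norm.pow 2

/-- A functional whose rate of change along truncations is `O(R^((1-s)/2))` is conserved. -/
theorem eq_of_truncate {b A : ℝ} (hs : 2 < s) {Φ : L2 → ℝ} {Φ' : ℕ → ℝ → ℝ}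
    (hb0 : 0 ≤ b)
    (hd : ∀ (n : ℕ), ∀ t ∈ Set.Icc 0 b,
      HasDerivWithinAt (fun τ => Φ (truncate ((n : ℝ) + 1) (u τ))) (Φ' n t) (Set.Icc 0 b) t)
    (hA : ∀ (n : ℕ), ∀ t ∈ Set.Icc 0 b, |Φ' n t| ≤ A * ((n : ℝ) + 1) ^ ((1 - s) / 2))
    (hc : ∀ t ∈ Set.Icc 0 b,
      Tendsto (fun n : ℕ => Φ (truncate ((n : ℝ) + 1) (u t))) atTop (𝓝 (Φ (u t)))) :
    Φ (u b) = Φ (u 0) := by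
  have h0 : (0 : ℝ) ∈ Set.Icc 0 b := Set.left_mem_Icc.2 hb0
  have h1 : b ∈ Set.Icc 0 b := Set.right_mem_Icc.2 hb0
  have h2 := ((tendsto_rpow_cutoff hs).const_mul A).mul_const ‖b - 0‖
  rw [mul_zero, zero_mul] at h2
  have h3 : Tendsto (fun n : ℕ => Φ (truncate ((n : ℝ) + 1) (u b)) -
      Φ (truncate ((n : ℝ) + 1) (u 0))) atTop (𝓝 0) :=
    squeeze_zero_norm (fun n => (convex_Icc 0 b).norm_image_sub_le_of_norm_hasDerivWithin_le
      (f := fun τ => Φ (truncate ((n : ℝ) + 1) (u τ))) (hd n) (hA n) h0 h1) h2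
  exact sub_eq_zero.1 (tendsto_nhds_unique ((hc b h1).sub (hc 0 h0)) h3)

theorem hasDerivWithinAt_norm_sq {V : ℝ → CL2} {V' : CL2} {S : Set ℝ} {t : ℝ}
    (h : HasDerivWithinAt V V' S t) :
    HasDerivWithinAt (fun τ => ‖V τ‖ ^ 2) (2 * (inner ℂ (V t) V' : ℂ).re) S t := by
  have h1 := Complex.reCLM.hasFDerivAt.comp_hasDerivWithinAt t (h.inner ℂ h)
  have e : (fun τ => ‖V τ‖ ^ 2) = Complex.reCLM ∘ fun τ => inner ℂ (V τ) (V τ) := by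
    funext τ
    simp only [Function.comp_apply, Complex.reCLM_apply]
    rw [inner_self_eq_norm_sq_to_K, RCLike.ofReal_eq_complex_ofReal, ← Complex.ofReal_pow,
      Complex.ofReal_re]
  rw [e]
  refine h1.congr_deriv ?_
  rw [Complex.reCLM_apply, Complex.add_re, ← inner_conj_symm V', Complex.conj_re]
  ring

/-- Conservation of mass. -/
theorem IsSolution.norm_sq_eq (h : IsSolution k m (-1) 1 s T u) (hs : 2 < s) (hk : 0 < k)
    (hm : Odd m) {b : ℝ} (hb0 : 0 ≤ b) (hb : (b : EReal) < T) : ‖u b‖ ^ 2 = ‖u 0‖ ^ 2 := by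
  have hf := isPrimitive_oddPow hk hm
  have hlt : ∀ τ ∈ Set.Icc 0 b, (τ : EReal) < T := fun τ hτ =>
    (EReal.coe_le_coe_iff.2 hτ.2).trans_lt hb
  obtain ⟨B, K, hB0, hB⟩ := h.exists_bound hs hb
  obtain ⟨C, hC, hL⟩ := hf.lipschitz K
  refine eq_of_truncate (Φ := fun v => ‖v‖ ^ 2) (A := 2 * (B * (C * B)))
    (Φ' := fun n t => 2 * (inner ℂ (fourierL2 (truncate ((n : ℝ) + 1) (u t)))
      (mulFn (dxCut ((n : ℝ) + 1)) (gradHat (flux k m) (u t))) : ℂ).re) hs hb0 (fun n t ht => ?_)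
    (fun n t ht => ?_) (fun t ht => tendsto_norm_sq_truncate hs (h.memMul_jbPow ht.1 (hlt t ht)))
  · have := hasDerivWithinAt_norm_sq (h.hasDerivWithinAt_truncate hs hk hm hb0 hb ((n : ℝ) + 1) t ht)
    simpa only [norm_fourierL2] using this
  · have hmem := h.memMul_jbPow ht.1 (hlt t ht)
    set R := (n : ℝ) + 1 with hR
    have hRpos : 0 < R := by positivity
    rw [re_inner_mass hf (memMul_wtZero hs.le hmem) ((hB t ht).2.2 R), ← sqrt_mul_rpow hRpos,
      abs_mul, abs_two, mul_assoc]
    refine mul_le_mul_of_nonneg_left ?_ zero_le_two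
    -- The cut-off derivative costs `√R`, while `f(u) - f(v)` gains `R^{-s/2}` from the truncation
    -- error of `u`; the product is `R^{(1-s)/2}`.
    refine (Complex.abs_re_le_norm _).trans ((norm_inner_le_norm _ _).trans ?_)
    rw [← fourierL2_sub, norm_fourierL2]
    have h1 := norm_mulFn_dxCut_le R (fourierL2 (truncate R (u t)))
    have h2 : ‖fourierL2 (truncate R (u t))‖ ≤ B := by
      rw [fourierL2_truncate]
      have h3 := norm_mulFn_le (memMul_ballCut R (fourierL2 (u t))) (norm_ballCut_le R)
      rw [one_mul, norm_fourierL2] at h3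
      exact h3.trans ((norm_le_norm_hsLift (by linarith) hmem).trans (hB t ht).1)
    have h3 := hf.norm_compL2_sub_le hL (hB t ht).2.1 ((hB t ht).2.2 R)
    have h4 : ‖u t - truncate R (u t)‖ ≤ R ^ (-s / 2) * B :=
      (norm_sub_truncate_le (by linarith) hRpos hmem).trans (by gcongr; exact (hB t ht).1)
    calc _ ≤ (√R * B) * (C * (R ^ (-s / 2) * B)) := by
          refine mul_le_mul (h1.trans (by gcongr)) (h3.trans (by gcongr)) (norm_nonneg _)
            (by positivity)
      _ = _ := by ring

/-- Conservation of energy. -/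
theorem IsSolution.energyE_eq (h : IsSolution k m (-1) 1 s T u) (hs : 2 < s) (hk : 0 < k)
    (hm : Odd m) (hp43 : (k : ℝ) / m < 4 / 3) {b : ℝ} (hb0 : 0 ≤ b) (hb : (b : EReal) < T) :
    energyE k m (u b) = energyE k m (u 0) := by
  have hf := isPrimitive_oddPow hk hm
  have hlt : ∀ τ ∈ Set.Icc 0 b, (τ : EReal) < T := fun τ hτ =>
    (EReal.coe_le_coe_iff.2 hτ.2).trans_lt hb
  obtain ⟨B, K, hB0, hB⟩ := h.exists_bound hs hb
  obtain ⟨C, hC, hL⟩ := hf.lipschitz K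
  obtain ⟨D, hD⟩ := isCompact_Icc.exists_bound_of_continuousOn (h.continuousOn_gradHat hs hk hm hb)
  have hZ : ∀ t ∈ Set.Icc 0 b, MemZ (u t) := fun t ht =>
    memZ_of_jbPow (by linarith) (h.memMul_jbPow ht.1 (hlt t ht))
  refine eq_of_truncate (Φ := energyE k m) (A := B * C * D)
    (Φ' := fun n t => (inner ℂ (fourierL2 (compL2 (flux k m) (u t)) -
      fourierL2 (compL2 (flux k m) (truncate ((n : ℝ) + 1) (u t))))
        (mulFn (dxCut ((n : ℝ) + 1)) (gradHat (flux k m) (u t))) : ℂ).re)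
    hs hb0 (fun n t ht => ?_) (fun n t ht => ?_) (fun t ht => ?_)
  · set R := (n : ℝ) + 1 with hR
    have hV := h.hasDerivWithinAt_truncate hs hk hm hb0 hb R t ht
    have h1 := hasDerivWithinAt_norm_sq
      (hasDerivWithinAt_mulFn (measurable_sqwt_ballCut R) (norm_sqwt_ballCut_le R) hV)
    have h2 := hf.hasDerivWithinAt_functionalJ hC hL ht hV (fun τ hτ => (hB τ hτ).2.2 R)
    have h3 := (h1.const_mul (1 / 2)).sub h2
    -- The quadratic part contributes the pairing with `f(u)` and the potential part that with
    -- `f(v)`, `v` the truncation; only their difference survives.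
    rw [re_inner_energy (memMul_wtZero hs.le (h.memMul_jbPow ht.1 (hlt t ht)))] at h3
    refine (h3.congr_of_mem (fun τ hτ => ?_) ht).congr_deriv ?_
    · rw [energyE_eq_zLift ((hZ τ hτ).truncate R), zLift_truncate R (hZ τ hτ)]
      rfl
    · rw [inner_sub_left, Complex.sub_re]
      ring
  · have hmem := h.memMul_jbPow ht.1 (hlt t ht)
    set R := (n : ℝ) + 1 with hR
    have hRpos : 0 < R := by positivity
    rw [← sqrt_mul_rpow hRpos]
    refine (Complex.abs_re_le_norm _).trans ((norm_inner_le_norm _ _).trans ?_)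
    rw [← fourierL2_sub, norm_fourierL2]
    have h1 := (norm_mulFn_dxCut_le R (gradHat (flux k m) (u t))).trans
      (mul_le_mul_of_nonneg_left (hD t ht) (Real.sqrt_nonneg R))
    have h3 := hf.norm_compL2_sub_le hL (hB t ht).2.1 ((hB t ht).2.2 R)
    have h4 : ‖u t - truncate R (u t)‖ ≤ R ^ (-s / 2) * B :=
      (norm_sub_truncate_le (by linarith) hRpos hmem).trans (by gcongr; exact (hB t ht).1)
    calc _ ≤ (C * (R ^ (-s / 2) * B)) * (√R * D) := by
          refine mul_le_mul (h3.trans (by gcongr)) h1 (norm_nonneg _) (by positivity)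
      _ = _ := by ring
  · have := (tendsto_energyE_sub hk hm hp43 (φ := fun _ => u t) (K := ‖zLift 1 (u t)‖)
      (fun _ => hZ t ht) (fun n => (hZ t ht).truncate _) (fun _ => le_rfl)
      (tendsto_zLift_truncate hs (h.memMul_jbPow ht.1 (hlt t ht)))).add_const (energyE k m (u t))
    simpa using this

end Conservation

/-! ### Orbital stability -/

/-- Orbital stability of the set of minimizers. -/
theorem IsLevel.stable {k m : ℕ} {c lam S : ℝ} (h : IsLevel k m c lam S) {ε : ℝ} (hε : 0 < ε) :
    ∃ δ : ℝ, 0 < δ ∧ ∀ s : ℝ, 2 < s → ∀ (T : EReal) (u : ℝ → L2),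
      IsSolution k m (-1) 1 s T u →
      (∃ φ ∈ minimizers k m c lam, zNorm (u 0 - φ) ≤ ENNReal.ofReal δ) →
      ∀ t : ℝ, 0 ≤ t → (t : EReal) < T →
        (⨅ ψ ∈ minimizers k m c lam, zNorm (u t - ψ)) ≤ ENNReal.ofReal ε := by
  by_contra hcon
  push Not at hcon
  -- Of the flow only this survives: `v` is the initial value, `w` the value at a time where
  -- stability fails, and they have equal mass and energy.
  have hex : ∀ n : ℕ, ∃ φ ∈ minimizers k m c lam, ∃ v w : L2, MemZ v ∧ MemZ w ∧
      zNorm (v - φ) ≤ ENNReal.ofReal (1 / ((n : ℝ) + 1)) ∧ ‖w‖ ^ 2 = ‖v‖ ^ 2 ∧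
      energyE k m w = energyE k m v ∧
      ∀ ψ ∈ minimizers k m c lam, ENNReal.ofReal ε < zNorm (w - ψ) := by
    intro n
    obtain ⟨s, hs, T, u, hu, ⟨φ, hφ, hd⟩, t, ht, hT, hlt⟩ := hcon (1 / ((n : ℝ) + 1)) (by positivity)
    have h0T : ((0 : ℝ) : EReal) < T := (EReal.coe_le_coe_iff.2 ht).trans_lt hT
    exact ⟨φ, hφ, u 0, u t, memZ_of_jbPow (by linarith) (hu.memMul_jbPow le_rfl h0T),
      memZ_of_jbPow (by linarith) (hu.memMul_jbPow ht hT), hd, hu.norm_sq_eq hs h.hk h.hm ht hT,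
      hu.energyE_eq hs h.hk h.hm h.hp43 ht hT,
      fun ψ hψ => hlt.trans_le (iInf₂_le ψ hψ)⟩
  choose φ hφ v w hv hw hd hM hE hψ using hex
  have hφK : ∀ n, ‖zLift 1 (φ n)‖ ≤ (√(min c 1))⁻¹ * √(2 * minI k m c lam) := fun n => by
    refine (norm_zLift_one_le h.hc (hφ n).1).trans ?_
    gcongr
    refine Real.le_sqrt_of_sq_le ?_
    rw [norm_zLift_sq h.hc.le (hφ n).1, (hφ n).2.1]
  have hconv : Tendsto (fun n => ‖zLift 1 (v n - φ n)‖) atTop (𝓝 0) := by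
    refine squeeze_zero (fun n => norm_nonneg _) (fun n => ?_)
      (tendsto_one_div_add_atTop_nhds_zero_nat (𝕜 := ℝ))
    have h1 := hd n
    rw [zNorm_eq ((hv n).sub (hφ n).1), ← ofReal_norm] at h1
    exact (ENNReal.ofReal_le_ofReal_iff (by positivity)).1 h1
  have hEw : Tendsto (fun n => energyE k m (w n)) atTop (𝓝 (energyE k m (φ 0))) := by
    have h1 := (tendsto_energyE_sub h.hk h.hm h.hp43 (fun n => (hφ n).1) hv hφK hconv).add_const
      (energyE k m (φ 0))
    rw [zero_add] at h1
    refine h1.congr fun n => ?_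
    -- The minimizer `φ n` varies with `n`, but its energy does not, so `φ 0` can serve as a fixed
    -- reference.
    rw [hE, h.energyE_eq (hφ 0), h.energyE_eq (hφ n), sub_add_cancel]
  have hMw : Tendsto (fun n => ‖w n‖ ^ 2) atTop (𝓝 (‖φ 0‖ ^ 2)) := by
    have hnφ : ∀ n, ‖φ n‖ = ‖φ 0‖ := fun n => by
      have h1 := (h.norm_sq_eq (hφ n)).trans (h.norm_sq_eq (hφ 0)).symm
      exact (sq_eq_sq₀ (norm_nonneg _) (norm_nonneg _)).1 h1
    have h1 : Tendsto (fun n => ‖v n‖ - ‖φ 0‖) atTop (𝓝 0) := by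
      refine squeeze_zero_norm (fun n => ?_) hconv
      rw [← hnφ n, Real.norm_eq_abs]
      exact (abs_norm_sub_norm_le _ _).trans (norm_le_norm_zLift ((hv n).sub (hφ n).1))
    have h2 := (h1.add_const ‖φ 0‖).pow 2
    rw [zero_add] at h2
    refine h2.congr fun n => ?_
    rw [sub_add_cancel, hM]
  obtain ⟨hI, hJ⟩ := h.tendsto_of_energyE (hφ 0) hw hMw hEw
  obtain ⟨g, σ, a, -, hg, hlim⟩ := h.exists_translate hw hI hJ
  obtain ⟨n, hn⟩ := (hlim.eventually_lt_const hε).exists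
  -- The set of minimizers is translation invariant, so the translation is undone on the limit
  -- rather than on the solution, contradicting the choice of `w`.
  have hmin : translate (-a n) g ∈ minimizers k m c lam :=
    ⟨hg.1.translate _, (energyI_translate _ c g).trans hg.2.1,
      (functionalJ_translate _ _ g).trans hg.2.2⟩
  refine absurd (hψ (σ n) _ hmin) (not_lt.2 ?_)
  have e : w (σ n) - translate (-a n) g =
      translate (-a n) (translate (a n) (w (σ n)) - g) := by
    rw [translate_sub, translate_neg_translate]
  rw [e, zNorm_translate, zNorm_eq (((hw _).translate _).sub hg.1), ← ofReal_norm]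
  exact ENNReal.ofReal_le_ofReal hn.le

end BOZK

end

theorem theorem3p8 (k m : ℕ) (hk : 0 < k) (hm : Odd m) (hkm : Nat.Coprime k m)
    (p : ℝ) (hp : p = (k : ℝ) / m) (hp43 : p < 4 / 3)
    (c : ℝ) (hc : 0 < c)
    (lam : ℝ) (hlam : lam = (2 * (p + 1) * BOZK.minI k m c 1) ^ ((p + 2) / p)) :
    BOZK.groundSet k m c lam = BOZK.minimizers k m c lam ∧
    ∀ ε : ℝ, 0 < ε → ∃ δ : ℝ, 0 < δ ∧
      ∀ s : ℝ, 2 < s → ∀ (T : EReal) (u : ℝ → BOZK.L2),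
        BOZK.IsSolution k m (-1) 1 s T u →
        (∃ φ ∈ BOZK.groundSet k m c lam, BOZK.zNorm (u 0 - φ) ≤ ENNReal.ofReal δ) →
        (⨆ (t : ℝ) (_ : 0 ≤ t ∧ (t : EReal) < T),
          ⨅ ψ ∈ BOZK.groundSet k m c lam, BOZK.zNorm (u t - ψ)) ≤ ENNReal.ofReal ε := by
  have h := BOZK.isLevel hk hm hp hp43 hc hlam
  rw [h.groundSet_eq]
  refine ⟨rfl, fun ε hε => ?_⟩
  obtain ⟨δ, hδ, hst⟩ := h.stable hε
  exact ⟨δ, hδ, fun s hs T u hu hφ => iSup₂_le fun t ht => hst s hs T u hu hφ t ht.1 ht.2⟩
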